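/- Let $n\ge 3$, let $\bar e\in\mathbb S^{n-1}$ be a fixed pole, and write $\omega_k=\pi^{k/2}/\Gamma(1+k/2)$ for the volume of the unit ball of $\mathbb R^k$ and $|\cdot|$ for Hausdorff measure of the appropriate dimension. Let $\mu$ be a non-negative Borel measure on $\mathbb S^{n-1}$ with $\mu(\mathbb S^{n-1})=\frac12$ which is even (antipodal sets have equal measure) and zonal (invariant under the stabilizer of $\bar e$ in $\mathrm{SO}(n)$). Let $Z^\mu(\bar e)$ be the convex body with support function $h(Z^\mu(\bar e),v)=\int_{\mathbb S^{n-1}}|v\cdot w|\,d\mu(w)$, and for $u\in\mathbb S^{n-1}$ let $Z^\mu(u)=\vartheta Z^\mu(\bar e)$, where $\vartheta\in\mathrm{SO}(n)$ is any rotation with $\vartheta\bar e=u$. Let $L\subseteq\mathbb R^n$ be a Lebesgue measurable set with nonempty interior and of finite perimeter, that is, $\sup\{\int_L\operatorname{div}\phi\,dx:\phi\in C^1_c(\mathbb R^n,\mathbb R^n),\ \|\phi\|_\infty\le1\}<\infty$. Let $D1_L$ be the weak gradient of the indicator function of $L$, a finite $\mathbb R^n$-valued measure with total variation $|D1_L|$.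 The reduced boundary $\partial^*L$ is the set of boundary points $x$ of $L$ at which $\lim_{r\to0^+}D1_L(B_r(x))/|D1_L|(B_r(x))$ exists and is a unit vector; the outer normal $\nu_L(x)$ is the negative of this limit. Then $|\partial^*L|<\infty$, and there are convex bodies $\Pi L$ and $\Phi^\mu L$ with support functions $$h(\Pi L,u)=\tfrac12\int_{\partial^*L}|u\cdot\nu_L(x)|\,dx,\qquad h(\Phi^\mu L,u)=\int_{\partial^*L}h(Z^\mu(u),\nu_L(x))\,dx,\qquad u\in\mathbb S^{n-1}.$$ Let $\Pi^\circ L$ and $\Phi^{\mu,\circ}L$ be their polars, where $K^\circ=\{x: x\cdot y\le1\text{ for all }y\in K\}$. Then $$\frac{n^n\omega_n^{n+1}}{\omega_{n-1}^n}\,|\partial^*L|^{-n}\ \le\ |\Phi^{\mu,\circ}L|\ \le\ |\Pi^\circ L|.$$ Equality holds on the left if and only if $\Phi^\mu L$ is a Euclidean ball, and on the right if and only if $\mu$ is discrete (concentrated on a countable set) or $\Pi L$ is a Euclidean ball. (If $\mathbb R^n\setminus L$ is a null set, then $|\partial^*L|=0$ and $\Pi L=\Phi^\mu L=\{0\}$;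 in this case read $0^{-n}=\infty$ and count $\{0\}$ as a ball. Otherwise all the quantities in the inequalities are positive and finite.) Consequently, for each such $L$, Petty's inequality $|\Pi^\circ L||L|^{n-1}\le(\omega_n/\omega_{n-1})^n$ implies the inequality $|\Phi^{\mu,\circ}L||L|^{n-1}\le(\omega_n/\omega_{n-1})^n$, and the latter implies the isoperimetric inequality $n^n\omega_n|L|^{n-1}\le|\partial^*L|^n$. -/

import Mathlib

open MeasureTheory Metric Set Filter Topology
open scoped ENNReal RealInnerProductSpace

noncomputable section

namespace IsoZonal

/-- Euclidean space `ℝⁿ`. -/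
abbrev Eucl (n : ℕ) : Type := EuclideanSpace ℝ (Fin n)

/-- The unit sphere `𝕊ⁿ⁻¹` of `ℝⁿ`. -/
abbrev USphere (n : ℕ) : Type := sphere (0 : Eucl n) 1

/-- `ω_k = π^(k/2) / Γ(1 + k/2)`, the volume of the unit ball of `ℝᵏ`. -/
def omega (k : ℕ) : ℝ := Real.pi ^ ((k : ℝ) / 2) / Real.Gamma (1 + (k : ℝ) / 2)

variable {n : ℕ}

/-! ### Sets of finite perimeter -/

/-- The divergence of a vector field on `ℝⁿ`. -/
def divergence (φ : Eucl n → Eucl n) (x : Eucl n) : ℝ :=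
  ∑ i, (fderiv ℝ φ x (EuclideanSpace.single i 1)) i

/-- `φ ∈ C_c¹(ℝⁿ, ℝⁿ)`. -/
def IsTestField (φ : Eucl n → Eucl n) : Prop :=
  ContDiff ℝ 1 φ ∧ HasCompactSupport φ

/-- The perimeter `P(L) = sup { ∫_L div φ : φ ∈ C_c¹(ℝⁿ, ℝⁿ), ‖φ‖_∞ ≤ 1 }`. The supremum is
taken in `[0, ∞]`; negative values do not matter, because `φ = 0` is admissible. -/
def perimeter (L : Set (Eucl n)) : ℝ≥0∞ :=
  ⨆ (φ : Eucl n → Eucl n) (_ : IsTestField φ) (_ : ∀ x, ‖φ x‖ ≤ 1),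
    ENNReal.ofReal (∫ x in L, divergence φ x)

/-- A Lebesgue measurable set of finite perimeter. -/
def HasFinitePerimeter (L : Set (Eucl n)) : Prop :=
  NullMeasurableSet L ∧ perimeter L < ∞

/-- `D` is the weak gradient of the indicator function of `L`: a finite `ℝⁿ`-valued Borel measure
with `∫_L div φ dx = - ∫ φ · dD` for all `φ ∈ C_c¹(ℝⁿ, ℝⁿ)`. -/
def IsGradMeasure (L : Set (Eucl n)) (D : VectorMeasure (Eucl n) (Eucl n)) : Prop :=
  D.variation univ < ∞ ∧
    ∀ φ : Eucl n → Eucl n, IsTestField φ →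
      ∫ x in L, divergence φ x = - ∫ᵛ x, φ x ∂[innerSL ℝ; D]

open Classical in
/-- The weak gradient `D 1_L` of the indicator function of `L`. For a set of finite perimeter it
exists (by the Riesz representation theorem) and is unique; the value `0` is used for all other
sets. -/
def gradMeasure (L : Set (Eucl n)) : VectorMeasure (Eucl n) (Eucl n) :=
  if h : ∃ D, IsGradMeasure L D then h.choose else 0

/-- The quotient `D 1_L (B_r(x)) / |D 1_L| (B_r(x))`, where `|D 1_L|` is the total variation. If
the denominator vanishes, then so does the numerator, and the quotient is read as `0` (which is not
a unit vector). -/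
def gradRatio (L : Set (Eucl n)) (x : Eucl n) (r : ℝ) : Eucl n :=
  ((gradMeasure L).variation (closedBall x r)).toReal⁻¹ • gradMeasure L (closedBall x r)

/-- The reduced boundary `∂*L`. -/
def reducedBoundary (L : Set (Eucl n)) : Set (Eucl n) :=
  {x | x ∈ frontier L ∧
    ∃ v : Eucl n, ‖v‖ = 1 ∧ Tendsto (gradRatio L x) (𝓝[>] 0) (𝓝 v)}

/-- The measure theoretic outer unit normal `ν_L` (meaningful on `∂*L`); the sign is there because
the weak gradient of `1_L` points into `L`. -/
def outerNormal (L : Set (Eucl n)) (x : Eucl n) : Eucl n :=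
  - limUnder (𝓝[>] (0 : ℝ)) (gradRatio L x)

/-- The `(n-1)`-dimensional Hausdorff measure on `ℝⁿ`, in the normalization for which
`k`-dimensional Hausdorff measure agrees with Lebesgue measure on `ℝᵏ`. -/
def surfaceMeasure (n : ℕ) : Measure (Eucl n) := Measure.euclideanHausdorffMeasure (n - 1)

/-- `|∂*L|`. -/
def surfaceArea (L : Set (Eucl n)) : ℝ≥0∞ := surfaceMeasure n (reducedBoundary L)

/-! ### Convex bodies -/

/-- The support function `h(K, u) = max { u · x : x ∈ K }`. -/
def supportFn (K : Set (Eucl n)) (u : Eucl n) : ℝ := sSup ((fun x => ⟪u, x⟫) '' K)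

/-- `K` is a convex body (nonempty, compact, convex) with `h(K, u) = h u` for all unit vectors
`u`. -/
def IsConvexBodyWithSupport (K : Set (Eucl n)) (h : Eucl n → ℝ) : Prop :=
  Convex ℝ K ∧ IsCompact K ∧ K.Nonempty ∧
    ∀ u : Eucl n, ‖u‖ = 1 → IsGreatest ((fun x => ⟪u, x⟫) '' K) (h u)

/-- The set `{ x : u · x ≤ h u for all unit vectors u }`. If there is a convex body whose
support function is `h`, then it is this set. -/
def bodyOf (h : Eucl n → ℝ) : Set (Eucl n) := {x | ∀ u : Eucl n, ‖u‖ = 1 → ⟪u, x⟫ ≤ h u}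

/-- The polar `K° = { x : x · y ≤ 1 for all y ∈ K }`. -/
def polarBody (K : Set (Eucl n)) : Set (Eucl n) := {x | ∀ y ∈ K, ⟪x, y⟫ ≤ 1}

/-- `K` is a Euclidean ball. -/
def IsBall (K : Set (Eucl n)) : Prop := ∃ (c : Eucl n) (r : ℝ), 0 ≤ r ∧ K = closedBall c r

/-! ### Measures on the sphere and their zonoids -/

/-- `ϑ ∈ SO(n)`. -/
def IsRotation (ϑ : Eucl n ≃ₗᵢ[ℝ] Eucl n) : Prop :=
  LinearMap.det (ϑ.toLinearEquiv : Eucl n →ₗ[ℝ] Eucl n) = 1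

/-- The action of an orthogonal map on the unit sphere. -/
def sphereMap (ϑ : Eucl n ≃ₗᵢ[ℝ] Eucl n) (v : USphere n) : USphere n :=
  ⟨ϑ v, by simp⟩

/-- `μ` is even: antipodal sets have the same measure. -/
def IsEvenMeasure (μ : Measure (USphere n)) : Prop := μ.map (fun v => -v) = μ

/-- `μ` is zonal with pole `e`: it is invariant under the stabilizer of `e` in `SO(n)`. -/
def IsZonal (e : USphere n) (μ : Measure (USphere n)) : Prop :=
  ∀ ϑ : Eucl n ≃ₗᵢ[ℝ] Eucl n, IsRotation ϑ → sphereMap ϑ e = e → μ.map (sphereMap ϑ) = μ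

/-- `μ` is discrete: it is concentrated on a countable set. -/
def IsDiscreteMeasure (μ : Measure (USphere n)) : Prop :=
  ∃ S : Set (USphere n), S.Countable ∧ μ Sᶜ = 0

/-- The zonoid `Z^μ` generated by `μ`: the convex body with
`h(Z^μ, v) = ∫ |v · w| dμ(w)`. For zonal `μ` with pole `e` this is `Z^μ(e)`. -/
def zonoid (μ : Measure (USphere n)) : Set (Eucl n) :=
  bodyOf fun v => ∫ w : USphere n, |⟪v, (w : Eucl n)⟫| ∂μ

/-- `Z^μ(u)`, the rotated copy of `Z^μ(e)` whose axis of symmetry is `u`. The rotated copies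
`ϑ Z^μ(e)` with `ϑ ∈ SO(n)` and `ϑ e = u` are all the same set, as `μ` is zonal with pole `e`; so
their union is that set. -/
def zonoidAt (μ : Measure (USphere n)) (e : USphere n) (u : Eucl n) : Set (Eucl n) :=
  {x | ∃ ϑ : Eucl n ≃ₗᵢ[ℝ] Eucl n, IsRotation ϑ ∧ ϑ (e : Eucl n) = u ∧ x ∈ ϑ '' zonoid μ}

/-! ### The bodies `Π L` and `Φ^μ L` -/

/-- The right hand side in the definition `h(Π L, u) = (1/2) ∫_{∂*L} |u · ν_L(x)| dx`. -/
def projSupport (L : Set (Eucl n)) (u : Eucl n) : ℝ :=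
  (1 / 2) * ∫ x in reducedBoundary L, |⟪u, outerNormal L x⟫| ∂(surfaceMeasure n)

/-- The projection body `Π L`. -/
def projBody (L : Set (Eucl n)) : Set (Eucl n) := bodyOf (projSupport L)

/-- The right hand side in the definition `h(Φ^μ L, u) = ∫_{∂*L} h(Z^μ(u), ν_L(x)) dx`. -/
def phiSupport (μ : Measure (USphere n)) (e : USphere n) (L : Set (Eucl n)) (u : Eucl n) : ℝ :=
  ∫ x in reducedBoundary L, supportFn (zonoidAt μ e u) (outerNormal L x) ∂(surfaceMeasure n)

/-- The convex body `Φ^μ L`. -/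
def phiBody (μ : Measure (USphere n)) (e : USphere n) (L : Set (Eucl n)) : Set (Eucl n) :=
  bodyOf (phiSupport μ e L)

end IsoZonal

end

open IsoZonal

open MeasureTheory Metric Set Filter Topology
open scoped ENNReal RealInnerProductSpace
open IsoZonal

noncomputable section

namespace IsoZonal

variable {n : ℕ}

/-! ### The special orthogonal group -/

/-! Let σ be surface measure on the reduced boundary, ν the outer normal, P(u) = h(ΠL, u) and Q(u) =
h(Φ^μ L, u). Some rotation exchanges two given unit vectors u and v, so h(Z(u), v) = h(Z(v), u)
(`zonoidSupport_symm`); hence Q extends to a sublinear function. Fubini then gives Q(ϑe) = ∫ P(ϑw)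
d(2μ)(w) (`zonalSupport_rot`): Q averages P against a probability measure. A polar volume is ω_n
times the mean over SO(n) of the (-n)-th power of the support function. Jensen's inequality for
t^(-n) in the variable w, followed by invariance of Haar measure, gives the right inequality
(`invPowMean_zonalSupport_le`). Jensen in ϑ gives the left one (`mean_inv_pow_le`), because Q and P
have the same mean, a multiple of |∂*L| by Cauchy's formula.

Equality on the left makes Q constant. Equality on the right makes P(ϑw) = Q(ϑe) for all ϑ and
almost all w. If μ is not carried by ±e, this holds for some w off the poles; then P is constant on
every parallel {x : ⟪u, x⟫ = t} with t = ⟪e, w⟫, nearby points share a parallel, and connectedness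
makes P constant (`eq_of_rot_eq`). If μ is carried by ±e, then Q = P.

About L this needs only |∂*L| < ∞, a measurable unit normal, and P > 0 unless σ = 0
(`reducedBoundary_regularity`). The weak gradient f τ, |f| = 1, comes from Riesz representation. At
points of ∂*L, the Gauss–Green formula and a translation estimate bound τ(B_r) above and below by
multiples of r^(n-1). The lower bound and a Vitali covering bound |∂*L|; the upper bound makes τ
vanish on H^(n-1)-null subsets of ∂*L. So P(u) = 0 forces ⟪u, f⟫ = 0 τ-a.e., L is then translation
invariant along u in the weak sense, and pushing test functions to infinity gives τ = 0. De Giorgi's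
full structure theorem is not used. -/

instance : ContinuousStar (Eucl n →L[ℝ] Eucl n) :=
  ⟨(ContinuousLinearMap.adjoint (𝕜 := ℝ) (E := Eucl n) (F := Eucl n)).continuous⟩

/-- The special orthogonal group of `ℝⁿ`, as a group of unitary operators. -/
def SOGroup (n : ℕ) : Subgroup (unitary (Eucl n →L[ℝ] Eucl n)) where
  carrier := {g | LinearMap.det ((g : Eucl n →L[ℝ] Eucl n) : Eucl n →ₗ[ℝ] Eucl n) = 1}
  one_mem' := by
    change LinearMap.det (LinearMap.id : Eucl n →ₗ[ℝ] Eucl n) = 1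
    simp
  mul_mem' {a b} ha hb := by
    change LinearMap.det (((a : Eucl n →L[ℝ] Eucl n) : Eucl n →ₗ[ℝ] Eucl n) *
      ((b : Eucl n →L[ℝ] Eucl n) : Eucl n →ₗ[ℝ] Eucl n)) = 1
    rw [map_mul, ha, hb, one_mul]
  inv_mem' {a} ha := by
    have h1 : LinearMap.det (((a⁻¹ : unitary _) : Eucl n →L[ℝ] Eucl n) : Eucl n →ₗ[ℝ] Eucl n) *
        LinearMap.det ((a : Eucl n →L[ℝ] Eucl n) : Eucl n →ₗ[ℝ] Eucl n) = 1 := by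
      rw [← map_mul]
      have : (((a⁻¹ : unitary _) : Eucl n →L[ℝ] Eucl n) : Eucl n →ₗ[ℝ] Eucl n) *
          ((a : Eucl n →L[ℝ] Eucl n) : Eucl n →ₗ[ℝ] Eucl n) = LinearMap.id := by
        ext1 x
        exact congrArg (fun u : unitary (Eucl n →L[ℝ] Eucl n) => (u : Eucl n →L[ℝ] Eucl n) x)
          (inv_mul_cancel a)
      rw [this, LinearMap.det_id]
    have ha' : LinearMap.det ((a : Eucl n →L[ℝ] Eucl n) : Eucl n →ₗ[ℝ] Eucl n) = 1 := ha
    rw [ha', mul_one] at h1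
    exact h1

/-- The isometry of `ℝⁿ` underlying an element of `SO(n)`. -/
def rot (g : SOGroup n) : Eucl n ≃ₗᵢ[ℝ] Eucl n := Unitary.linearIsometryEquiv g.1

lemma rot_apply (g : SOGroup n) (x : Eucl n) :
    rot g x = (g.1 : Eucl n →L[ℝ] Eucl n) x := rfl

lemma rot_isRotation (g : SOGroup n) : IsRotation (rot g) := g.2

lemma rot_mul (g h : SOGroup n) (x : Eucl n) : rot (g * h) x = rot g (rot h x) := rfl

lemma exists_SOGroup {ϑ : Eucl n ≃ₗᵢ[ℝ] Eucl n} (h : IsRotation ϑ) :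
    ∃ g : SOGroup n, rot g = ϑ :=
  ⟨⟨Unitary.linearIsometryEquiv.symm ϑ, h⟩, by
    ext1 x; rfl⟩

lemma continuous_rot : Continuous fun p : SOGroup n × Eucl n => rot p.1 p.2 := by
  simp only [rot_apply]
  exact ((continuous_subtype_val.comp continuous_subtype_val).comp continuous_fst).clm_apply
    continuous_snd

instance : CompactSpace (SOGroup n) := by
  have hcl : IsClosed ((fun g : SOGroup n => ((g.1 : Eucl n →L[ℝ] Eucl n))) '' univ) := by
    have : (fun g : SOGroup n => ((g.1 : Eucl n →L[ℝ] Eucl n))) '' univ =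
        (unitary (Eucl n →L[ℝ] Eucl n) : Set (Eucl n →L[ℝ] Eucl n)) ∩
        {A | LinearMap.det (A : Eucl n →ₗ[ℝ] Eucl n) = 1} := by
      ext A
      constructor
      · rintro ⟨g, -, rfl⟩
        exact ⟨g.1.2, g.2⟩
      · rintro ⟨h1, h2⟩
        exact ⟨⟨⟨A, h1⟩, h2⟩, trivial, rfl⟩
    rw [this]
    refine isClosed_unitary.inter (isClosed_eq ?_ continuous_const)
    exact ContinuousLinearMap.continuous_det
  have hbd : Bornology.IsBounded ((fun g : SOGroup n => ((g.1 : Eucl n →L[ℝ] Eucl n))) '' univ) := by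
    refine (isBounded_iff_forall_norm_le).2 ⟨1, ?_⟩
    rintro _ ⟨g, -, rfl⟩
    refine ContinuousLinearMap.opNorm_le_bound _ zero_le_one fun x => ?_
    rw [one_mul]
    exact ((rot g).norm_map x).le
  have hind : IsInducing (fun g : SOGroup n => ((g.1 : Eucl n →L[ℝ] Eucl n))) :=
    IsInducing.subtypeVal.comp IsInducing.subtypeVal
  exact ⟨hind.isCompact_iff.2 (isCompact_of_isClosed_isBounded hcl hbd)⟩

instance : SecondCountableTopology (SOGroup n) :=
  (show IsInducing (fun g : SOGroup n => ((g.1 : Eucl n →L[ℝ] Eucl n))) from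
    IsInducing.subtypeVal.comp IsInducing.subtypeVal).secondCountableTopology

instance : MeasurableSpace (SOGroup n) := borel _
instance : BorelSpace (SOGroup n) := ⟨rfl⟩

/-- The right-invariant Haar probability measure of `SO(n)`. -/
def haarSO (n : ℕ) : Measure (SOGroup n) :=
  (Measure.haarMeasure (⊤ : TopologicalSpace.PositiveCompacts (SOGroup n))).inv

/-- Right invariance is the side needed for orbit maps g ↦ g x: replacing x by k x translates g on
the right by k. This is why the left Haar measure is inverted. -/
instance : (haarSO n).IsMulRightInvariant := by unfold haarSO; infer_instance

instance : IsProbabilityMeasure (haarSO n) := by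
  refine ⟨?_⟩
  unfold haarSO
  rw [Measure.inv_apply, inv_univ]
  exact Measure.haarMeasure_self

instance : (haarSO n).IsOpenPosMeasure := by
  unfold haarSO
  refine ⟨fun U hU hne => ?_⟩
  rw [Measure.inv_apply]
  exact IsOpen.measure_ne_zero _ hU.inv (by simpa using hne)

/-! ### Transitivity -/

lemma exists_unit_orthogonal (hn : 3 ≤ n) (p q : Eucl n) :
    ∃ z : Eucl n, ‖z‖ = 1 ∧ ⟪z, p⟫ = 0 ∧ ⟪z, q⟫ = 0 := by
  set K := Submodule.span ℝ ({p, q} : Set (Eucl n))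
  have h1 : Module.finrank ℝ K ≤ 2 := by
    refine (finrank_span_le_card ({p, q} : Set (Eucl n))).trans ?_
    rw [Set.toFinset_insert, Set.toFinset_singleton]
    exact Finset.card_le_two
  have h2 := K.finrank_add_finrank_orthogonal
  rw [finrank_euclideanSpace_fin] at h2
  have h3 : Kᗮ ≠ ⊥ := by
    intro h
    rw [h, finrank_bot] at h2
    omega
  obtain ⟨z, hz, hz0⟩ := Submodule.exists_mem_ne_zero_of_ne_bot h3
  refine ⟨‖z‖⁻¹ • z, ?_, ?_, ?_⟩
  · rw [norm_smul, norm_inv, norm_norm, inv_mul_cancel₀ (norm_ne_zero_iff.2 hz0)]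
  · rw [real_inner_smul_left, real_inner_comm,
      (Submodule.mem_orthogonal _ _).1 hz p (Submodule.subset_span (by simp)), mul_zero]
  · rw [real_inner_smul_left, real_inner_comm,
      (Submodule.mem_orthogonal _ _).1 hz q (Submodule.subset_span (by simp)), mul_zero]

lemma reflection_fix {a x : Eucl n} (h : ⟪a, x⟫ = 0) : (ℝ ∙ a)ᗮ.reflection x = x :=
  Submodule.reflection_mem_subspace_eq_self (Submodule.mem_orthogonal_singleton_iff_inner_right.2 h)

/-- `SO(n)`, `n ≥ 3`, acts transitively on pairs of vectors with a given Gram matrix. -/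
lemma exists_rotation_pair (hn : 3 ≤ n) {e w u p : Eucl n} (h1 : ‖e‖ = ‖u‖) (h2 : ‖w‖ = ‖p‖)
    (h : ⟪e, w⟫ = ⟪u, p⟫) : ∃ g : SOGroup n, rot g e = u ∧ rot g w = p := by
  set R₁ := (ℝ ∙ (e - u))ᗮ.reflection with hR₁
  have hR₁e : R₁ e = u := Submodule.reflection_sub h1
  set w₁ := R₁ w with hw₁
  have hw₁n : ‖w₁‖ = ‖p‖ := by rw [hw₁, R₁.norm_map, h2]
  have hw₁u : ⟪u, w₁⟫ = ⟪u, p⟫ := by rw [← h, ← hR₁e, hw₁, R₁.inner_map_map]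
  set R₂ := (ℝ ∙ (w₁ - p))ᗮ.reflection with hR₂
  have hR₂w : R₂ w₁ = p := Submodule.reflection_sub hw₁n
  -- `w₁` and `p` have the same inner product with `u`, so `u` is orthogonal to `w₁ - p` and the
  -- second reflection does not disturb it.
  have hR₂u : R₂ u = u := reflection_fix (by
    rw [inner_sub_left, real_inner_comm, hw₁u, real_inner_comm, sub_self])
  -- A reflection fixing both `u` and `p` corrects the determinant when it is -1; the direction `z`
  -- exists because n ≥ 3.
  obtain ⟨z, hz, hzu, hzp⟩ := exists_unit_orthogonal hn u p
  set R₃ := (ℝ ∙ z)ᗮ.reflection with hR₃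
  set ϑ := R₁.trans R₂ with hϑ
  have hu : ϑ e = u := by rw [hϑ, LinearIsometryEquiv.trans_apply, hR₁e, hR₂u]
  have hp : ϑ w = p := by rw [hϑ, LinearIsometryEquiv.trans_apply]; exact hR₂w
  have hdet : LinearMap.det (ϑ.toLinearEquiv : Eucl n →ₗ[ℝ] Eucl n) = 1 ∨
      LinearMap.det (ϑ.toLinearEquiv : Eucl n →ₗ[ℝ] Eucl n) = -1 := by
    have : (ϑ.toLinearEquiv : Eucl n →ₗ[ℝ] Eucl n) =
      (R₂.toLinearEquiv : Eucl n →ₗ[ℝ] Eucl n) * (R₁.toLinearEquiv : Eucl n →ₗ[ℝ] Eucl n) := rfl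
    have h1 : LinearMap.det (R₁.toLinearEquiv : Eucl n →ₗ[ℝ] Eucl n) = _ :=
      Submodule.det_reflection _
    have h2 : LinearMap.det (R₂.toLinearEquiv : Eucl n →ₗ[ℝ] Eucl n) = _ :=
      Submodule.det_reflection _
    rw [this, map_mul, h1, h2, ← pow_add]
    exact neg_one_pow_eq_or ℝ _
  rcases hdet with hd | hd
  · obtain ⟨g, hg⟩ := exists_SOGroup (n := n) (ϑ := ϑ) hd
    exact ⟨g, by rw [hg, hu], by rw [hg, hp]⟩
  · have hd3 : IsRotation (ϑ.trans R₃) := by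
      have h3 : LinearMap.det (R₃.toLinearEquiv : Eucl n →ₗ[ℝ] Eucl n) = -1 := by
        have h4 := Submodule.det_reflection (𝕜 := ℝ) (ℝ ∙ z)ᗮ
        rw [Submodule.orthogonal_orthogonal, finrank_span_singleton (by
          rintro rfl; simp at hz), pow_one] at h4
        exact h4
      have : ((ϑ.trans R₃).toLinearEquiv : Eucl n →ₗ[ℝ] Eucl n) =
          (R₃.toLinearEquiv : Eucl n →ₗ[ℝ] Eucl n) * (ϑ.toLinearEquiv : Eucl n →ₗ[ℝ] Eucl n) := rfl
      rw [IsRotation, this, map_mul, h3, hd]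
      norm_num
    obtain ⟨g, hg⟩ := exists_SOGroup hd3
    refine ⟨g, ?_, ?_⟩
    · rw [hg, LinearIsometryEquiv.trans_apply, hu]
      exact reflection_fix hzu
    · rw [hg, LinearIsometryEquiv.trans_apply, hp]
      exact reflection_fix hzp

lemma exists_rotation (hn : 3 ≤ n) {e u : Eucl n} (h : ‖e‖ = ‖u‖) :
    ∃ g : SOGroup n, rot g e = u := by
  obtain ⟨g, hg, -⟩ := exists_rotation_pair hn h h
    (by rw [real_inner_self_eq_norm_sq, real_inner_self_eq_norm_sq, h])
  exact ⟨g, hg⟩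

/-- Two unit vectors that are close enough lie on a common subsphere `{x : ⟪u, x⟫ = t}`. -/
lemma exists_unit_inner_eq (hn : 3 ≤ n) {p q : Eucl n} (hp : ‖p‖ = 1) (hq : ‖q‖ = 1) {t : ℝ}
    (hpq : 2 * |t| ≤ ‖p + q‖) :
    ∃ u : Eucl n, ‖u‖ = 1 ∧ ⟪u, p⟫ = t ∧ ⟪u, q⟫ = t := by
  obtain ⟨z, hz, hzp, hzq⟩ := exists_unit_orthogonal hn p q
  have hsq : ‖p + q‖ ^ 2 = 2 + 2 * ⟪p, q⟫ := by
    rw [norm_add_sq_real, hp, hq]; ring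
  rcases eq_or_ne (‖p + q‖) 0 with h0 | h0
  · have ht0 : t = 0 := by
      rw [h0] at hpq
      exact abs_eq_zero.1 (le_antisymm (by linarith) (abs_nonneg t))
    exact ⟨z, hz, by rw [hzp, ht0], by rw [hzq, ht0]⟩
  · set N := ‖p + q‖ with hN
    have hNpos : 0 < N := lt_of_le_of_ne (norm_nonneg _) (Ne.symm h0)
    -- Since ⟪p + q, p⟫ = ⟪p + q, q⟫ = N²/2, this multiple of p + q has inner product t with both
    -- points. The orthogonal vector b z makes the norm 1, which is possible because |a| N ≤ 1.
    set a := 2 * t / N ^ 2 with ha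
    set b := Real.sqrt (1 - a ^ 2 * N ^ 2) with hb
    have haN : a ^ 2 * N ^ 2 ≤ 1 := by
      have : a ^ 2 * N ^ 2 = (2 * |t|) ^ 2 / N ^ 2 := by
        rw [ha, mul_pow, sq_abs]; field_simp
      rw [this, div_le_one (by positivity)]
      exact pow_le_pow_left₀ (by positivity) hpq 2
    have hzpq : ⟪z, p + q⟫ = 0 := by rw [inner_add_right, hzp, hzq, add_zero]
    refine ⟨a • (p + q) + b • z, ?_, ?_, ?_⟩
    · have : ‖a • (p + q) + b • z‖ ^ 2 = 1 := by
        rw [norm_add_sq_real, norm_smul, norm_smul, real_inner_smul_left, real_inner_smul_right,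
          real_inner_comm, hzpq, hz, mul_pow, mul_pow, Real.norm_eq_abs, Real.norm_eq_abs, sq_abs,
          sq_abs, hb, Real.sq_sqrt (by linarith)]
        ring
      nlinarith [norm_nonneg (a • (p + q) + b • z)]
    · rw [inner_add_left, real_inner_smul_left, real_inner_smul_left, hzp, inner_add_left,
        real_inner_self_eq_norm_sq, hp, real_inner_comm p q, ha]
      field_simp
      rw [hsq]; ring
    · rw [inner_add_left, real_inner_smul_left, real_inner_smul_left, hzq, inner_add_left,
        real_inner_self_eq_norm_sq, hq, ha]
      field_simp
      rw [hsq]; ring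

/-! ### Averages over the rotation group -/

lemma measurable_rot : Measurable fun p : SOGroup n × Eucl n => rot p.1 p.2 :=
  continuous_rot.measurable

lemma continuous_rot_apply (x : Eucl n) : Continuous fun g : SOGroup n => rot g x :=
  continuous_rot.comp (continuous_id.prodMk continuous_const)

lemma lintegral_haarSO_rot (f : Eucl n → ℝ≥0∞) (k : SOGroup n) (x : Eucl n) :
    ∫⁻ g, f (rot g (rot k x)) ∂haarSO n = ∫⁻ g, f (rot g x) ∂haarSO n := by
  simp_rw [← rot_mul]
  exact lintegral_mul_right_eq_self (fun g => f (rot g x)) k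

lemma lintegral_haarSO_eq (hn : 3 ≤ n) (f : Eucl n → ℝ≥0∞) {x y : Eucl n} (h : ‖x‖ = ‖y‖) :
    ∫⁻ g, f (rot g x) ∂haarSO n = ∫⁻ g, f (rot g y) ∂haarSO n := by
  obtain ⟨k, rfl⟩ := exists_rotation hn h
  exact (lintegral_haarSO_rot f k x).symm

lemma integral_haarSO_eq (hn : 3 ≤ n) (f : Eucl n → ℝ) {x y : Eucl n} (h : ‖x‖ = ‖y‖) :
    ∫ g, f (rot g x) ∂haarSO n = ∫ g, f (rot g y) ∂haarSO n := by
  obtain ⟨k, rfl⟩ := exists_rotation hn h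
  simp_rw [← rot_mul]
  exact (integral_mul_right_eq_self (fun g => f (rot g x)) k).symm

/-- Integration in polar coordinates, with the Haar measure of the rotation group in place of
the surface measure of the sphere. -/
lemma lintegral_polar_haarSO (hn : 3 ≤ n) {e : Eucl n} (he : ‖e‖ = 1) {F : Eucl n → ℝ≥0∞}
    (hF : Measurable F) :
    ∫⁻ x, F x = ∫⁻ x : Eucl n, ∫⁻ g, F (‖x‖ • rot g e) ∂haarSO n := by
  have h1 : ∀ g : SOGroup n, ∫⁻ x, F (rot g x) = ∫⁻ x, F x := fun g =>
    (rot g).measurePreserving.lintegral_comp hF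
  -- Average the rotation invariance of Lebesgue measure over g; after swapping, the inner integral
  -- depends on x only through ‖x‖.
  calc (∫⁻ x, F x) = ∫⁻ g, (∫⁻ x, F (rot g x)) ∂haarSO n := by simp [h1]
    _ = ∫⁻ x : Eucl n, ∫⁻ g, F (rot g x) ∂haarSO n :=
      lintegral_lintegral_swap (f := fun g x => F (rot g x)) (hF.comp measurable_rot).aemeasurable
    _ = ∫⁻ x : Eucl n, ∫⁻ g, F (‖x‖ • rot g e) ∂haarSO n := by
      refine lintegral_congr fun x => ?_
      rw [lintegral_haarSO_eq hn F (x := x) (y := ‖x‖ • e) (by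
        rw [norm_smul, norm_norm, he, mul_one])]
      simp only [map_smul]

lemma volume_closedBall_eq (hn : 3 ≤ n) {r : ℝ} (hr : 0 ≤ r) :
    volume (closedBall (0 : Eucl n) r) = ENNReal.ofReal (omega n * r ^ n) := by
  have : Nonempty (Fin n) := ⟨⟨0, by omega⟩⟩
  rw [EuclideanSpace.volume_closedBall, Fintype.card_fin, omega, Real.sqrt_eq_rpow,
    ← Real.rpow_natCast (_ ^ _), ← Real.rpow_mul Real.pi_pos.le, ← ENNReal.ofReal_pow hr,
    ← ENNReal.ofReal_mul (by positivity), mul_comm, add_comm (1 : ℝ)]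
  congr 4
  ring

lemma omega_pos (k : ℕ) : 0 < omega k :=
  div_pos (Real.rpow_pos_of_pos Real.pi_pos _) (Real.Gamma_pos_of_pos (by positivity))

/-- The volume of a star body in terms of its gauge. -/
lemma volume_sublevel (hn : 3 ≤ n) {e : Eucl n} (he : ‖e‖ = 1) {H : Eucl n → ℝ}
    (hc : Continuous H) (hh : ∀ (t : ℝ) x, 0 ≤ t → H (t • x) = t * H x)
    (hpos : ∀ u, ‖u‖ = 1 → 0 < H u) :
    volume {x | H x ≤ 1} =
      ENNReal.ofReal (omega n) * ∫⁻ g, ENNReal.ofReal ((H (rot g e))⁻¹ ^ n) ∂haarSO n := by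
  have hm : MeasurableSet {x | H x ≤ 1} := measurableSet_le hc.measurable measurable_const
  have hm2 : Measurable fun p : Eucl n × SOGroup n =>
      ({x | H x ≤ 1} : Set (Eucl n)).indicator (1 : Eucl n → ℝ≥0∞) (‖p.1‖ • rot p.2 e) := by
    refine (measurable_one.indicator hm).comp ?_
    exact (continuous_fst.norm.smul ((continuous_rot_apply e).comp continuous_snd)).measurable
  rw [← lintegral_indicator_one hm, lintegral_polar_haarSO hn he (measurable_one.indicator hm),
    lintegral_lintegral_swap hm2.aemeasurable, ← lintegral_const_mul' _ _ ENNReal.ofReal_ne_top]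
  refine lintegral_congr fun g => ?_
  have hp : 0 < H (rot g e) := hpos _ (by rw [(rot g).norm_map, he])
  -- For a fixed direction, membership of ‖x‖ g e only asks ‖x‖ ≤ 1 / H(g e), so the integral over x
  -- is the volume of a ball.
  have : (fun x : Eucl n => ({x | H x ≤ 1} : Set (Eucl n)).indicator (1 : Eucl n → ℝ≥0∞)
      (‖x‖ • rot g e)) = (closedBall (0 : Eucl n) (H (rot g e))⁻¹).indicator 1 := by
    ext x
    by_cases hx : ‖x‖ ≤ (H (rot g e))⁻¹
    · rw [indicator_of_mem, indicator_of_mem]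
      · rfl
      · simpa using hx
      · change H _ ≤ 1
        rw [hh _ _ (norm_nonneg _)]
        rwa [← le_div_iff₀ hp, one_div]
    · rw [indicator_of_notMem, indicator_of_notMem]
      · simpa using hx
      · change ¬ (H _ ≤ 1)
        rw [hh _ _ (norm_nonneg _)]
        rwa [← le_div_iff₀ hp, one_div]
  rw [this, lintegral_indicator_one measurableSet_closedBall,
    volume_closedBall_eq hn (inv_pos.2 hp).le, ENNReal.ofReal_mul (omega_pos n).le]

/-- Ingredient for the spherical mean of |⟪v, ·⟫|: against the weight exp(-‖x‖²), the integral of |x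
i| factors over coordinates and that of ‖x‖ is radial. Their quotient is the mean. -/
lemma integral_abs_mul_exp_neg_sq : ∫ t : ℝ, |t| * Real.exp (-t ^ 2) = 1 := by
  have h := integral_comp_abs (f := fun t => t * Real.exp (-t ^ 2))
  simp only [sq_abs] at h
  rw [h]
  have := integral_rpow_mul_exp_neg_rpow (p := 2) (q := 1) (by norm_num) (by norm_num)
  norm_num at this
  rw [this]
  norm_num

lemma integral_abs_coord_mul_exp (i : Fin n) :
    ∫ x : Eucl n, |x i| * Real.exp (-‖x‖ ^ 2) = Real.sqrt Real.pi ^ (n - 1) := by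
  have h1 : ∀ x : Fin n → ℝ, |x i| * Real.exp (-‖(WithLp.toLp 2 x : Eucl n)‖ ^ 2) =
      ∏ j, (if j = i then fun t : ℝ => |t| * Real.exp (-t ^ 2)
        else fun t : ℝ => Real.exp (-t ^ 2)) (x j) := by
    intro x
    rw [EuclideanSpace.real_norm_sq_eq, ← Finset.sum_neg_distrib, Real.exp_sum,
      ← Finset.mul_prod_erase _ _ (Finset.mem_univ i),
      ← Finset.mul_prod_erase Finset.univ _ (Finset.mem_univ i), if_pos rfl, mul_assoc]
    congr 2
    refine Finset.prod_congr rfl fun j hj => ?_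
    rw [if_neg (Finset.ne_of_mem_erase hj)]
  rw [← (PiLp.volume_preserving_toLp (Fin n)).integral_comp
    (MeasurableEquiv.toLp 2 (Fin n → ℝ)).measurableEmbedding]
  simp only [h1]
  rw [integral_fintype_prod_volume_eq_prod, ← Finset.mul_prod_erase _ _ (Finset.mem_univ i),
    if_pos rfl, integral_abs_mul_exp_neg_sq, one_mul]
  rw [Finset.prod_congr rfl (g := fun _ => Real.sqrt Real.pi) (fun j hj => by
    rw [if_neg (Finset.ne_of_mem_erase hj)]
    simpa using integral_gaussian 1)]
  simp [Finset.card_erase_of_mem]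

lemma integral_norm_mul_exp (hn : 3 ≤ n) :
    ∫ x : Eucl n, ‖x‖ * Real.exp (-‖x‖ ^ 2) =
      n * omega n * (Real.Gamma (1 + ((n - 1 : ℕ) : ℝ) / 2) / 2) := by
  have : Nontrivial (Eucl n) := by
    have : Nonempty (Fin n) := ⟨⟨0, by omega⟩⟩
    infer_instance
  have h := integral_fun_norm_addHaar (volume : Measure (Eucl n)) (fun y => y * Real.exp (-y ^ 2))
  rw [h, finrank_euclideanSpace_fin, nsmul_eq_mul, smul_eq_mul]
  have h1 : (volume : Measure (Eucl n)).real (ball 0 1) = omega n := by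
    rw [Measure.real, ← Measure.addHaar_closedBall_eq_addHaar_ball,
      volume_closedBall_eq hn zero_le_one, one_pow, mul_one, ENNReal.toReal_ofReal (omega_pos n).le]
  have h2 := integral_rpow_mul_exp_neg_rpow (p := 2) (q := n) (by norm_num)
    (by have : (0 : ℝ) ≤ n := by positivity
        linarith)
  rw [h1, mul_assoc]
  congr 2
  rw [show (1 + ((n - 1 : ℕ) : ℝ) / 2) = ((n : ℝ) + 1) / 2 by
    rw [Nat.cast_sub (by omega)]; push_cast; ring]
  rw [show Real.Gamma (((n : ℝ) + 1) / 2) / 2 = 1 / 2 * Real.Gamma (((n : ℝ) + 1) / 2) by ring, ← h2]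
  refine setIntegral_congr_fun measurableSet_Ioi fun y _ => ?_
  simp only [smul_eq_mul, Real.rpow_natCast]
  rw [← mul_assoc, ← pow_succ, Nat.sub_add_cancel (by omega)]
  norm_num

/-- The mean of `|⟪v, ·⟫|` over the sphere. -/
lemma integral_haarSO_abs_inner (hn : 3 ≤ n) {e v : Eucl n} (he : ‖e‖ = 1) (hv : ‖v‖ = 1) :
    ∫ g, |⟪v, rot g e⟫| ∂haarSO n = 2 * omega (n - 1) / (n * omega n) := by
  set i : Fin n := ⟨0, by omega⟩
  obtain ⟨k, hk⟩ := exists_rotation (n := n) hn (e := EuclideanSpace.single i 1) (u := v) (by simp [hv])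
  have hL : ∫ x : Eucl n, |⟪v, x⟫| * Real.exp (-‖x‖ ^ 2) = Real.sqrt Real.pi ^ (n - 1) := by
    rw [← (rot k).measurePreserving.integral_comp (rot k).toMeasurableEquiv.measurableEmbedding]
    simp only [← hk, (rot k).inner_map_map, (rot k).norm_map]
    rw [← integral_abs_coord_mul_exp i]
    simp [EuclideanSpace.inner_single_left]
  have hpol := lintegral_polar_haarSO hn he
    (F := fun x => ENNReal.ofReal (|⟪v, x⟫| * Real.exp (-‖x‖ ^ 2))) (by fun_prop)
  have hsplit : ∀ (x : Eucl n) (g : SOGroup n),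
      ENNReal.ofReal (|⟪v, ‖x‖ • rot g e⟫| * Real.exp (-‖‖x‖ • rot g e‖ ^ 2)) =
      ENNReal.ofReal (‖x‖ * Real.exp (-‖x‖ ^ 2)) * ENNReal.ofReal |⟪v, rot g e⟫| := by
    intro x g
    rw [← ENNReal.ofReal_mul (by positivity), real_inner_smul_right, abs_mul, abs_norm, norm_smul,
      norm_norm, (rot g).norm_map, he, mul_one]
    congr 1; ring
  simp only [hsplit] at hpol
  simp_rw [lintegral_const_mul' _ _ ENNReal.ofReal_ne_top] at hpol
  rw [lintegral_mul_const _ (by fun_prop)] at hpol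
  have hprod := congrArg ENNReal.toReal hpol
  rw [ENNReal.toReal_mul, ← integral_eq_lintegral_of_nonneg_ae, ← integral_eq_lintegral_of_nonneg_ae,
    ← integral_eq_lintegral_of_nonneg_ae, hL, integral_norm_mul_exp hn] at hprod
  · have hG : 0 < Real.Gamma (1 + ((n - 1 : ℕ) : ℝ) / 2) := Real.Gamma_pos_of_pos (by positivity)
    have hn0 : (0 : ℝ) < n := by positivity
    have ho := omega_pos n
    have h3 : Real.sqrt Real.pi ^ (n - 1) =
        omega (n - 1) * Real.Gamma (1 + ((n - 1 : ℕ) : ℝ) / 2) := by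
      rw [omega, div_mul_cancel₀ _ hG.ne', Real.sqrt_eq_rpow, ← Real.rpow_natCast (_ ^ _),
        ← Real.rpow_mul Real.pi_pos.le]
      congr 1; ring
    rw [h3] at hprod
    rw [eq_div_iff (by positivity)]
    have := mul_right_cancel₀ hG.ne' (hprod.trans (by ring :
      _ = (n * omega n * (1/2) * ∫ g, |⟪v, rot g e⟫| ∂haarSO n) * _))
    rw [this]; ring
  · exact ae_of_all _ fun g => abs_nonneg _
  · exact (continuous_const.inner (continuous_rot_apply e)).abs.aestronglyMeasurable
  · exact ae_of_all _ fun x => by positivity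
  · exact Continuous.aestronglyMeasurable (by fun_prop)
  · exact ae_of_all _ fun x => by positivity
  · exact Continuous.aestronglyMeasurable (by fun_prop)

/-! ### Sublinear functions and convex bodies -/

/-- Positively homogeneous and subadditive functions. -/
structure IsSublinear (H : Eucl n → ℝ) : Prop where
  smul : ∀ (t : ℝ) (x : Eucl n), 0 ≤ t → H (t • x) = t * H x
  add : ∀ x y, H (x + y) ≤ H x + H y

namespace IsSublinear

variable {H : Eucl n → ℝ}

lemma zero (hH : IsSublinear H) : H 0 = 0 := by
  simpa using hH.smul 0 0 le_rfl

lemma continuous (hH : IsSublinear H) : Continuous H := by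
  have hc : ConvexOn ℝ univ H := by
    refine ⟨convex_univ, fun x _ y _ a b ha hb _ => ?_⟩
    rw [smul_eq_mul, smul_eq_mul, ← hH.smul a x ha, ← hH.smul b y hb]
    exact hH.add _ _
  exact continuousOn_univ.1 (hc.continuousOn isOpen_univ)

lemma nonneg_add_neg (hH : IsSublinear H) (x : Eucl n) : 0 ≤ H x + H (-x) := by
  have := hH.add x (-x)
  rwa [add_neg_cancel, hH.zero] at this

lemma inner_le (hH : IsSublinear H) {y : Eucl n} (hy : y ∈ bodyOf H) (x : Eucl n) :
    ⟪x, y⟫ ≤ H x := by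
  rcases eq_or_ne x 0 with rfl | hx
  · rw [inner_zero_left, hH.zero]
  · have hx' : 0 < ‖x‖ := norm_pos_iff.2 hx
    have h := hy (‖x‖⁻¹ • x) (by rw [norm_smul, norm_inv, norm_norm, inv_mul_cancel₀ hx'.ne'])
    rw [real_inner_smul_left, hH.smul _ _ (inv_nonneg.2 hx'.le)] at h
    exact le_of_mul_le_mul_left h (inv_pos.2 hx')

/-- The support function of the body of a sublinear function is attained. -/
lemma exists_inner_eq (hH : IsSublinear H) {u : Eucl n} (hu : u ≠ 0) :
    ∃ y ∈ bodyOf H, ⟪u, y⟫ = H u := by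
  -- Hahn–Banach applied to c u ↦ c H(u) on the line through u. For c < 0 the domination by H is 0 ≤
  -- H(u) + H(-u).
  obtain ⟨g, hg1, hg2⟩ := exists_extension_of_le_sublinear
    (LinearPMap.mkSpanSingleton (σ := RingHom.id ℝ) u (H u) hu) H
    (fun c hc x => hH.smul c x hc.le) hH.add (by
      rintro ⟨x, hx⟩
      obtain ⟨c, rfl⟩ := Submodule.mem_span_singleton.1 hx
      rw [LinearPMap.mkSpanSingleton'_apply]
      rw [RingHom.id_apply, smul_eq_mul]
      change c * H u ≤ H (c • u)
      rcases le_total 0 c with hc | hc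
      · rw [hH.smul c u hc]
      · have h1 : c • u = (-c) • (-u) := by simp
        rw [h1, hH.smul _ _ (by linarith)]
        nlinarith [hH.nonneg_add_neg u])
  set y := (InnerProductSpace.toDual ℝ (Eucl n)).symm (LinearMap.toContinuousLinearMap g)
  have hy : ∀ x, ⟪x, y⟫ = g x := fun x => by
    rw [real_inner_comm, InnerProductSpace.toDual_symm_apply]
    rfl
  refine ⟨y, fun x _ => by rw [hy]; exact hg2 x, ?_⟩
  rw [hy]
  have := hg1 ⟨u, Submodule.mem_span_singleton_self u⟩
  rw [LinearPMap.mkSpanSingleton_apply] at this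
  exact this

lemma isGreatest (hH : IsSublinear H) {u : Eucl n} (hu : u ≠ 0) :
    IsGreatest ((fun x => ⟪u, x⟫) '' bodyOf H) (H u) := by
  obtain ⟨y, hy, h⟩ := hH.exists_inner_eq hu
  refine ⟨⟨y, hy, h⟩, ?_⟩
  rintro _ ⟨x, hx, rfl⟩
  exact hH.inner_le hx u

lemma isConvexBodyWithSupport (hn : 3 ≤ n) (hH : IsSublinear H) :
    IsConvexBodyWithSupport (bodyOf H) H := by
  have hne : ∀ u : Eucl n, ‖u‖ = 1 → u ≠ 0 := by rintro u hu rfl; simp at hu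
  refine ⟨?_, ?_, ?_, fun u hu => hH.isGreatest (hne u hu)⟩
  · intro x hx y hy a b ha hb hab u hu
    rw [inner_add_right, real_inner_smul_right, real_inner_smul_right]
    calc a * ⟪u, x⟫ + b * ⟪u, y⟫ ≤ a * H u + b * H u := by
          gcongr
          · exact hx u hu
          · exact hy u hu
      _ = H u := by rw [← add_mul, hab, one_mul]
  · refine isCompact_of_isClosed_isBounded ?_ ?_
    · have : bodyOf H = ⋂ (u : Eucl n) (_ : ‖u‖ = 1), {x | ⟪u, x⟫ ≤ H u} := by
        ext x; simp [bodyOf]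
      rw [this]
      exact isClosed_biInter fun u _ => isClosed_le (by fun_prop) continuous_const
    · obtain ⟨C, hC⟩ := (isCompact_sphere (0 : Eucl n) 1).exists_bound_of_continuousOn
        hH.continuous.continuousOn
      refine isBounded_iff_forall_norm_le.2 ⟨max C 0, fun x hx => ?_⟩
      rcases eq_or_ne x 0 with rfl | hx0
      · simp
      · have hx' : 0 < ‖x‖ := norm_pos_iff.2 hx0
        have h1 : ‖‖x‖⁻¹ • x‖ = 1 := by
          rw [norm_smul, norm_inv, norm_norm, inv_mul_cancel₀ hx'.ne']
        have h := hx _ h1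
        rw [real_inner_smul_left, real_inner_self_eq_norm_sq, pow_two, inv_mul_cancel_left₀ hx'.ne']
          at h
        exact h.trans ((le_abs_self _).trans ((hC _ (by simpa using h1)).trans (le_max_left _ _)))
  · obtain ⟨z, hz, -⟩ := exists_unit_orthogonal hn (0 : Eucl n) 0
    obtain ⟨y, hy, -⟩ := hH.exists_inner_eq (hne z hz)
    exact ⟨y, hy⟩

lemma supportFn_bodyOf (hn : 3 ≤ n) (hH : IsSublinear H) (u : Eucl n) :
    supportFn (bodyOf H) u = H u := by
  rcases eq_or_ne u 0 with rfl | hu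
  · obtain ⟨y, hy⟩ := (hH.isConvexBodyWithSupport hn).2.2.1
    rw [hH.zero, supportFn]
    have : (fun x : Eucl n => ⟪(0 : Eucl n), x⟫) '' bodyOf H = {0} := by
      ext t
      simp only [inner_zero_left, mem_image, mem_singleton_iff]
      exact ⟨fun ⟨_, _, h⟩ => h.symm, fun h => ⟨y, hy, h.symm⟩⟩
    rw [this, csSup_singleton]
  · exact (hH.isGreatest hu).csSup_eq

lemma polarBody_bodyOf (hH : IsSublinear H) : polarBody (bodyOf H) = {x | H x ≤ 1} := by
  ext x
  constructor
  · intro hx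
    rcases eq_or_ne x 0 with rfl | hx0
    · change H 0 ≤ 1
      rw [hH.zero]; exact zero_le_one
    · obtain ⟨y, hy, h⟩ := hH.exists_inner_eq hx0
      exact h.symm.le.trans (hx y hy)
  · intro hx y hy
    exact (hH.inner_le hy x).trans hx

/-- The body of an even sublinear function is a ball iff the function is constant on the sphere. -/
lemma isBall_bodyOf_iff (hn : 3 ≤ n) (hH : IsSublinear H) (heven : ∀ x, H (-x) = H x) :
    IsBall (bodyOf H) ↔ ∃ r, ∀ u : Eucl n, ‖u‖ = 1 → H u = r := by
  constructor
  · rintro ⟨c, r, hr, hK⟩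
    have hs : ∀ u : Eucl n, ‖u‖ = 1 → H u = ⟪u, c⟫ + r := by
      intro u hu
      refine (hH.isGreatest (by rintro rfl; simp at hu)).unique ?_
      rw [hK]
      constructor
      · refine ⟨c + r • u, ?_, ?_⟩
        · rw [mem_closedBall, dist_eq_norm, add_sub_cancel_left, norm_smul, hu, mul_one,
            Real.norm_of_nonneg hr]
        · simp only [inner_add_right, real_inner_smul_right, real_inner_self_eq_norm_sq, hu]
          ring
      · rintro _ ⟨x, hx, rfl⟩
        have h1 : ⟪u, x - c⟫ ≤ ‖u‖ * ‖x - c‖ := real_inner_le_norm _ _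
        rw [hu, one_mul, inner_sub_right] at h1
        rw [mem_closedBall, dist_eq_norm] at hx
        change ⟪u, x⟫ ≤ _
        linarith
    -- Comparing the formula at u and -u, evenness removes the term coming from the centre.
    refine ⟨r, fun u hu => ?_⟩
    have h1 := hs u hu
    have h2 := hs (-u) (by rwa [norm_neg])
    rw [heven, inner_neg_left] at h2
    linarith
  · rintro ⟨r, hr⟩
    obtain ⟨z, hz, -⟩ := exists_unit_orthogonal hn (0 : Eucl n) 0
    have hr0 : 0 ≤ r := by
      have := hH.nonneg_add_neg z
      rw [heven, hr z hz] at this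
      linarith
    refine ⟨0, r, hr0, ?_⟩
    ext x
    rw [mem_closedBall, dist_zero_right]
    constructor
    · intro hx
      rcases eq_or_ne x 0 with rfl | hx0
      · simpa using hr0
      · have hx' : 0 < ‖x‖ := norm_pos_iff.2 hx0
        have h1 : ‖‖x‖⁻¹ • x‖ = 1 := by
          rw [norm_smul, norm_inv, norm_norm, inv_mul_cancel₀ hx'.ne']
        have h := hx _ h1
        rwa [hr _ h1, real_inner_smul_left, real_inner_self_eq_norm_sq, pow_two,
          inv_mul_cancel_left₀ hx'.ne'] at h
    · intro hx u hu
      rw [hr u hu]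
      have := real_inner_le_norm u x
      rw [hu, one_mul] at this
      exact this.trans hx

end IsSublinear

lemma bodyOf_congr {h h' : Eucl n → ℝ} (hh : ∀ u, ‖u‖ = 1 → h u = h' u) : bodyOf h = bodyOf h' := by
  ext x
  exact forall₂_congr fun u hu => by rw [hh u hu]

/-! ### Jensen's inequality for negative powers -/

/-- Strict convexity of t ↦ t^(-n) in tangent form. With s = a / x, Bernoulli gives 1 + n(s - 1) ≤
s^n, and s - 1 exceeds (s - 1)/s by (s - 1)²/s, which vanishes only at s = 1. -/
lemma inv_pow_sub_tangent {a x : ℝ} (ha : 0 < a) (hx : 0 < x) (hn : n ≠ 0) :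
    (a⁻¹) ^ n - n * (a⁻¹) ^ (n + 1) * (x - a) ≤ (x⁻¹) ^ n ∧
      ((a⁻¹) ^ n - n * (a⁻¹) ^ (n + 1) * (x - a) = (x⁻¹) ^ n → x = a) := by
  set s := a / x with hs
  have hs0 : 0 < s := div_pos ha hx
  have hxs : x = a / s := by rw [hs]; field_simp
  have hB : 1 + n * (s - 1) ≤ s ^ n := by
    have := one_add_mul_le_pow (a := s - 1) (by linarith) n
    simpa using this
  have hn' : (0 : ℝ) < n := by positivity
  have hid : s - 1 - (s - 1) / s = (s - 1) ^ 2 / s := by field_simp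
  have hL : (a⁻¹) ^ n - n * (a⁻¹) ^ (n + 1) * (x - a) = (a⁻¹) ^ n * (1 + n * ((s - 1) / s)) := by
    have : (a⁻¹) ^ (n + 1) * (x - a) = (a⁻¹) ^ n * (1 / s - 1) := by
      rw [hxs, pow_succ]; field_simp
    rw [mul_assoc, this]; field_simp; ring
  have hR : (x⁻¹) ^ n = (a⁻¹) ^ n * s ^ n := by
    rw [hxs, ← mul_pow]; congr 1; field_simp
  have hap : 0 < (a⁻¹) ^ n := by positivity
  have hsq : 0 ≤ (s - 1) ^ 2 / s := by positivity
  rw [hL, hR]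
  constructor
  · refine mul_le_mul_of_nonneg_left ?_ hap.le
    nlinarith
  · intro h
    have h1 := mul_left_cancel₀ hap.ne' h
    have h2 : (s - 1) ^ 2 / s ≤ 0 := by
      by_contra hc
      push Not at hc
      nlinarith
    have h3 : (s - 1) ^ 2 = 0 := by
      have := (div_le_iff₀ hs0).1 h2
      nlinarith [sq_nonneg (s - 1)]
    have h4 : s = 1 := by nlinarith
    rw [hxs, h4, div_one]

lemma integral_pos_of_le {X : Type*} [MeasurableSpace X] {m : Measure X} [IsProbabilityMeasure m]
    {F : X → ℝ} {c : ℝ} (hc : 0 < c) (hF : Integrable F m) (hcF : ∀ᵐ x ∂m, c ≤ F x) :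
    0 < ∫ x, F x ∂m := by
  refine hc.trans_le ?_
  have := integral_mono_ae (integrable_const c) hF hcF
  simpa using this

/-- Jensen's inequality for `t ↦ t ^ (-n)`, with the equality case. -/
lemma jensen_inv_pow {X : Type*} [MeasurableSpace X] {m : Measure X} [IsProbabilityMeasure m]
    {F : X → ℝ} (hn : n ≠ 0) {c : ℝ} (hc : 0 < c) (hF : Integrable F m) (hcF : ∀ᵐ x ∂m, c ≤ F x) :
    ((∫ x, F x ∂m)⁻¹) ^ n ≤ ∫ x, ((F x)⁻¹) ^ n ∂m ∧
      (((∫ x, F x ∂m)⁻¹) ^ n = ∫ x, ((F x)⁻¹) ^ n ∂m → ∀ᵐ x ∂m, F x = ∫ x, F x ∂m) := by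
  set a := ∫ x, F x ∂m with ha
  have ha0 : 0 < a := integral_pos_of_le hc hF hcF
  have hI : Integrable (fun x => ((F x)⁻¹) ^ n) m := by
    refine Integrable.mono' (integrable_const ((c⁻¹) ^ n))
      (hF.aestronglyMeasurable.aemeasurable.inv.pow_const n).aestronglyMeasurable ?_
    filter_upwards [hcF] with x hx
    have : 0 < F x := hc.trans_le hx
    rw [Real.norm_of_nonneg (by positivity)]
    gcongr
  have hT : Integrable (fun x => (a⁻¹) ^ n - n * (a⁻¹) ^ (n + 1) * (F x - a)) m :=
    (integrable_const _).sub ((hF.sub (integrable_const a)).const_mul _)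
  -- The tangent is taken at the mean, so its linear term integrates to zero.
  have hTi : ∫ x, ((a⁻¹) ^ n - n * (a⁻¹) ^ (n + 1) * (F x - a)) ∂m = (a⁻¹) ^ n := by
    have h1 : Integrable (fun x => F x - a) m := hF.sub (integrable_const a)
    rw [integral_sub (integrable_const _) (h1.const_mul _),
      integral_const_mul, integral_sub hF (integrable_const _), ← ha]
    simp
  have hle : ∀ᵐ x ∂m, (a⁻¹) ^ n - n * (a⁻¹) ^ (n + 1) * (F x - a) ≤ ((F x)⁻¹) ^ n := by
    filter_upwards [hcF] with x hx
    exact (inv_pow_sub_tangent ha0 (hc.trans_le hx) hn).1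
  constructor
  · rw [← hTi]
    exact integral_mono_ae hT hI hle
  · intro h
    rw [← hTi] at h
    have h2 := (integral_eq_iff_of_ae_le hT hI hle).1 h
    filter_upwards [h2, hcF] with x hx hcx
    exact (inv_pow_sub_tangent ha0 (hc.trans_le hcx) hn).2 hx

/-! ### The rotated zonoids -/

section Kernel

variable {e : USphere n} {μ : Measure (USphere n)}

lemma norm_sphere (w : USphere n) : ‖(w : Eucl n)‖ = 1 := by simp

lemma continuous_sphereMap (ϑ : Eucl n ≃ₗᵢ[ℝ] Eucl n) : Continuous (sphereMap ϑ) :=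
  (ϑ.continuous.comp continuous_subtype_val).subtype_mk _

/-- The rotation h⁻¹ g fixes the pole, hence preserves μ. This makes Z^μ(v) independent of the
rotation used to define it. -/
lemma integral_zonal (hμz : IsZonal e μ) {g h : SOGroup n} (hgh : rot g e = rot h e)
    {f : Eucl n → ℝ} (hf : Continuous f) :
    ∫ w, f (rot g w) ∂μ = ∫ w, f (rot h w) ∂μ := by
  have hfix : sphereMap (rot (h⁻¹ * g)) e = e := by
    apply Subtype.ext
    change rot (h⁻¹ * g) e = e
    rw [rot_mul, hgh, ← rot_mul, inv_mul_cancel]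
    rfl
  conv_rhs => rw [← hμz _ (rot_isRotation (h⁻¹ * g)) hfix]
  rw [integral_map (f := fun w : USphere n => f (rot h w))
    (continuous_sphereMap _).measurable.aemeasurable
    (hf.comp ((rot h).continuous.comp continuous_subtype_val)).aestronglyMeasurable]
  refine integral_congr_ae (ae_of_all _ fun w => ?_)
  change f (rot g w) = f (rot h (rot (h⁻¹ * g) w))
  rw [← rot_mul, mul_inv_cancel_left]

open Classical in
/-- The support function of `Z^μ(v)`. -/
def zonoidSupport (μ : Measure (USphere n)) (e : USphere n) (v x : Eucl n) : ℝ :=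
  if h : ∃ g : SOGroup n, rot g e = v then ∫ w, |⟪x, rot h.choose w⟫| ∂μ else 0

lemma zonoidSupport_eq (hμz : IsZonal e μ) (g : SOGroup n) (x : Eucl n) :
    zonoidSupport μ e (rot g e) x = ∫ w, |⟪x, rot g w⟫| ∂μ := by
  have h : ∃ g' : SOGroup n, rot g' e = rot g e := ⟨g, rfl⟩
  rw [zonoidSupport, dif_pos h]
  exact integral_zonal hμz h.choose_spec (f := fun y => |⟪x, y⟫|) (by fun_prop)

/-- The pairs (u, v) and (v, u) have the same Gram matrix, so one rotation exchanges u and v. The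
symmetry moves u from the axis of the zonoid to the argument of its support function, where
sublinearity is visible. -/
lemma zonoidSupport_symm (hn : 3 ≤ n) (hμz : IsZonal e μ) {u v : Eucl n} (hu : ‖u‖ = 1)
    (hv : ‖v‖ = 1) : zonoidSupport μ e u v = zonoidSupport μ e v u := by
  obtain ⟨g, rfl⟩ := exists_rotation hn (e := (e : Eucl n)) (u := u) (by rw [hu, norm_sphere])
  obtain ⟨ρ, h1, h2⟩ := exists_rotation_pair hn (e := rot g e) (w := v) (u := v) (p := rot g e)
    (by rw [hu, hv]) (by rw [hu, hv]) (real_inner_comm _ _)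
  rw [zonoidSupport_eq hμz]
  conv_rhs => rw [← h1, ← rot_mul, zonoidSupport_eq hμz]
  refine integral_congr_ae (ae_of_all _ fun w => ?_)
  change |_| = |_|
  conv_rhs => rw [← h2]
  rw [rot_mul, (rot ρ).inner_map_map]

lemma integrable_abs_inner_rot [IsFiniteMeasure μ] (g : SOGroup n) (x : Eucl n) :
    Integrable (fun w : USphere n => |⟪x, rot g w⟫|) μ := by
  refine Integrable.mono' (integrable_const ‖x‖) ?_ (ae_of_all _ fun w => ?_)
  · exact (continuous_const.inner ((rot g).continuous.comp
      continuous_subtype_val)).abs.aestronglyMeasurable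
  · rw [Real.norm_eq_abs, abs_abs]
    refine (abs_real_inner_le_norm _ _).trans ?_
    rw [(rot g).norm_map, norm_sphere, mul_one]

lemma isSublinear_zonoidSupport [IsFiniteMeasure μ] (v : Eucl n) :
    IsSublinear (zonoidSupport μ e v) := by
  by_cases h : ∃ g : SOGroup n, rot g e = v
  · constructor
    · intro t x ht
      simp only [zonoidSupport, dif_pos h, real_inner_smul_left, abs_mul, abs_of_nonneg ht]
      rw [integral_const_mul]
    · intro x y
      simp only [zonoidSupport, dif_pos h]
      rw [← integral_add (integrable_abs_inner_rot _ _) (integrable_abs_inner_rot _ _)]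
      refine integral_mono (integrable_abs_inner_rot _ _)
        ((integrable_abs_inner_rot _ _).add (integrable_abs_inner_rot _ _)) fun w => ?_
      simp only [inner_add_left]
      exact abs_add_le _ _
  · constructor <;> simp [zonoidSupport, dif_neg h]

lemma zonoidSupport_nonneg (v x : Eucl n) : 0 ≤ zonoidSupport μ e v x := by
  unfold zonoidSupport
  split_ifs
  · exact integral_nonneg fun w => abs_nonneg _
  · exact le_rfl

lemma zonoidSupport_neg (v x : Eucl n) : zonoidSupport μ e v (-x) = zonoidSupport μ e v x := by
  simp [zonoidSupport, inner_neg_left]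

lemma zonoidSupport_le [IsFiniteMeasure μ] (v x : Eucl n) :
    zonoidSupport μ e v x ≤ μ.real univ * ‖x‖ := by
  unfold zonoidSupport
  split_ifs with h
  · have := integral_mono (integrable_abs_inner_rot h.choose x) (integrable_const ‖x‖ (μ := μ))
      fun w => by
        refine (abs_real_inner_le_norm _ _).trans ?_
        rw [(rot _).norm_map, norm_sphere, mul_one]
    simpa using this
  · positivity

lemma zonoidAt_eq (hn : 3 ≤ n) (hμz : IsZonal e μ) {u : Eucl n} (hu : ‖u‖ = 1) :
    zonoidAt μ e u = bodyOf (zonoidSupport μ e u) := by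
  have key : ∀ g : SOGroup n, rot g e = u →
      (rot g) '' zonoid μ = bodyOf (zonoidSupport μ e u) := by
    rintro g rfl
    ext x
    constructor
    · rintro ⟨z, hz, rfl⟩ v hv
      have h := hz ((rot g).symm v) (by rw [LinearIsometryEquiv.norm_map, hv])
      rw [zonoidSupport_eq hμz]
      calc ⟪v, rot g z⟫ = ⟪(rot g).symm v, z⟫ := by
            rw [← (rot g).inner_map_map ((rot g).symm v), LinearIsometryEquiv.apply_symm_apply]
        _ ≤ _ := h
        _ = _ := by
            refine integral_congr_ae (ae_of_all _ fun w => ?_)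
            change |_| = |_|
            rw [← (rot g).inner_map_map ((rot g).symm v), LinearIsometryEquiv.apply_symm_apply]
    · intro hx
      refine ⟨(rot g).symm x, fun v hv => ?_, LinearIsometryEquiv.apply_symm_apply _ _⟩
      have h := hx (rot g v) (by rw [LinearIsometryEquiv.norm_map, hv])
      rw [zonoidSupport_eq hμz] at h
      simp only [(rot g).inner_map_map] at h
      rwa [← (rot g).inner_map_map, LinearIsometryEquiv.apply_symm_apply]
  obtain ⟨g, hg⟩ := exists_rotation hn (e := (e : Eucl n)) (u := u) (by rw [hu, norm_sphere])
  ext x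
  constructor
  · rintro ⟨ϑ, h1, h2, h3⟩
    obtain ⟨g', rfl⟩ := exists_SOGroup h1
    rwa [key g' h2] at h3
  · intro hx
    refine ⟨rot g, rot_isRotation g, hg, ?_⟩
    rwa [key g hg]

lemma supportFn_zonoidAt [IsFiniteMeasure μ] (hn : 3 ≤ n) (hμz : IsZonal e μ) {u : Eucl n}
    (hu : ‖u‖ = 1) (v : Eucl n) : supportFn (zonoidAt μ e u) v = zonoidSupport μ e u v := by
  rw [zonoidAt_eq hn hμz hu, (isSublinear_zonoidSupport u).supportFn_bodyOf hn]

/-- The parallels of e other than the poles are infinite, so a finite zonal measure has no atoms off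
the poles. With a, b orthonormal and orthogonal to e, the points t e + q(s a + √(1 - s²) b) are told
apart by their inner products with a. -/
lemma infinite_setOf_inner_eq (hn : 3 ≤ n) (e : USphere n) {t : ℝ} (ht : |t| < 1) :
    {p : USphere n | ⟪(e : Eucl n), (p : Eucl n)⟫ = t}.Infinite := by
  obtain ⟨a, ha, hae, -⟩ := exists_unit_orthogonal hn (e : Eucl n) e
  obtain ⟨b, hb, hbe, hba⟩ := exists_unit_orthogonal hn (e : Eucl n) a
  have hee : ⟪(e : Eucl n), (e : Eucl n)⟫ = 1 := by
    rw [real_inner_self_eq_norm_sq, norm_sphere, one_pow]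
  have haa : ⟪a, a⟫ = 1 := by rw [real_inner_self_eq_norm_sq, ha, one_pow]
  have hbb : ⟪b, b⟫ = 1 := by rw [real_inner_self_eq_norm_sq, hb, one_pow]
  have hea : ⟪(e : Eucl n), a⟫ = 0 := by rw [real_inner_comm, hae]
  have heb : ⟪(e : Eucl n), b⟫ = 0 := by rw [real_inner_comm, hbe]
  have hab : ⟪a, b⟫ = 0 := by rw [real_inner_comm, hba]
  have ht2 : 0 < 1 - t ^ 2 := by nlinarith [abs_nonneg t, sq_abs t]
  set q := Real.sqrt (1 - t ^ 2)
  have hq : 0 < q := Real.sqrt_pos.2 ht2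
  have hq2 : q * q = 1 - t ^ 2 := Real.mul_self_sqrt ht2.le
  let p : ℝ → Eucl n := fun s => t • (e : Eucl n) + q • (s • a + Real.sqrt (1 - s ^ 2) • b)
  have hpn : ∀ s ∈ Icc (0 : ℝ) 1, ‖p s‖ = 1 := by
    intro s hs
    have hs2 : Real.sqrt (1 - s ^ 2) * Real.sqrt (1 - s ^ 2) = 1 - s ^ 2 :=
      Real.mul_self_sqrt (by nlinarith [hs.1, hs.2])
    have : ‖p s‖ ^ 2 = 1 := by
      rw [← real_inner_self_eq_norm_sq]
      simp only [p, inner_add_left, inner_add_right, real_inner_smul_left, real_inner_smul_right,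
        hee, haa, hbb, hea, heb, hab, hae, hbe, hba]
      linear_combination q * q * hs2 + hq2
    nlinarith [norm_nonneg (p s)]
  have hinf : (Icc (0 : ℝ) 1).Infinite := Icc_infinite zero_lt_one
  let f : ℝ → USphere n := fun s => if h : ‖p s‖ = 1 then ⟨p s, by simpa using h⟩ else e
  have hf : ∀ s ∈ Icc (0 : ℝ) 1, (f s : Eucl n) = p s := by
    intro s hs
    simp only [f, dif_pos (hpn s hs)]
  refine infinite_of_injOn_mapsTo (f := f) (s := Icc 0 1) ?_ ?_ hinf
  · intro s hs s' hs' h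
    have h1 : ⟪a, p s⟫ = ⟪a, p s'⟫ := by rw [← hf s hs, ← hf s' hs', h]
    simp only [p, inner_add_right, real_inner_smul_right, haa, hae, hab] at h1
    simp only [mul_zero, mul_one, zero_add, add_zero] at h1
    exact mul_left_cancel₀ hq.ne' h1
  · intro s hs
    change ⟪(e : Eucl n), (f s : Eucl n)⟫ = t
    rw [hf s hs]
    simp only [p, inner_add_right, real_inner_smul_right, hee, hea, heb]
    ring

lemma abs_inner_lt_one {e w : USphere n} (h1 : w ≠ e) (h2 : w ≠ -e) :
    |⟪(e : Eucl n), (w : Eucl n)⟫| < 1 := by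
  have h := abs_real_inner_le_norm (e : Eucl n) w
  rw [norm_sphere, norm_sphere, one_mul] at h
  refine lt_of_le_of_ne h fun h' => ?_
  rcases eq_or_eq_neg_of_abs_eq h' with h3 | h3
  · exact h1 (Subtype.ext ((inner_eq_one_iff_of_norm_eq_one (𝕜 := ℝ) (norm_sphere e)
      (norm_sphere w)).1 h3).symm)
  · have h4 : ⟪(e : Eucl n), -(w : Eucl n)⟫ = 1 := by rw [inner_neg_right, h3, neg_neg]
    have h5 := (inner_eq_one_iff_of_norm_eq_one (𝕜 := ℝ) (norm_sphere e)
      (by rw [norm_neg, norm_sphere])).1 h4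
    apply h2
    apply Subtype.ext
    change (w : Eucl n) = -(e : Eucl n)
    rw [h5, neg_neg]

/-- A discrete zonal measure is concentrated on the poles. -/
lemma IsDiscreteMeasure.ae_eq_pole [IsFiniteMeasure μ] (hn : 3 ≤ n) (hμz : IsZonal e μ)
    (hd : IsDiscreteMeasure μ) : ∀ᵐ w ∂μ, w = e ∨ w = -e := by
  obtain ⟨S, hS, hS0⟩ := hd
  have hpt : ∀ w : USphere n, w ≠ e → w ≠ -e → μ {w} = 0 := by
    intro w h1 h2
    by_contra hw
    -- Rotations about e carry w to every point of its parallel, so each of these infinitely many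
    -- points would have mass at least μ {w}.
    have htop := Infinite.meas_eq_top (μ := μ) (infinite_setOf_inner_eq hn e (abs_inner_lt_one h1 h2))
      ⟨μ {w}, hw, fun p hp => ?_⟩
    · exact measure_ne_top _ _ htop
    · obtain ⟨g, hg1, hg2⟩ := exists_rotation_pair hn (e := (e : Eucl n)) (w := w) (u := e) (p := p)
        rfl (by rw [norm_sphere, norm_sphere]) hp.symm
      have hmap := hμz _ (rot_isRotation g) (Subtype.ext hg1)
      rw [← hmap, Measure.map_apply (continuous_sphereMap _).measurable (measurableSet_singleton p),
        hmap]
      refine measure_mono ?_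
      rintro _ rfl
      exact Subtype.ext hg2
  have h0 : μ (S ∩ {w | ¬ (w = e ∨ w = -e)}) = 0 := by
    rw [← biUnion_of_singleton (S ∩ _), measure_biUnion_null_iff (hS.mono inter_subset_left)]
    rintro w ⟨-, hw⟩
    rw [mem_ofPred_eq, not_or] at hw
    exact hpt w hw.1 hw.2
  rw [ae_iff]
  refine measure_mono_null ?_ (measure_union_null h0 hS0)
  intro w hw
  by_cases hwS : w ∈ S
  · exact Or.inl ⟨hwS, hw⟩
  · exact Or.inr hwS

end Kernel

/-! ### The inequalities for a finite measure with a field of unit normals -/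

/-- `½ ∫ |⟪x, ν⟫| dσ`. -/
def cosSupport {X : Type*} [MeasurableSpace X] (σ : Measure X) (ν : X → Eucl n) (x : Eucl n) : ℝ :=
  (1 / 2) * ∫ y, |⟪x, ν y⟫| ∂σ

/-- The sublinear extension of `u ↦ ∫ h(Z^μ(u), ν) dσ`. -/
def zonalSupport {X : Type*} [MeasurableSpace X] (σ : Measure X) (ν : X → Eucl n)
    (μ : Measure (USphere n)) (e : USphere n) (x : Eucl n) : ℝ :=
  ∫ y, zonoidSupport μ e (ν y) x ∂σ

section Abstract

variable {X : Type*} [MeasurableSpace X] {σ : Measure X} [IsFiniteMeasure σ] {ν : X → Eucl n}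
  {μ : Measure (USphere n)} {e : USphere n}

lemma integrable_abs_inner (hν : AEStronglyMeasurable ν σ) (hν1 : ∀ᵐ y ∂σ, ‖ν y‖ = 1)
    (x : Eucl n) : Integrable (fun y => |⟪x, ν y⟫|) σ := by
  refine Integrable.mono' (integrable_const ‖x‖)
    (Continuous.comp_aestronglyMeasurable (g := fun z : Eucl n => |⟪x, z⟫|) (by fun_prop) hν) ?_
  filter_upwards [hν1] with y hy
  rw [Real.norm_eq_abs, abs_abs]
  refine (abs_real_inner_le_norm _ _).trans ?_
  rw [hy, mul_one]

lemma isSublinear_cosSupport (hν : AEStronglyMeasurable ν σ) (hν1 : ∀ᵐ y ∂σ, ‖ν y‖ = 1) :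
    IsSublinear (cosSupport σ ν) := by
  constructor
  · intro t x ht
    simp only [cosSupport, real_inner_smul_left, abs_mul, abs_of_nonneg ht]
    rw [integral_const_mul]; ring
  · intro x y
    simp only [cosSupport]
    rw [← mul_add, ← integral_add (integrable_abs_inner hν hν1 _) (integrable_abs_inner hν hν1 _)]
    refine mul_le_mul_of_nonneg_left ?_ (by norm_num)
    refine integral_mono (integrable_abs_inner hν hν1 _)
      ((integrable_abs_inner hν hν1 _).add (integrable_abs_inner hν hν1 _)) fun w => ?_
    simp only [inner_add_left]
    exact abs_add_le _ _

lemma cosSupport_neg (x : Eucl n) : cosSupport σ ν (-x) = cosSupport σ ν x := by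
  simp [cosSupport, inner_neg_left]

lemma zonalSupport_neg (x : Eucl n) : zonalSupport σ ν μ e (-x) = zonalSupport σ ν μ e x := by
  simp [zonalSupport, zonoidSupport_neg]

variable [IsFiniteMeasure μ] (hn : 3 ≤ n) (hμz : IsZonal e μ)

include hn hμz in
lemma zonoidSupport_ae_symm (hν1 : ∀ᵐ y ∂σ, ‖ν y‖ = 1) {u : Eucl n} (hu : ‖u‖ = 1) :
    (fun y => zonoidSupport μ e u (ν y)) =ᵐ[σ] fun y => zonoidSupport μ e (ν y) u := by
  filter_upwards [hν1] with y hy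
  exact zonoidSupport_symm hn hμz hu hy

include hn hμz in
-- Measurability in y is hidden by the choice of a rotation carrying e to ν y. For unit x the
-- symmetry puts ν y into the continuous argument; other x follow by homogeneity.
lemma integrable_zonoidSupport (hν : AEStronglyMeasurable ν σ) (hν1 : ∀ᵐ y ∂σ, ‖ν y‖ = 1)
    (x : Eucl n) : Integrable (fun y => zonoidSupport μ e (ν y) x) σ := by
  rcases eq_or_ne x 0 with rfl | hx
  · simp [(isSublinear_zonoidSupport _).zero]
  · have hx' : 0 < ‖x‖ := norm_pos_iff.2 hx
    have h1 : ‖‖x‖⁻¹ • x‖ = 1 := by rw [norm_smul, norm_inv, norm_norm, inv_mul_cancel₀ hx'.ne']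
    have hI : Integrable (fun y => zonoidSupport μ e (ν y) (‖x‖⁻¹ • x)) σ := by
      refine Integrable.congr ?_ (zonoidSupport_ae_symm hn hμz hν1 h1)
      refine Integrable.mono' (integrable_const (μ.real univ))
        ((isSublinear_zonoidSupport _).continuous.comp_aestronglyMeasurable hν) ?_
      filter_upwards [hν1] with y hy
      rw [Real.norm_of_nonneg (zonoidSupport_nonneg _ _)]
      simpa [hy] using zonoidSupport_le (μ := μ) (e := e) (‖x‖⁻¹ • x) (ν y)
    have h2 := hI.const_mul ‖x‖
    refine h2.congr (ae_of_all _ fun y => ?_)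
    change _ * _ = _
    rw [← (isSublinear_zonoidSupport _).smul _ _ hx'.le, smul_inv_smul₀ hx'.ne']

include hn hμz in
lemma isSublinear_zonalSupport (hν : AEStronglyMeasurable ν σ) (hν1 : ∀ᵐ y ∂σ, ‖ν y‖ = 1) :
    IsSublinear (zonalSupport σ ν μ e) := by
  constructor
  · intro t x ht
    simp only [zonalSupport, (isSublinear_zonoidSupport (μ := μ) (e := e) _).smul t x ht]
    rw [integral_const_mul]
  · intro x y
    simp only [zonalSupport]
    rw [← integral_add (integrable_zonoidSupport hn hμz hν hν1 _)
      (integrable_zonoidSupport hn hμz hν hν1 _)]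
    exact integral_mono (integrable_zonoidSupport hn hμz hν hν1 _)
      ((integrable_zonoidSupport hn hμz hν hν1 _).add (integrable_zonoidSupport hn hμz hν hν1 _))
      fun w => (isSublinear_zonoidSupport _).add x y

include hn hμz in
-- The identity behind both inequalities, by Fubini for σ × μ. The factor 2 cancels the ½ in
-- `cosSupport` and turns μ into the probability measure 2μ.
lemma zonalSupport_rot (hν : AEStronglyMeasurable ν σ) (hν1 : ∀ᵐ y ∂σ, ‖ν y‖ = 1)
    (g : SOGroup n) :
    zonalSupport σ ν μ e (rot g e) = 2 * ∫ w : USphere n, cosSupport σ ν (rot g w) ∂μ := by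
  have h1 : zonalSupport σ ν μ e (rot g e) =
      ∫ y, ∫ w : USphere n, |⟪ν y, rot g w⟫| ∂μ ∂σ := by
    rw [zonalSupport, ← integral_congr_ae (zonoidSupport_ae_symm hn hμz hν1
      (by rw [(rot g).norm_map, norm_sphere]))]
    simp_rw [zonoidSupport_eq hμz]
  have hcont : Continuous fun w : USphere n => rot g (w : Eucl n) :=
    (rot g).continuous.comp continuous_subtype_val
  have hint : Integrable (Function.uncurry fun (y : X) (w : USphere n) => |⟪ν y, rot g w⟫|)
      (σ.prod μ) := by
    refine Integrable.mono' (integrable_const 1) ?_ ?_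
    · have hm : AEStronglyMeasurable (fun p : X × USphere n => ⟪ν p.1, rot g p.2⟫) (σ.prod μ) :=
        hν.comp_fst.inner (hcont.comp_aestronglyMeasurable
          measurable_snd.aestronglyMeasurable)
      exact continuous_abs.comp_aestronglyMeasurable hm
    · have : ∀ᵐ p ∂(σ.prod μ), ‖ν p.1‖ = 1 := Measure.quasiMeasurePreserving_fst.ae hν1
      filter_upwards [this] with p hp
      rw [Function.uncurry_def, Real.norm_eq_abs, abs_abs]
      refine (abs_real_inner_le_norm _ _).trans ?_
      rw [hp, (rot g).norm_map, norm_sphere, mul_one]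
  rw [h1, integral_integral_swap hint, ← integral_const_mul]
  refine integral_congr_ae (ae_of_all _ fun w => ?_)
  simp only [cosSupport]
  rw [← mul_assoc]
  norm_num
  simp_rw [real_inner_comm]

end Abstract

/-- The mean over the rotation group of the `-n`-th power of a function on the sphere. -/
def invPowMean (e : USphere n) (H : Eucl n → ℝ) : ℝ := ∫ g, (H (rot g e))⁻¹ ^ n ∂haarSO n

lemma IsSublinear.exists_pos_le {H : Eucl n → ℝ} (hn : 3 ≤ n) (hH : IsSublinear H)
    (hpos : ∀ u, ‖u‖ = 1 → 0 < H u) : ∃ c, 0 < c ∧ ∀ u, ‖u‖ = 1 → c ≤ H u := by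
  obtain ⟨z, hz, -⟩ := exists_unit_orthogonal hn (0 : Eucl n) 0
  obtain ⟨u₀, hu₀, hmin⟩ := (isCompact_sphere (0 : Eucl n) 1).exists_isMinOn
    ⟨z, by simpa using hz⟩ hH.continuous.continuousOn
  exact ⟨H u₀, hpos u₀ (by simpa using hu₀), fun u hu => hmin (by simpa using hu)⟩

lemma integrable_haarSO {f : SOGroup n → ℝ} (hf : Continuous f) : Integrable f (haarSO n) := by
  rw [← integrableOn_univ]
  exact hf.continuousOn.integrableOn_compact isCompact_univ

lemma continuous_inv_pow_rot {H : Eucl n → ℝ} (hc : Continuous H)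
    (hpos : ∀ u, ‖u‖ = 1 → 0 < H u) (w : USphere n) :
    Continuous fun g : SOGroup n => (H (rot g w))⁻¹ ^ n := by
  refine ((hc.comp (continuous_rot_apply _)).inv₀ fun g => ?_).pow n
  exact (hpos _ (by rw [(rot g).norm_map, norm_sphere])).ne'

lemma volume_polar_eq (hn : 3 ≤ n) (e : USphere n) {H : Eucl n → ℝ} (hH : IsSublinear H)
    (hpos : ∀ u, ‖u‖ = 1 → 0 < H u) :
    volume (polarBody (bodyOf H)) = ENNReal.ofReal (omega n * invPowMean e H) := by
  rw [hH.polarBody_bodyOf, volume_sublevel hn (norm_sphere e) hH.continuous hH.smul hpos,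
    ENNReal.ofReal_mul (omega_pos n).le, invPowMean,
    ofReal_integral_eq_lintegral_ofReal (integrable_haarSO (continuous_inv_pow_rot hH.continuous hpos e))]
  refine ae_of_all _ fun g => ?_
  have := hpos (rot g e) (by rw [(rot g).norm_map, norm_sphere])
  positivity

lemma invPowMean_eq (hn : 3 ≤ n) (e w : USphere n) (H : Eucl n → ℝ) :
    invPowMean w H = invPowMean e H :=
  integral_haarSO_eq hn (fun x => (H x)⁻¹ ^ n) (by rw [norm_sphere, norm_sphere])

/-! ### Jensen's inequality over the sphere and over the rotation group, with equality cases. -/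

section Inequalities

variable {X : Type*} [MeasurableSpace X] {σ : Measure X} [IsFiniteMeasure σ] {ν : X → Eucl n}
  {μ : Measure (USphere n)} {e : USphere n}

lemma isProbabilityMeasure_two_smul (hμ : μ univ = 1 / 2) :
    IsProbabilityMeasure ((2 : ℝ≥0∞) • μ) :=
  ⟨by rw [Measure.smul_apply, hμ, smul_eq_mul, one_div, ENNReal.mul_inv_cancel] <;> simp⟩

lemma isFiniteMeasure_of_half (hμ : μ univ = 1 / 2) : IsFiniteMeasure μ :=
  ⟨by rw [hμ]; simp⟩

lemma ae_two_smul_iff {p : USphere n → Prop} : (∀ᵐ w ∂((2 : ℝ≥0∞) • μ), p w) ↔ ∀ᵐ w ∂μ, p w := by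
  rw [ae_iff, ae_iff, Measure.smul_apply, smul_eq_mul, mul_eq_zero]
  simp

variable (hn : 3 ≤ n) (hμz : IsZonal e μ) (hμ : μ univ = 1 / 2)
  (hν : AEStronglyMeasurable ν σ) (hν1 : ∀ᵐ y ∂σ, ‖ν y‖ = 1)

include hn hμz hμ hν hν1

lemma zonalSupport_rot_eq_integral (g : SOGroup n) :
    zonalSupport σ ν μ e (rot g e) =
      ∫ w : USphere n, cosSupport σ ν (rot g w) ∂((2 : ℝ≥0∞) • μ) := by
  have := isFiniteMeasure_of_half hμ
  rw [zonalSupport_rot hn hμz hν hν1, integral_smul_measure]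
  simp

omit hμz hμ in
-- Cauchy's surface area formula: after swapping integrals, the mean of |⟪g e, ν y⟫| over rotations
-- does not depend on y.
lemma integral_cosSupport_rot : ∫ g, cosSupport σ ν (rot g e) ∂haarSO n =
    σ.real univ * (omega (n - 1) / (n * omega n)) := by
  have hm : AEStronglyMeasurable (fun p : SOGroup n × X => |⟪rot p.1 e, ν p.2⟫|)
      ((haarSO n).prod σ) :=
    continuous_abs.comp_aestronglyMeasurable
      (((continuous_rot_apply (e : Eucl n)).comp_aestronglyMeasurable
        measurable_fst.aestronglyMeasurable).inner hν.comp_snd)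
  have hint : Integrable (Function.uncurry fun (g : SOGroup n) (y : X) => |⟪rot g e, ν y⟫|)
      ((haarSO n).prod σ) := by
    refine Integrable.mono' (integrable_const 1) hm ?_
    have : ∀ᵐ p ∂((haarSO n).prod σ), ‖ν p.2‖ = 1 := Measure.quasiMeasurePreserving_snd.ae hν1
    filter_upwards [this] with p hp
    rw [Function.uncurry_def, Real.norm_eq_abs, abs_abs]
    refine (abs_real_inner_le_norm _ _).trans ?_
    rw [hp, (rot p.1).norm_map, norm_sphere, mul_one]
  simp only [cosSupport]
  rw [integral_const_mul, integral_integral_swap hint]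
  have h2 : ∫ y, ∫ g, |⟪rot g e, ν y⟫| ∂haarSO n ∂σ =
      ∫ _, 2 * omega (n - 1) / (n * omega n) ∂σ := by
    refine integral_congr_ae ?_
    filter_upwards [hν1] with y hy
    rw [← integral_haarSO_abs_inner hn (norm_sphere e) hy]
    simp_rw [real_inner_comm]
  rw [h2, integral_const, smul_eq_mul]
  ring

omit hμz hν hν1 hn in
lemma integrable_comp_rot_prod {f : Eucl n → ℝ}
    (hf : Continuous fun p : SOGroup n × USphere n => f (rot p.1 p.2)) :
    Integrable (Function.uncurry fun (g : SOGroup n) (w : USphere n) => f (rot g w))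
      ((haarSO n).prod ((2 : ℝ≥0∞) • μ)) := by
  have := isProbabilityMeasure_two_smul hμ
  rw [← integrableOn_univ]
  exact hf.continuousOn.integrableOn_compact isCompact_univ

/-- Averaging against the probability measure 2μ leaves the rotational mean unchanged, since this
mean is the same at every point w of the sphere. -/
lemma integral_zonalSupport_rot : ∫ g, zonalSupport σ ν μ e (rot g e) ∂haarSO n =
    σ.real univ * (omega (n - 1) / (n * omega n)) := by
  have := isProbabilityMeasure_two_smul hμ
  have hc := (isSublinear_cosSupport hν hν1).continuous
  simp_rw [zonalSupport_rot_eq_integral hn hμz hμ hν hν1]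
  rw [integral_integral_swap (integrable_comp_rot_prod hμ (f := cosSupport σ ν)
    (hc.comp (continuous_rot.comp (continuous_fst.prodMk (continuous_subtype_val.comp
      continuous_snd)))))]
  simp_rw [integral_cosSupport_rot (e := _) hn hν hν1]
  simp

variable (hpos : ∀ u, ‖u‖ = 1 → 0 < cosSupport σ ν u)

include hpos

omit hn hμz hpos in
lemma integrable_cosSupport_rot (g : SOGroup n) :
    Integrable (fun w : USphere n => cosSupport σ ν (rot g w)) ((2 : ℝ≥0∞) • μ) := by
  have := isProbabilityMeasure_two_smul hμ
  rw [← integrableOn_univ]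
  refine ContinuousOn.integrableOn_compact isCompact_univ ?_
  exact ((isSublinear_cosSupport hν hν1).continuous.comp ((rot g).continuous.comp
    continuous_subtype_val)).continuousOn

lemma zonalSupport_pos (u : Eucl n) (hu : ‖u‖ = 1) : 0 < zonalSupport σ ν μ e u := by
  have := isProbabilityMeasure_two_smul hμ
  obtain ⟨g, rfl⟩ := exists_rotation hn (e := (e : Eucl n)) (u := u) (by rw [hu, norm_sphere])
  obtain ⟨c, hc, hcH⟩ := (isSublinear_cosSupport hν hν1).exists_pos_le hn hpos
  rw [zonalSupport_rot_eq_integral hn hμz hμ hν hν1]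
  exact integral_pos_of_le hc (integrable_cosSupport_rot hμ hν hν1 g)
    (ae_of_all _ fun w => hcH _ (by rw [(rot g).norm_map, norm_sphere]))

/-- The inequality between the mean of the support function and the volume of the polar body. -/
lemma mean_inv_pow_le : (σ.real univ * (omega (n - 1) / (n * omega n)))⁻¹ ^ n ≤
      invPowMean e (zonalSupport σ ν μ e) ∧
    ((σ.real univ * (omega (n - 1) / (n * omega n)))⁻¹ ^ n =
      invPowMean e (zonalSupport σ ν μ e) ↔
        ∃ r, ∀ u, ‖u‖ = 1 → zonalSupport σ ν μ e u = r) := by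
  have := isFiniteMeasure_of_half hμ
  have hQ := isSublinear_zonalSupport hn hμz hν hν1
  obtain ⟨c, hc, hcH⟩ := hQ.exists_pos_le hn (zonalSupport_pos hn hμz hμ hν hν1 hpos)
  have hcont : Continuous fun g : SOGroup n => zonalSupport σ ν μ e (rot g e) :=
    hQ.continuous.comp (continuous_rot_apply _)
  have hJ := jensen_inv_pow (n := n) (m := haarSO n) (by omega) hc (integrable_haarSO hcont)
    (ae_of_all _ fun g => hcH _ (by rw [(rot g).norm_map, norm_sphere]))
  rw [integral_zonalSupport_rot hn hμz hμ hν hν1] at hJ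
  refine ⟨hJ.1, fun h => ?_, ?_⟩
  · have h1 := (Continuous.ae_eq_iff_eq (haarSO n) hcont continuous_const).1 (hJ.2 h)
    refine ⟨σ.real univ * (omega (n - 1) / (n * omega n)), fun u hu => ?_⟩
    obtain ⟨g, rfl⟩ := exists_rotation hn (e := (e : Eucl n)) (u := u) (by rw [hu, norm_sphere])
    exact congrFun h1 g
  · rintro ⟨r, hr⟩
    have h1 : ∀ g : SOGroup n, zonalSupport σ ν μ e (rot g e) = r := fun g =>
      hr _ (by rw [(rot g).norm_map, norm_sphere])
    have h2 := integral_zonalSupport_rot hn hμz hμ hν hν1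
    simp_rw [h1] at h2
    rw [← h2, invPowMean]
    simp_rw [h1]
    simp

omit hμz hμ hν hν1 hpos in
/-- A function on the sphere whose rotations are constant along a non-polar parallel is
constant. -/
lemma eq_of_rot_eq {P Q : Eucl n → ℝ} {w : USphere n} (h1 : w ≠ e) (h2 : w ≠ -e)
    (h : ∀ g : SOGroup n, P (rot g w) = Q (rot g e)) : ∃ r, ∀ u, ‖u‖ = 1 → P u = r := by
  have ht := abs_inner_lt_one h1 h2
  set t := ⟪(e : Eucl n), (w : Eucl n)⟫
  -- If p and q lie on a common parallel {x : ⟪u, x⟫ = t}, rotations taking (e, w) to (u, p) and to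
  -- (u, q) give P p = Q u = P q.
  have hloc : ∀ p q : Eucl n, ‖p‖ = 1 → ‖q‖ = 1 → 2 * |t| ≤ ‖p + q‖ → P p = P q := by
    intro p q hp hq hpq
    obtain ⟨u, hu, hup, huq⟩ := exists_unit_inner_eq hn hp hq hpq
    obtain ⟨g, hg1, hg2⟩ := exists_rotation_pair hn (e := (e : Eucl n)) (w := w) (u := u) (p := p)
      (by rw [norm_sphere, hu]) (by rw [norm_sphere, hp]) hup.symm
    obtain ⟨g', hg1', hg2'⟩ := exists_rotation_pair hn (e := (e : Eucl n)) (w := w) (u := u) (p := q)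
      (by rw [norm_sphere, hu]) (by rw [norm_sphere, hq]) huq.symm
    rw [← hg2, h g, hg1, ← hg1', ← h g', hg2']
  have hlc : IsLocallyConstant fun p : USphere n => P p := by
    rw [IsLocallyConstant.iff_eventually_eq]
    intro p
    have hcont : Continuous fun q : USphere n => ‖(p : Eucl n) + q‖ := by fun_prop
    -- The strict inequality |t| < 1, that is, w not a pole, makes the condition hold on a
    -- neighbourhood of p.
    have hp : 2 * |t| < ‖(p : Eucl n) + p‖ := by
      rw [← two_smul ℝ, norm_smul, norm_sphere]; norm_num; linarith
    filter_upwards [hcont.continuousAt.eventually (lt_mem_nhds hp)] with q hq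
    exact (hloc p q (norm_sphere p) (norm_sphere q) hq.le).symm
  have hrank : 1 < Module.rank ℝ (Eucl n) := by
    rw [← Module.finrank_eq_rank, finrank_euclideanSpace_fin]
    exact_mod_cast (by omega : 1 < n)
  have : PreconnectedSpace (USphere n) :=
    isPreconnected_iff_preconnectedSpace.1 (isPreconnected_sphere hrank 0 1)
  refine ⟨P e, fun u hu => ?_⟩
  exact hlc.apply_eq_of_preconnectedSpace ⟨u, by simpa using hu⟩ e

omit hpos hν1 hν in
lemma eq_of_isDiscreteMeasure {P Q : Eucl n → ℝ} (hP : ∀ x, P (-x) = P x)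
    (hQ : ∀ g : SOGroup n, Q (rot g e) = ∫ w : USphere n, P (rot g w) ∂((2 : ℝ≥0∞) • μ))
    (hd : IsDiscreteMeasure μ) (g : SOGroup n) : Q (rot g e) = P (rot g e) := by
  have := isFiniteMeasure_of_half hμ
  have := isProbabilityMeasure_two_smul hμ
  rw [hQ, integral_congr_ae (g := fun _ => P (rot g e))]
  · simp
  · refine ae_two_smul_iff.2 ?_
    filter_upwards [hd.ae_eq_pole hn hμz] with w hw
    rcases hw with rfl | rfl
    · rfl
    · change P (rot g (-(e : Eucl n))) = _
      rw [map_neg, hP]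

/-- Jensen in w for each fixed g, then integration over g: after swapping, the mean of P(g w)^(-n)
over g is independent of w. In the equality case, Jensen is an equality for almost every g. -/
lemma invPowMean_zonalSupport_le :
    invPowMean e (zonalSupport σ ν μ e) ≤ invPowMean e (cosSupport σ ν) ∧
    (invPowMean e (zonalSupport σ ν μ e) = invPowMean e (cosSupport σ ν) ↔
      IsDiscreteMeasure μ ∨ ∃ r, ∀ u, ‖u‖ = 1 → cosSupport σ ν u = r) := by
  have hfin := isFiniteMeasure_of_half hμ
  have hprob := isProbabilityMeasure_two_smul hμ
  have hP := isSublinear_cosSupport hν hν1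
  have hQ := isSublinear_zonalSupport hn hμz hν hν1
  have hQpos := zonalSupport_pos hn hμz hμ hν hν1 hpos
  have hQP := zonalSupport_rot_eq_integral hn hμz hμ hν hν1
  obtain ⟨c, hc, hcH⟩ := hP.exists_pos_le hn hpos
  have hJ : ∀ g : SOGroup n, _ := fun g =>
    jensen_inv_pow (n := n) (m := (2 : ℝ≥0∞) • μ) (by omega) hc
      (integrable_cosSupport_rot hμ hν hν1 g)
      (ae_of_all _ fun w => hcH _ (by rw [(rot g).norm_map, norm_sphere]))
  simp_rw [← hQP] at hJ
  have hcontP : Continuous fun p : SOGroup n × USphere n => (cosSupport σ ν (rot p.1 p.2))⁻¹ ^ n := by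
    refine ((hP.continuous.comp (continuous_rot.comp (continuous_fst.prodMk
      (continuous_subtype_val.comp continuous_snd)))).inv₀ fun p => ?_).pow n
    exact (hpos _ (((rot p.1).norm_map _).trans (norm_sphere p.2))).ne'
  have hint := integrable_comp_rot_prod hμ
    (f := fun x => (cosSupport σ ν x)⁻¹ ^ n) hcontP
  have hswap : ∫ g, ∫ w : USphere n, (cosSupport σ ν (rot g w))⁻¹ ^ n ∂((2 : ℝ≥0∞) • μ) ∂haarSO n =
      invPowMean e (cosSupport σ ν) := by
    rw [integral_integral_swap hint]
    have : ∀ w : USphere n, ∫ g, (cosSupport σ ν (rot g w))⁻¹ ^ n ∂haarSO n =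
        invPowMean e (cosSupport σ ν) := fun w => invPowMean_eq hn e w _
    simp_rw [this]
    simp
  have hI1 := integrable_haarSO (continuous_inv_pow_rot hQ.continuous hQpos e)
  have hI2 : Integrable (fun g => ∫ w : USphere n, (cosSupport σ ν (rot g w))⁻¹ ^ n
      ∂((2 : ℝ≥0∞) • μ)) (haarSO n) := hint.integral_prod_left
  refine ⟨?_, fun h => ?_, ?_⟩
  · rw [← hswap]
    exact integral_mono hI1 hI2 fun g => (hJ g).1
  · by_cases hd : ∀ᵐ w ∂μ, w = e ∨ w = -e
    · refine Or.inl ⟨{e, -e}, (countable_singleton _).insert _, ?_⟩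
      exact measure_mono_null (fun w hw => by simpa using hw) (ae_iff.1 hd)
    · right
      rw [← hswap] at h
      have h1 := (integral_eq_iff_of_ae_le hI1 hI2 (ae_of_all _ fun g => (hJ g).1)).1 h
      have h2 : ∀ᵐ g ∂haarSO n, ∀ᵐ w : USphere n ∂((2 : ℝ≥0∞) • μ),
          cosSupport σ ν (rot g w) = zonalSupport σ ν μ e (rot g e) := by
        filter_upwards [h1] with g hg
        exact (hJ g).2 hg
      have hcP : Continuous fun p : SOGroup n × USphere n => cosSupport σ ν (rot p.1 p.2) :=
        hP.continuous.comp (continuous_rot.comp (continuous_fst.prodMk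
          (continuous_subtype_val.comp continuous_snd)))
      have hcQ : Continuous fun g : SOGroup n => zonalSupport σ ν μ e (rot g e) :=
        hQ.continuous.comp (continuous_rot_apply _)
      have hms : MeasurableSet {p : SOGroup n × USphere n |
          cosSupport σ ν (rot p.1 p.2) = zonalSupport σ ν μ e (rot p.1 e)} :=
        (isClosed_eq hcP (hcQ.comp continuous_fst)).measurableSet
      -- Exchanging the quantifiers gives, for almost every w, the equation for almost every g; as μ
      -- is not carried by the poles, such a w exists off them.
      rw [Measure.ae_ae_comm hms] at h2
      rw [ae_two_smul_iff] at h2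
      have h3 : ∃ w : USphere n, ¬ (w = e ∨ w = -e) ∧ ∀ᵐ g ∂haarSO n,
          cosSupport σ ν (rot g w) = zonalSupport σ ν μ e (rot g e) := by
        have : ∃ᶠ w in ae μ, ¬ (w = e ∨ w = -e) := fun hh => hd (hh.mono fun w hw => not_not.1 hw)
        exact (this.and_eventually h2).exists
      obtain ⟨w, hw, hw2⟩ := h3
      rw [not_or] at hw
      have h4 := (Continuous.ae_eq_iff_eq (haarSO n)
        (hP.continuous.comp (continuous_rot_apply (w : Eucl n))) hcQ).1 hw2
      exact eq_of_rot_eq hn hw.1 hw.2 fun g => congrFun h4 g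
  · intro h
    have hPQ : ∀ g : SOGroup n, zonalSupport σ ν μ e (rot g e) = cosSupport σ ν (rot g e) := by
      rcases h with hd | ⟨r, hr⟩
      · exact eq_of_isDiscreteMeasure hn hμz hμ cosSupport_neg hQP hd
      · intro g
        rw [hQP, hr (rot g e) (by rw [LinearIsometryEquiv.norm_map]; exact norm_sphere _),
          integral_congr_ae (g := fun _ => r) (ae_of_all _ fun w => hr _ (by
            rw [LinearIsometryEquiv.norm_map]; exact norm_sphere _))]
        simp
    simp only [invPowMean, hPQ]

end Inequalities

/-! ### Volumes of polar bodies, the degenerate case σ = 0, and the isoperimetric consequence. -/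

section Volumes

variable {X : Type*} [MeasurableSpace X] {σ : Measure X} [IsFiniteMeasure σ] {ν : X → Eucl n}
  {μ : Measure (USphere n)} {e : USphere n}

lemma volume_polarBody_zero (hn : 3 ≤ n) {H : Eucl n → ℝ} (hH : ∀ x, H x = 0) :
    volume (polarBody (bodyOf H)) = ∞ := by
  have hs : IsSublinear H := ⟨fun t x _ => by simp [hH], fun x y => by simp [hH]⟩
  have : Nonempty (Fin n) := ⟨⟨0, by omega⟩⟩
  have hu : {x : Eucl n | H x ≤ 1} = univ := eq_univ_of_forall fun x => by
    change H x ≤ 1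
    rw [hH]; exact zero_le_one
  rw [hs.polarBody_bodyOf, hu]
  exact measure_univ_of_isAddLeftInvariant volume

/-- The volume inequalities, with their equality cases, for the bodies generated by a finite
measure with a field of unit normals. -/
theorem volume_polar_inequalities (hn : 3 ≤ n) (hμz : IsZonal e μ) (hμ : μ univ = 1 / 2)
    (hν : AEStronglyMeasurable ν σ) (hν1 : ∀ᵐ y ∂σ, ‖ν y‖ = 1)
    (hdeg : σ = 0 ∨ ∀ u, ‖u‖ = 1 → 0 < cosSupport σ ν u) :
    ENNReal.ofReal ((n : ℝ) ^ n * omega n ^ (n + 1) / omega (n - 1) ^ n) * (σ univ ^ n)⁻¹ ≤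
      volume (polarBody (bodyOf (zonalSupport σ ν μ e))) ∧
    volume (polarBody (bodyOf (zonalSupport σ ν μ e))) ≤
      volume (polarBody (bodyOf (cosSupport σ ν))) ∧
    (ENNReal.ofReal ((n : ℝ) ^ n * omega n ^ (n + 1) / omega (n - 1) ^ n) * (σ univ ^ n)⁻¹ =
      volume (polarBody (bodyOf (zonalSupport σ ν μ e))) ↔
        IsBall (bodyOf (zonalSupport σ ν μ e))) ∧
    (volume (polarBody (bodyOf (zonalSupport σ ν μ e))) =
      volume (polarBody (bodyOf (cosSupport σ ν))) ↔
        IsDiscreteMeasure μ ∨ IsBall (bodyOf (cosSupport σ ν))) := by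
  have hfin := isFiniteMeasure_of_half hμ
  have hP := isSublinear_cosSupport hν hν1
  have hQ := isSublinear_zonalSupport hn hμz hν hν1
  have hω := omega_pos n
  have hω' := omega_pos (n - 1)
  have hn0 : (0 : ℝ) < n := by
    have : 0 < n := by omega
    exact_mod_cast this
  rw [hQ.isBall_bodyOf_iff hn zonalSupport_neg, hP.isBall_bodyOf_iff hn cosSupport_neg]
  rcases hdeg with rfl | hpos
  -- For σ = 0 all three quantities are ∞ and both support functions vanish, so every equality and
  -- every ball condition holds.
  · have h1 : ∀ x, zonalSupport (0 : Measure X) ν μ e x = 0 := fun x => by simp [zonalSupport]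
    have h2 : ∀ x, cosSupport (0 : Measure X) ν x = 0 := fun x => by simp [cosSupport]
    have hC : ENNReal.ofReal ((n : ℝ) ^ n * omega n ^ (n + 1) / omega (n - 1) ^ n) ≠ 0 := by
      rw [Ne, ENNReal.ofReal_eq_zero, not_le]
      positivity
    have hz : ((0 : Measure X) univ ^ n)⁻¹ = ∞ := by
      rw [Measure.coe_zero, Pi.zero_apply, zero_pow (by omega), ENNReal.inv_zero]
    rw [volume_polarBody_zero hn h1, volume_polarBody_zero hn h2, hz, ENNReal.mul_top hC]
    exact ⟨le_rfl, le_rfl, ⟨fun _ => ⟨0, fun u _ => h1 u⟩, fun _ => rfl⟩,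
      ⟨fun _ => Or.inr ⟨0, fun u _ => h2 u⟩, fun _ => rfl⟩⟩
  · have hQpos := zonalSupport_pos hn hμz hμ hν hν1 hpos
    set s := σ.real univ with hs
    have hs0 : 0 < s := by
      refine lt_of_le_of_ne measureReal_nonneg fun h0 => ?_
      have hσ0 : σ = 0 := by
        rw [hs, eq_comm, measureReal_eq_zero_iff, Measure.measure_univ_eq_zero] at h0
        exact h0
      have := hpos e (norm_sphere e)
      simp [cosSupport, hσ0] at this
    have hA : ENNReal.ofReal ((n : ℝ) ^ n * omega n ^ (n + 1) / omega (n - 1) ^ n) *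
        (σ univ ^ n)⁻¹ =
        ENNReal.ofReal (omega n * (s * (omega (n - 1) / (n * omega n)))⁻¹ ^ n) := by
      rw [← ofReal_measureReal (μ := σ) (s := univ), ← hs, ← ENNReal.ofReal_pow hs0.le,
        ← ENNReal.ofReal_inv_of_pos (by positivity), ← ENNReal.ofReal_mul (by positivity)]
      congr 1
      rw [mul_inv, inv_div, mul_pow, div_pow, mul_pow, inv_pow, pow_succ]
      ring
    have hm := mean_inv_pow_le hn hμz hμ hν hν1 hpos
    have hr := invPowMean_zonalSupport_le hn hμz hμ hν hν1 hpos
    have hL : 0 ≤ (s * (omega (n - 1) / (n * omega n)))⁻¹ ^ n := by positivity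
    have hQ0 := hL.trans hm.1
    have hP0 := hQ0.trans hr.1
    rw [hA, volume_polar_eq hn e hQ hQpos, volume_polar_eq hn e hP hpos]
    refine ⟨ENNReal.ofReal_le_ofReal (mul_le_mul_of_nonneg_left hm.1 hω.le),
      ENNReal.ofReal_le_ofReal (mul_le_mul_of_nonneg_left hr.1 hω.le), ?_, ?_⟩
    · rw [ENNReal.ofReal_eq_ofReal_iff (by positivity) (by positivity), mul_right_inj' hω.ne']
      exact hm.2
    · rw [ENNReal.ofReal_eq_ofReal_iff (by positivity) (by positivity), mul_right_inj' hω.ne']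
      exact hr.2

end Volumes

/-- The constant in the lower bound is K n^n ω_n with K = (ω_n / ω_{n-1})^n, the constant of the
assumed upper bound, so K cancels. -/
lemma isoperimetric_of_polar_inequality (hn : 3 ≤ n) {s V W : ℝ≥0∞} (hV : V ≠ 0)
    (h1 : ENNReal.ofReal ((n : ℝ) ^ n * omega n ^ (n + 1) / omega (n - 1) ^ n) * (s ^ n)⁻¹ ≤ W)
    (h2 : W * V ^ (n - 1) ≤ ENNReal.ofReal ((omega n / omega (n - 1)) ^ n)) :
    ENNReal.ofReal ((n : ℝ) ^ n * omega n) * V ^ (n - 1) ≤ s ^ n := by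
  have hω := omega_pos n
  have hω' := omega_pos (n - 1)
  have hn0 : (0 : ℝ) < n := by
    have : 0 < n := by omega
    exact_mod_cast this
  have h3 := (mul_le_mul_left h1 (V ^ (n - 1))).trans h2
  set K := (omega n / omega (n - 1)) ^ n with hK
  have hK0 : 0 < K := by positivity
  have hC : (n : ℝ) ^ n * omega n ^ (n + 1) / omega (n - 1) ^ n = K * ((n : ℝ) ^ n * omega n) := by
    rw [hK, div_pow, pow_succ]; ring
  have hKne : ENNReal.ofReal K ≠ 0 := by rwa [Ne, ENNReal.ofReal_eq_zero, not_le]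
  rw [hC, ENNReal.ofReal_mul hK0.le, mul_assoc, mul_assoc] at h3
  have h4 : ENNReal.ofReal ((n : ℝ) ^ n * omega n) * ((s ^ n)⁻¹ * V ^ (n - 1)) ≤ 1 := by
    have := (ENNReal.mul_le_mul_iff_right (b := ENNReal.ofReal ((n : ℝ) ^ n * omega n) * ((s ^ n)⁻¹ * V ^ (n - 1))) (c := 1)
      hKne ENNReal.ofReal_ne_top).1
    rw [mul_one] at this
    exact this h3
  rcases eq_or_ne (s ^ n) ∞ with ht | ht
  · rw [ht]; exact le_top
  -- A vanishing perimeter would turn the left side of `h4` into ∞ ≤ 1; this uses V ≠ 0.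
  have hs0 : s ^ n ≠ 0 := by
    intro h0
    rw [h0, ENNReal.inv_zero, ENNReal.top_mul (pow_ne_zero _ hV), ENNReal.mul_top] at h4
    · simp at h4
    · rw [Ne, ENNReal.ofReal_eq_zero, not_le]; positivity
  calc ENNReal.ofReal ((n : ℝ) ^ n * omega n) * V ^ (n - 1)
      = ENNReal.ofReal ((n : ℝ) ^ n * omega n) * ((s ^ n)⁻¹ * V ^ (n - 1)) * s ^ n := by
        rw [mul_assoc, mul_comm _ (s ^ n), ← mul_assoc (s ^ n), ENNReal.mul_inv_cancel hs0 ht,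
          one_mul]
    _ ≤ 1 * s ^ n := by gcongr
    _ = s ^ n := one_mul _

/-! ### Polar decomposition of vector measures -/

open VectorMeasure in
-- Each coordinate of D is a signed measure absolutely continuous with respect to the variation; the
-- density is assembled from the scalar Radon–Nikodym derivatives.
lemma exists_density_variation (D : VectorMeasure (Eucl n) (Eucl n)) [IsFiniteMeasure D.variation] :
    ∃ f : Eucl n → Eucl n, Measurable f ∧ Integrable f D.variation ∧
      ∀ s, MeasurableSet s → D s = ∫ x in s, f x ∂D.variation := by
  classical
  set τ := D.variation with hτ
  let p : Fin n → (Eucl n →L[ℝ] ℝ) := fun i => EuclideanSpace.proj i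
  let S : Fin n → SignedMeasure (Eucl n) := fun i =>
    D.mapRange (p i).toLinearMap.toAddMonoidHom (p i).continuous
  have hS : ∀ i s, S i s = D s i := fun i s => rfl
  have hac : ∀ i, S i ≪ᵥ τ.toENNRealVectorMeasure := by
    intro i
    refine VectorMeasure.AbsolutelyContinuous.mk fun s hs h0 => ?_
    rw [Measure.toENNRealVectorMeasure_apply_measurable hs] at h0
    have : ‖D s‖ₑ ≤ 0 := (enorm_measure_le_variation D s).trans h0.le
    have h1 : D s = 0 := by simpa using this
    rw [hS, h1]; rfl
  let g : Fin n → Eucl n → ℝ := fun i => (S i).rnDeriv τ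
  have hgm : ∀ i, Measurable (g i) := fun i => SignedMeasure.measurable_rnDeriv _ _
  have hgi : ∀ i, Integrable (g i) τ := fun i => SignedMeasure.integrable_rnDeriv _ _
  have hg : ∀ i, τ.withDensityᵥ (g i) = S i := fun i =>
    SignedMeasure.withDensityᵥ_rnDeriv_eq _ _ (hac i)
  let f : Eucl n → Eucl n := fun x => WithLp.toLp 2 (fun i => g i x)
  have hfm : Measurable f := by
    have : Measurable fun x => fun i => g i x := measurable_pi_lambda _ hgm
    exact (PiLp.continuous_toLp 2 _).measurable.comp this
  have hfi : Integrable f τ := by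
    have : Integrable (fun x => ∑ i, g i x • (EuclideanSpace.single i (1:ℝ) : Eucl n)) τ :=
      integrable_finsetSum _ fun i _ => (hgi i).smul_const _
    refine this.congr (Filter.Eventually.of_forall fun x => ?_)
    ext j
    simp [f, Pi.single_apply]
  refine ⟨f, hfm, hfi, fun s hs => ?_⟩
  ext i
  rw [← hS, ← hg, withDensityᵥ_apply (hgi i) hs]
  exact (p i).integral_comp_comm hfi.integrableOn

/-- The variation of f |D| is ‖f‖ |D|, so ‖f‖ = 1 almost everywhere, and f is redefined on the
remaining null set. The integral formula passes from indicators to sums, L¹ limits and a.e. equal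
functions. -/
lemma exists_polar (hn : 3 ≤ n) (D : VectorMeasure (Eucl n) (Eucl n))
    [IsFiniteMeasure D.variation] :
    ∃ f : Eucl n → Eucl n, Measurable f ∧ (∀ x, ‖f x‖ = 1) ∧
      (∀ s, MeasurableSet s → D s = ∫ x in s, f x ∂D.variation) ∧
      ∀ φ : Eucl n → Eucl n, Integrable φ D.variation →
        ∫ᵛ x, φ x ∂[innerSL ℝ; D] = ∫ x, ⟪φ x, f x⟫ ∂D.variation := by
  classical
  obtain ⟨f, hfm, hfi, hf⟩ := exists_density_variation D
  have hD : D = D.variation.withDensityᵥ f := by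
    ext1 s hs
    rw [withDensityᵥ_apply hfi hs, hf s hs]
  have hone : (fun x => ‖f x‖ₑ) =ᵐ[D.variation] fun _ => (1 : ℝ≥0∞) := by
    have h1 := Measure.variation_withDensityᵥ hfi
    rw [← hD] at h1
    rw [← withDensity_eq_iff (by fun_prop) (by fun_prop)
      (by simpa [hasFiniteIntegral_iff_enorm] using hfi.2.ne), ← h1]
    exact withDensity_one.symm
  obtain ⟨e, he⟩ : ∃ e : Eucl n, ‖e‖ = 1 :=
    ⟨EuclideanSpace.single ⟨0, by omega⟩ 1, by simp⟩
  let g : Eucl n → Eucl n := fun x => if ‖f x‖ = 1 then f x else e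
  have hgf : g =ᵐ[D.variation] f := by
    filter_upwards [hone] with x hx
    have : ‖f x‖ = 1 := by
      rw [← toReal_enorm, hx]; simp
    simp [g, this]
  have hgm : Measurable g :=
    Measurable.ite (measurableSet_eq_fun hfm.norm measurable_const) hfm measurable_const
  have hg1 : ∀ x, ‖g x‖ = 1 := by
    intro x
    by_cases h : ‖f x‖ = 1 <;> simp [g, h, he]
  have hgD : ∀ s, MeasurableSet s → D s = ∫ x in s, g x ∂D.variation := by
    intro s hs
    rw [hf s hs]
    exact (integral_congr_ae (ae_restrict_of_ae hgf)).symm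
  have hinn : ∀ φ : Eucl n → Eucl n, Integrable φ D.variation →
      Integrable (fun x => ⟪φ x, g x⟫) D.variation := by
    intro φ hφ
    refine hφ.norm.mono (hφ.1.inner hgm.aestronglyMeasurable) (ae_of_all _ fun x => ?_)
    calc ‖⟪φ x, g x⟫‖ ≤ ‖φ x‖ * ‖g x‖ := norm_inner_le_norm _ _
      _ = ‖‖φ x‖‖ := by rw [hg1]; simp
  have hgi : Integrable g D.variation :=
    ⟨hgm.aestronglyMeasurable, HasFiniteIntegral.of_bounded (C := 1)
      (ae_of_all _ fun x => (hg1 x).le)⟩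
  refine ⟨g, hgm, hg1, hgD, fun φ hφ => ?_⟩
  refine Integrable.induction (P := fun φ : Eucl n → Eucl n =>
    ∫ᵛ x, φ x ∂[innerSL ℝ; D] = ∫ x, ⟪φ x, g x⟫ ∂D.variation) ?_ ?_ ?_ ?_ hφ
  · intro c s hs hlt
    rw [VectorMeasure.integral_indicator_const _ hs]
    rw [hgD s hs, ← integral_indicator hs]
    have : (fun x => ⟪s.indicator (fun _ => c) x, g x⟫) = fun x => innerSL ℝ c (s.indicator g x) := by
      ext x
      by_cases h : x ∈ s <;> simp [h]
    rw [this]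
    exact ((innerSL ℝ c).integral_comp_comm (hgi.indicator hs)).symm
  · intro φ ψ hd hφ hψ h1 h2
    have e1 := VectorMeasure.integral_add (μ := D) (B := innerSL ℝ) hφ hψ
    rw [e1, h1, h2, ← integral_add (hinn φ hφ) (hinn ψ hψ)]
    simp [inner_add_left]
  · refine isClosed_eq (VectorMeasure.continuous_integral (μ := D) (B := innerSL ℝ)) ?_
    refine (LipschitzWith.of_dist_le_mul (K := 1) fun φ ψ => ?_).continuous
    rw [Real.dist_eq, ← integral_sub (hinn _ (L1.integrable_coeFn φ)) (hinn _ (L1.integrable_coeFn ψ)),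
      dist_eq_norm, L1.norm_eq_integral_norm, NNReal.coe_one, one_mul]
    rw [← Real.norm_eq_abs]
    refine (norm_integral_le_integral_norm _).trans (integral_mono_ae ?_ ?_ ?_)
    · exact ((hinn _ (L1.integrable_coeFn φ)).sub (hinn _ (L1.integrable_coeFn ψ))).norm
    · exact (L1.integrable_coeFn (φ - ψ)).norm
    · filter_upwards [Lp.coeFn_sub φ ψ] with x hx
      rw [hx, ← inner_sub_left]
      calc ‖⟪φ x - ψ x, g x⟫‖ ≤ ‖φ x - ψ x‖ * ‖g x‖ := norm_inner_le_norm _ _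
        _ = _ := by rw [hg1]; simp
  · intro φ ψ h hφ ih
    rw [← VectorMeasure.integral_congr_ae h, ih]
    refine integral_congr_ae ?_
    filter_upwards [h] with x hx
    rw [hx]

/-! ### The Gauss–Green formula for scalar test functions -/

/-- The vector measure `f τ` with `‖f‖ = 1` is the weak gradient of the indicator function of `L`,
tested against the fields `g • v` with a scalar function `g` and a constant vector `v`. -/
structure IsGradPair (L : Set (Eucl n)) (τ : Measure (Eucl n)) (f : Eucl n → Eucl n) : Prop where
  nullMeasurableSet : NullMeasurableSet L
  measurable : Measurable f
  norm_eq : ∀ x, ‖f x‖ = 1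
  integral_eq : ∀ g : Eucl n → ℝ, ContDiff ℝ 1 g → HasCompactSupport g → ∀ v : Eucl n,
    ∫ x in L, fderiv ℝ g x v = - ∫ x, g x * ⟪v, f x⟫ ∂τ

lemma divergence_smul_const {g : Eucl n → ℝ} (hg : ContDiff ℝ 1 g) (v x : Eucl n) :
    divergence (fun y => g y • v) x = fderiv ℝ g x v := by
  have hd : DifferentiableAt ℝ g x := hg.differentiable (by simp) x
  have h1 : fderiv ℝ (fun y => g y • v) x = (fderiv ℝ g x).smulRight v :=
    (hd.hasFDerivAt.smul_const v).fderiv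
  unfold divergence
  rw [h1]
  have h2 : v = ∑ i, v i • (EuclideanSpace.single i (1 : ℝ) : Eucl n) := by
    ext j
    simp [Pi.single_apply]
  conv_rhs => rw [h2, map_sum]
  refine Finset.sum_congr rfl fun i _ => ?_
  simp [mul_comm]

lemma continuous_fderiv_apply_const {g : Eucl n → ℝ} (hg : ContDiff ℝ 1 g) (v : Eucl n) :
    Continuous fun x => fderiv ℝ g x v :=
  (hg.continuous_fderiv (by simp)).clm_apply continuous_const

lemma hasCompactSupport_fderiv_apply_const {g : Eucl n → ℝ} (hg : HasCompactSupport g)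
    (v : Eucl n) : HasCompactSupport fun x => fderiv ℝ g x v :=
  hg.fderiv_apply (𝕜 := ℝ) v

lemma integrable_fderiv_apply_const {g : Eucl n → ℝ} (hg : ContDiff ℝ 1 g)
    (hc : HasCompactSupport g) (v : Eucl n) : Integrable fun x => fderiv ℝ g x v :=
  (continuous_fderiv_apply_const hg v).integrable_of_hasCompactSupport
    (hasCompactSupport_fderiv_apply_const hc v)

lemma integral_fderiv_apply_eq_zero {g : Eucl n → ℝ} (hg : ContDiff ℝ 1 g)
    (hc : HasCompactSupport g) (v : Eucl n) : ∫ x, fderiv ℝ g x v = 0 := by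
  have := integral_mul_fderiv_eq_neg_fderiv_mul_of_integrable (μ := (volume : Measure (Eucl n)))
    (f := fun _ => (1 : ℝ)) (g := g) (v := v) (by simp)
    (by simpa using integrable_fderiv_apply_const hg hc v)
    (by simpa using hg.continuous.integrable_of_hasCompactSupport hc)
    (fun x _ => by fun_prop) (fun x _ => hg.differentiable (by simp) x)
  simpa using this

lemma exists_isGradPair (hn : 3 ≤ n) {L : Set (Eucl n)} (hL : NullMeasurableSet L)
    {D : VectorMeasure (Eucl n) (Eucl n)} (hD : IsGradMeasure L D) :
    ∃ f, IsGradPair L D.variation f ∧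
      ∀ s, MeasurableSet s → D s = ∫ x in s, f x ∂D.variation := by
  have : IsFiniteMeasure D.variation := ⟨hD.1⟩
  obtain ⟨f, hfm, hf1, hfD, hf⟩ := exists_polar hn D
  refine ⟨f, ⟨hL, hfm, hf1, fun g hg hc v => ?_⟩, hfD⟩
  have hφ : IsTestField fun y => g y • v := ⟨hg.smul contDiff_const, hc.smul_right⟩
  have h := hD.2 _ hφ
  rw [hf _ (hφ.1.continuous.integrable_of_hasCompactSupport hφ.2)] at h
  simp_rw [divergence_smul_const hg, real_inner_smul_left] at h
  exact h

section
variable {L : Set (Eucl n)} {τ : Measure (Eucl n)} {f : Eucl n → Eucl n}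

/-- Derivatives of compactly supported functions integrate to zero over the whole space. Every
estimate for L thereby also applies to its complement. -/
lemma IsGradPair.compl (h : IsGradPair L τ f) : IsGradPair Lᶜ τ (fun x => - f x) where
  nullMeasurableSet := h.nullMeasurableSet.compl
  measurable := h.measurable.neg
  norm_eq x := by rw [norm_neg, h.norm_eq]
  integral_eq g hg hc v := by
    have h1 := integral_add_compl₀ h.nullMeasurableSet (integrable_fderiv_apply_const hg hc v)
    rw [integral_fderiv_apply_eq_zero hg hc, h.integral_eq g hg hc v] at h1
    simp only [inner_neg_right, mul_neg, integral_neg, neg_neg]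
    linarith

lemma IsGradPair.abs_inner_le (h : IsGradPair L τ f) (v x : Eucl n) : |⟪v, f x⟫| ≤ ‖v‖ := by
  simpa [h.norm_eq] using abs_real_inner_le_norm v (f x)

lemma IsGradPair.integrable_mul_inner [IsFiniteMeasure τ] (h : IsGradPair L τ f) {g : Eucl n → ℝ}
    (hg : Integrable g τ) (v : Eucl n) : Integrable (fun x => g x * ⟪v, f x⟫) τ := by
  refine (hg.norm.mul_const ‖v‖).mono (hg.1.mul
    (aestronglyMeasurable_const.inner h.measurable.aestronglyMeasurable)) (ae_of_all _ fun x => ?_)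
  rw [norm_mul, norm_mul, norm_norm, norm_norm]
  gcongr
  exact h.abs_inner_le v x

lemma IsGradPair.integrable_inner [IsFiniteMeasure τ] (h : IsGradPair L τ f) (v : Eucl n) :
    Integrable (fun x => ⟪v, f x⟫) τ := by
  simpa using h.integrable_mul_inner (integrable_const (1 : ℝ)) v

end

/-! ### Radial cutoff functions -/

/-- A `C¹` function which is `0` on `(-∞, 0]`, `1` on `[1, ∞)` and increasing in between. -/
def smoothStep (t : ℝ) : ℝ := ∫ s in (0 : ℝ)..t, 6 * max 0 (s * (1 - s))

lemma hasDerivAt_smoothStep (t : ℝ) : HasDerivAt smoothStep (6 * max 0 (t * (1 - t))) t := by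
  have hc : Continuous fun s : ℝ => 6 * max 0 (s * (1 - s)) := by fun_prop
  exact intervalIntegral.integral_hasDerivAt_right (hc.intervalIntegrable _ _)
    (hc.stronglyMeasurableAtFilter _ _) hc.continuousAt

lemma contDiff_smoothStep : ContDiff ℝ 1 smoothStep := by
  rw [contDiff_one_iff_deriv]
  refine ⟨fun t => (hasDerivAt_smoothStep t).differentiableAt, ?_⟩
  rw [show deriv smoothStep = fun t => 6 * max 0 (t * (1 - t)) from
    funext fun t => (hasDerivAt_smoothStep t).deriv]
  fun_prop

lemma monotone_smoothStep : Monotone smoothStep :=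
  monotone_of_hasDerivAt_nonneg hasDerivAt_smoothStep fun t => by
    have := le_max_left 0 (t * (1 - t))
    simp only [Pi.zero_apply]
    linarith

lemma smoothStep_of_nonpos {t : ℝ} (ht : t ≤ 0) : smoothStep t = 0 := by
  unfold smoothStep
  rw [intervalIntegral.integral_congr (g := fun _ => (0 : ℝ))]
  · simp
  · intro s hs
    rw [uIcc_of_ge ht] at hs
    have : s * (1 - s) ≤ 0 := mul_nonpos_of_nonpos_of_nonneg hs.2 (by linarith [hs.2])
    simp [this]

lemma smoothStep_of_one_le {t : ℝ} (ht : 1 ≤ t) : smoothStep t = 1 := by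
  have hc : Continuous fun s : ℝ => 6 * max 0 (s * (1 - s)) := by fun_prop
  unfold smoothStep
  rw [← intervalIntegral.integral_add_adjacent_intervals (b := 1) (hc.intervalIntegrable _ _)
    (hc.intervalIntegrable _ _)]
  have h2 : ∫ s in (1 : ℝ)..t, 6 * max 0 (s * (1 - s)) = 0 := by
    rw [intervalIntegral.integral_congr (g := fun _ => (0 : ℝ))]
    · simp
    · intro s hs
      rw [uIcc_of_le ht] at hs
      have : s * (1 - s) ≤ 0 :=
        mul_nonpos_of_nonneg_of_nonpos (by linarith [hs.1]) (by linarith [hs.1])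
      simp [this]
  -- The integral of s - s² over [0, 1] is 1/6, whence the factor 6.
  have h1 : ∫ s in (0 : ℝ)..1, 6 * max 0 (s * (1 - s)) = ∫ s in (0 : ℝ)..1, 6 * (s - s ^ 2) := by
    refine intervalIntegral.integral_congr fun s hs => ?_
    rw [uIcc_of_le zero_le_one] at hs
    have : 0 ≤ s * (1 - s) := mul_nonneg hs.1 (by linarith [hs.2])
    simp only [max_eq_right this]
    ring
  rw [h2, h1, intervalIntegral.integral_const_mul,
    intervalIntegral.integral_sub (continuous_id'.intervalIntegrable _ _)
      ((continuous_pow 2).intervalIntegrable _ _), integral_id, integral_pow]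
  norm_num

lemma smoothStep_mem_Icc (t : ℝ) : smoothStep t ∈ Icc (0 : ℝ) 1 := by
  constructor
  · rw [← smoothStep_of_nonpos (min_le_right t 0)]
    exact monotone_smoothStep (min_le_left _ _)
  · rw [← smoothStep_of_one_le (le_max_right t 1)]
    exact monotone_smoothStep (le_max_left _ _)

/-- The radial profile which is `1` on `[0, ρ]` and `0` on `[ρ + h, ∞)`. -/
def radialProfile (ρ h r : ℝ) : ℝ := smoothStep (((ρ + h) ^ 2 - r ^ 2) / (h * (2 * ρ + h)))

/-- The radial `C¹` cutoff which is `1` on the ball of radius `ρ` about `x` and vanishes outside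
the ball of radius `ρ + h`. -/
def radialCutoff (x : Eucl n) (ρ h : ℝ) (y : Eucl n) : ℝ := radialProfile ρ h ‖y - x‖

lemma radialProfile_mem_Icc (ρ h r : ℝ) : radialProfile ρ h r ∈ Icc (0 : ℝ) 1 :=
  smoothStep_mem_Icc _

lemma antitoneOn_radialProfile {ρ h : ℝ} (hρ : 0 ≤ ρ) (hh : 0 < h) :
    AntitoneOn (radialProfile ρ h) (Ici 0) := by
  intro r hr s hs hrs
  refine monotone_smoothStep ?_
  have : 0 ≤ r := hr
  gcongr

lemma radialProfile_of_le {ρ h r : ℝ} (hρ : 0 ≤ ρ) (hh : 0 < h) (hr : 0 ≤ r) (hrρ : r ≤ ρ) :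
    radialProfile ρ h r = 1 := by
  refine smoothStep_of_one_le ?_
  rw [one_le_div (by positivity)]
  nlinarith

lemma radialProfile_of_ge {ρ h r : ℝ} (hρ : 0 ≤ ρ) (hh : 0 < h) (hrρ : ρ + h ≤ r) :
    radialProfile ρ h r = 0 := by
  refine smoothStep_of_nonpos (div_nonpos_of_nonpos_of_nonneg ?_ (by positivity))
  nlinarith

lemma continuous_radialProfile (ρ h : ℝ) : Continuous (radialProfile ρ h) := by
  unfold radialProfile
  exact contDiff_smoothStep.continuous.comp (by fun_prop)

/-- The profile is a function of ‖y - x‖², hence smooth at the centre as well. Its denominator is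
h(2ρ + h) = (ρ + h)² - ρ². -/
lemma contDiff_radialCutoff (x : Eucl n) (ρ h : ℝ) : ContDiff ℝ 1 (radialCutoff x ρ h) := by
  unfold radialCutoff radialProfile
  refine contDiff_smoothStep.comp ((contDiff_const.sub ?_).div_const _)
  exact (contDiff_id.sub contDiff_const).norm_sq ℝ

lemma hasCompactSupport_radialCutoff (x : Eucl n) {ρ h : ℝ} (hρ : 0 ≤ ρ) (hh : 0 < h) :
    HasCompactSupport (radialCutoff x ρ h) := by
  refine HasCompactSupport.intro (isCompact_closedBall x (ρ + h)) fun y hy => ?_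
  refine radialProfile_of_ge hρ hh ?_
  rw [mem_closedBall, dist_eq_norm, not_le] at hy
  exact hy.le

lemma fderiv_radialCutoff (x : Eucl n) (ρ h : ℝ) (y v : Eucl n) :
    ∃ t : ℝ, t = ((ρ + h) ^ 2 - ‖y - x‖ ^ 2) / (h * (2 * ρ + h)) ∧
    fderiv ℝ (radialCutoff x ρ h) y v =
      6 * max 0 (t * (1 - t)) * (-(2 * ⟪y - x, v⟫) / (h * (2 * ρ + h))) := by
  refine ⟨_, rfl, ?_⟩
  have h1 : HasFDerivAt (fun z : Eucl n => ‖z - x‖ ^ 2)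
      (2 • (innerSL ℝ (y - x)).comp (ContinuousLinearMap.id ℝ (Eucl n))) y :=
    ((hasFDerivAt_id y).sub_const x).norm_sq
  have h2 := (h1.const_sub ((ρ + h) ^ 2)).mul_const (h * (2 * ρ + h))⁻¹
  have h3 := (hasDerivAt_smoothStep
    (((ρ + h) ^ 2 - ‖y - x‖ ^ 2) * (h * (2 * ρ + h))⁻¹)).comp_hasFDerivAt y h2
  have h4 : radialCutoff x ρ h =
      smoothStep ∘ fun z : Eucl n => ((ρ + h) ^ 2 - ‖z - x‖ ^ 2) * (h * (2 * ρ + h))⁻¹ := rfl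
  rw [h4, h3.fderiv]
  simp only [div_eq_mul_inv, smul_apply, neg_apply,
    ContinuousLinearMap.comp_id, innerSL_apply_apply, smul_eq_mul, nsmul_eq_mul, Nat.cast_ofNat]
  ring

/-- The constant 3/h is the product of 6 t(1 - t) ≤ 3/2 and 2(ρ + h)/(h(2ρ + h)) ≤ 2/h. -/
lemma abs_fderiv_radialCutoff_le (x : Eucl n) {ρ h : ℝ} (hρ : 0 ≤ ρ) (hh : 0 < h) (y : Eucl n)
    {v : Eucl n} (hv : ‖v‖ = 1) :
    |fderiv ℝ (radialCutoff x ρ h) y v| ≤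
      (ball x (ρ + h) \ ball x ρ).indicator (fun _ => 3 / h) y := by
  obtain ⟨t, ht, hd⟩ := fderiv_radialCutoff x ρ h y v
  have hpos : 0 < h * (2 * ρ + h) := by positivity
  rw [hd]
  by_cases hy : y ∈ ball x (ρ + h) \ ball x ρ
  · rw [indicator_of_mem hy]
    have hy1 : ‖y - x‖ < ρ + h := by simpa [dist_eq_norm] using hy.1
    have hi : |⟪y - x, v⟫| ≤ ρ + h := by
      have := abs_real_inner_le_norm (y - x) v
      rw [hv, mul_one] at this
      exact this.trans hy1.le
    have hk : 6 * max 0 (t * (1 - t)) ≤ 3 / 2 := by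
      have : max 0 (t * (1 - t)) ≤ 1 / 4 := max_le (by norm_num) (by nlinarith [sq_nonneg (t - 1/2)])
      linarith
    have hk0 : 0 ≤ 6 * max 0 (t * (1 - t)) := by positivity
    rw [abs_mul, abs_of_nonneg hk0, abs_div, abs_neg, abs_mul, abs_two, abs_of_pos hpos]
    calc 6 * max 0 (t * (1 - t)) * (2 * |⟪y - x, v⟫| / (h * (2 * ρ + h)))
        ≤ 3 / 2 * (2 * (ρ + h) / (h * (ρ + h))) := by
          gcongr
          linarith
      _ = 3 / h := by
          have : ρ + h ≠ 0 := by positivity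
          field_simp
  · rw [indicator_of_notMem hy]
    have : max 0 (t * (1 - t)) = 0 := by
      rw [max_eq_left]
      simp only [Set.mem_sdiff, mem_ball, dist_eq_norm, not_and, not_not] at hy
      by_cases h1 : ‖y - x‖ < ρ + h
      · have h2 := hy h1
        have : 1 ≤ t := by
          rw [ht, one_le_div hpos]
          nlinarith [norm_nonneg (y - x)]
        nlinarith
      · rw [not_lt] at h1
        have : t ≤ 0 := by
          rw [ht]
          exact div_nonpos_of_nonpos_of_nonneg (by nlinarith) hpos.le
        nlinarith
    simp [this]

/-! ### Growth of the mass near a boundary point -/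

/-- Layer-cake formula: the superlevel sets of a decreasing radial profile are closed balls.
Constancy on [0, ρ] and vanishing beyond b confine the relevant radii to [ρ, b), so the comparison
is needed only for small positive radii. -/
lemma lintegral_radial_le {α β : Measure (Eucl n)} (x : Eucl n) {c : ℝ≥0∞} (hc : c ≠ ∞) {ρ b : ℝ}
    (hρ : 0 < ρ) {Ψ : ℝ → ℝ} (hΨ : AntitoneOn Ψ (Ici 0)) (hcont : Continuous Ψ)
    (h0 : ∀ r, 0 ≤ Ψ r) (hΨρ : Ψ ρ = Ψ 0) (hb : ∀ r, b ≤ r → Ψ r = 0)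
    (h : ∀ s, 0 < s → s < b → α (closedBall x s) ≤ c * β (closedBall x s)) :
    ∫⁻ y, ENNReal.ofReal (Ψ ‖y - x‖) ∂α ≤ c * ∫⁻ y, ENNReal.ofReal (Ψ ‖y - x‖) ∂β := by
  have hm : Measurable fun y : Eucl n => Ψ ‖y - x‖ :=
    (hcont.comp (by fun_prop : Continuous fun y : Eucl n => ‖y - x‖)).measurable
  rw [lintegral_eq_lintegral_meas_le α (ae_of_all _ fun y => h0 _) hm.aemeasurable,
    lintegral_eq_lintegral_meas_le β (ae_of_all _ fun y => h0 _) hm.aemeasurable,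
    ← lintegral_const_mul' c _ hc]
  refine lintegral_mono_ae ((ae_restrict_iff' measurableSet_Ioi).2 (ae_of_all _ fun t ht => ?_))
  have ht0 : 0 < t := ht
  by_cases htΨ : t ≤ Ψ 0
  · set T : Set ℝ := {r | 0 ≤ r ∧ t ≤ Ψ r} with hT
    have hTc : IsClosed T := (isClosed_le continuous_const continuous_id).inter
      (isClosed_le continuous_const hcont)
    have hρT : ρ ∈ T := ⟨hρ.le, hΨρ ▸ htΨ⟩
    have hTb : ∀ r ∈ T, r < b := by
      intro r hr
      by_contra hbr
      have h1 := hb r (not_lt.1 hbr)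
      have h2 := hr.2
      linarith
    have hTba : BddAbove T := ⟨b, fun r hr => (hTb r hr).le⟩
    have hs := hTc.csSup_mem ⟨ρ, hρT⟩ hTba
    set s := sSup T
    have hset : {y : Eucl n | t ≤ Ψ ‖y - x‖} = closedBall x s := by
      ext y
      rw [mem_closedBall, dist_eq_norm]
      constructor
      · intro hy
        exact le_csSup hTba ⟨norm_nonneg _, hy⟩
      · intro hy
        exact hs.2.trans (hΨ (norm_nonneg _) hs.1 hy)
    rw [hset]
    exact h s (hρ.trans_le (le_csSup hTba hρT)) (hTb s hs)
  · have : {y : Eucl n | t ≤ Ψ ‖y - x‖} = ∅ := by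
      ext y
      simp only [mem_ofPred_eq, mem_empty_iff_false, iff_false, not_le]
      exact (hΨ (mem_Ici.2 le_rfl) (mem_Ici.2 (norm_nonneg _)) (norm_nonneg _)).trans_lt (not_le.1 htΨ)
    simp [this]

section
variable {L : Set (Eucl n)} {τ : Measure (Eucl n)} {f : Eucl n → Eucl n}

lemma volume_inter_ball_ne_top (L : Set (Eucl n)) (x : Eucl n) (r : ℝ) :
    volume (L ∩ ball x r) ≠ ∞ :=
  ((measure_mono inter_subset_right).trans_lt measure_ball_lt_top).ne

/-- With a radial cutoff g, ½ ∫ g dτ ≤ ∫ g ⟪v, f⟫ dτ ≤ |∫_L ∂_v g|, and the gradient of g is at most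
3/h on an annulus. This bounds the perimeter mass by the volume of L in the annulus, with constant 6
= 2 · 3. -/
lemma IsGradPair.mass_le [IsFiniteMeasure τ] (hp : IsGradPair L τ f) {x v : Eucl n} (hv : ‖v‖ = 1)
    {r₀ : ℝ} (hr : ∀ s, 0 < s → s < r₀ →
      τ.real (closedBall x s) ≤ 2 * ∫ y in closedBall x s, ⟪v, f y⟫ ∂τ)
    {ρ h : ℝ} (hρ : 0 < ρ) (hh : 0 < h) (hρh : ρ + h ≤ r₀) :
    τ.real (closedBall x ρ) ≤
      6 / h * (volume.real (L ∩ ball x (ρ + h)) - volume.real (L ∩ ball x ρ)) := by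
  set g := radialCutoff x ρ h with hg
  have hgc := contDiff_radialCutoff x ρ h
  have hgs := hasCompactSupport_radialCutoff x hρ.le hh
  have hgi : Integrable g τ := hgc.continuous.integrable_of_hasCompactSupport hgs
  have hgI : ∀ y, g y ∈ Icc (0 : ℝ) 1 := fun y => radialProfile_mem_Icc _ _ _
  have hvf : ∀ y, ⟪v, f y⟫ ≤ 1 := fun y => by
    have := (le_abs_self _).trans (hp.abs_inner_le v y)
    rwa [hv] at this
  have hmf : Measurable fun y => ⟪v, f y⟫ := measurable_const.inner hp.measurable
  have hgvi := hp.integrable_mul_inner hgi v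
  -- In terms of this measure the hypothesis reads α(B_s) ≤ ½ τ(B_s), a form that
  -- `lintegral_radial_le` carries over to the cutoff.
  set α := τ.withDensity fun y => ENNReal.ofReal (1 - ⟪v, f y⟫) with hα
  have h1 : ∫⁻ y, ENNReal.ofReal (g y) ∂α ≤ (1 / 2) * ∫⁻ y, ENNReal.ofReal (g y) ∂τ := by
    refine lintegral_radial_le x (by simp) hρ (antitoneOn_radialProfile hρ.le hh)
      (continuous_radialProfile ρ h) (fun r => (radialProfile_mem_Icc _ _ r).1)
      (by rw [radialProfile_of_le hρ.le hh hρ.le le_rfl,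
        radialProfile_of_le hρ.le hh le_rfl hρ.le])
      (fun r => radialProfile_of_ge hρ.le hh) fun s hs hsb => ?_
    have h2 := hr s hs (hsb.trans_le hρh)
    rw [hα, withDensity_apply _ measurableSet_closedBall, ← ofReal_integral_eq_lintegral_ofReal
      (f := fun y => 1 - ⟪v, f y⟫)
      (((integrable_const _).sub (hp.integrable_inner v)).integrableOn)
      (ae_of_all _ fun y => sub_nonneg.2 (hvf y)),
      integral_sub (integrable_const _) (hp.integrable_inner v).integrableOn]
    have h3 : (1 / 2 : ℝ≥0∞) * τ (closedBall x s) =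
        ENNReal.ofReal (1 / 2 * τ.real (closedBall x s)) := by
      rw [ENNReal.ofReal_mul (by norm_num), ofReal_measureReal]
      congr 1
      rw [ENNReal.ofReal_div_of_pos (by norm_num)]
      simp
    rw [h3]
    refine ENNReal.ofReal_le_ofReal ?_
    simp
    linarith
  have h2 : ∫ y, g y * (1 - ⟪v, f y⟫) ∂τ ≤ 1 / 2 * ∫ y, g y ∂τ := by
    have e1 : ∫⁻ y, ENNReal.ofReal (g y) ∂α = ENNReal.ofReal (∫ y, g y * (1 - ⟪v, f y⟫) ∂τ) := by
      rw [hα, lintegral_withDensity_eq_lintegral_mul _ (by fun_prop)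
        (hgc.continuous.measurable.ennreal_ofReal), ofReal_integral_eq_lintegral_ofReal]
      · refine lintegral_congr fun y => ?_
        rw [Pi.mul_apply, ENNReal.ofReal_mul (hgI y).1, mul_comm]
      · simp_rw [mul_sub, mul_one]
        exact hgi.sub hgvi
      · exact ae_of_all _ fun y => mul_nonneg (hgI y).1 (sub_nonneg.2 (hvf y))
    have e2 : (1 / 2) * ∫⁻ y, ENNReal.ofReal (g y) ∂τ = ENNReal.ofReal (1 / 2 * ∫ y, g y ∂τ) := by
      rw [ENNReal.ofReal_mul (by norm_num), ofReal_integral_eq_lintegral_ofReal hgi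
        (ae_of_all _ fun y => (hgI y).1)]
      congr 1
      rw [ENNReal.ofReal_div_of_pos (by norm_num)]
      simp
    rw [e1, e2] at h1
    exact (ENNReal.ofReal_le_ofReal_iff
      (mul_nonneg (by norm_num) (integral_nonneg fun y => (hgI y).1))).1 h1
  simp_rw [mul_sub, mul_one] at h2
  rw [integral_sub hgi hgvi] at h2
  have h3 : τ.real (closedBall x ρ) ≤ ∫ y, g y ∂τ := by
    rw [← integral_indicator_one measurableSet_closedBall]
    refine integral_mono ((integrable_const (1 : ℝ)).indicator measurableSet_closedBall) hgi
      fun y => ?_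
    by_cases hy : y ∈ closedBall x ρ
    · rw [indicator_of_mem hy]
      rw [mem_closedBall, dist_eq_norm] at hy
      exact (radialProfile_of_le hρ.le hh (norm_nonneg _) hy).ge
    · rw [indicator_of_notMem hy]
      exact (hgI y).1
  have h4 := hp.integral_eq g hgc hgs v
  have hms : MeasurableSet (ball x (ρ + h) \ ball x ρ) := measurableSet_ball.diff measurableSet_ball
  have h5 : |∫ y in L, fderiv ℝ g y v| ≤
      3 / h * (volume.real (L ∩ ball x (ρ + h)) - volume.real (L ∩ ball x ρ)) := by
    have e1 : ∫ y in L, (ball x (ρ + h) \ ball x ρ).indicator (fun _ => 3 / h) y =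
        3 / h * (volume.real (L ∩ ball x (ρ + h)) - volume.real (L ∩ ball x ρ)) := by
      rw [integral_indicator hms, setIntegral_const, smul_eq_mul, mul_comm,
        measureReal_sdiff (ball_subset_ball (by linarith)) measurableSet_ball
          ((Measure.restrict_le_self _).trans_lt measure_ball_lt_top).ne,
        measureReal_restrict_apply measurableSet_ball,
        measureReal_restrict_apply measurableSet_ball, inter_comm L, inter_comm L]
    rw [← e1, ← Real.norm_eq_abs]
    refine (norm_integral_le_integral_norm _).trans (integral_mono
      (integrable_fderiv_apply_const hgc hgs v).integrableOn.norm
      ?_ fun y => abs_fderiv_radialCutoff_le x hρ.le hh y hv)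
    refine (integrable_indicator_iff hms).2 (integrableOn_const ?_)
    refine ((Measure.restrict_le_self _).trans (measure_mono sdiff_subset)).trans_lt measure_ball_lt_top |>.ne
  have h6 : ∫ y, g y * ⟪v, f y⟫ ∂τ ≤ |∫ y in L, fderiv ℝ g y v| := by
    rw [h4, abs_neg]
    exact le_abs_self _
  have h7 : 6 / h * (volume.real (L ∩ ball x (ρ + h)) - volume.real (L ∩ ball x ρ)) =
    2 * (3 / h * (volume.real (L ∩ ball x (ρ + h)) - volume.real (L ∩ ball x ρ))) := by ring
  rw [h7]
  linarith

end

/-! ### Translations of sets of finite perimeter -/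

open scoped Manifold ContDiff in
lemma exists_contDiff_cutoff {K U : Set (Eucl n)} (hK : IsClosed K) (hU : IsOpen U) (hKU : K ⊆ U)
    (hb : Bornology.IsBounded U) :
    ∃ g : Eucl n → ℝ, ContDiff ℝ 1 g ∧ HasCompactSupport g ∧ (∀ y ∈ K, g y = 1) ∧
      (∀ y ∉ U, g y = 0) ∧ ∀ y, g y ∈ Icc (0 : ℝ) 1 := by
  obtain ⟨g, h0, h1, hI⟩ := exists_contMDiffMap_zero_one_of_isClosed (n := 1) 𝓘(ℝ, Eucl n)
    hU.isClosed_compl hK (disjoint_compl_left_iff_subset.2 hKU)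
  refine ⟨g, g.contMDiff.contDiff, ?_, fun y hy => h1 hy, fun y hy => h0 hy, hI⟩
  exact HasCompactSupport.intro hb.isCompact_closure fun y hy => h0 fun hyU => hy (subset_closure hyU)

section
variable {L : Set (Eucl n)} {τ : Measure (Eucl n)} {f : Eucl n → Eucl n}

lemma HasCompactSupport.comp_sub_const {g : Eucl n → ℝ} (hc : HasCompactSupport g) (c : Eucl n) :
    HasCompactSupport fun y => g (y - c) :=
  hc.comp_homeomorph (Homeomorph.subRight c)

/-- Differentiation under the integral produces -∂_w g, and Gauss–Green turns its integral over L
into one against τ. -/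
lemma IsGradPair.hasDerivAt_translate (hp : IsGradPair L τ f) {g : Eucl n → ℝ}
    (hg : ContDiff ℝ 1 g) (hc : HasCompactSupport g) (w : Eucl n) (t : ℝ) :
    HasDerivAt (fun t : ℝ => ∫ y in L, g (y - t • w)) (∫ y, g (y - t • w) * ⟪w, f y⟫ ∂τ) t := by
  have hgt : ContDiff ℝ 1 fun y => g (y - t • w) := hg.comp (contDiff_id.sub contDiff_const)
  have hct : HasCompactSupport fun y => g (y - t • w) := hc.comp_sub_const _
  have hfd : ∀ (t : ℝ) (y : Eucl n), HasDerivAt (fun t : ℝ => g (y - t • w))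
      (-fderiv ℝ g (y - t • w) w) t := by
    intro t y
    have h1 : HasDerivAt (fun t : ℝ => y - t • w) (-w) t := by
      simpa using ((hasDerivAt_id t).smul_const w).const_sub y
    have h2 := ((hg.differentiable (by simp) (y - t • w)).hasFDerivAt).comp_hasDerivAt t h1
    rw [map_neg] at h2
    exact h2
  have h4 := hp.integral_eq _ hgt hct w
  have h5 : ∀ y, fderiv ℝ (fun y => g (y - t • w)) y w = fderiv ℝ g (y - t • w) w := fun y => by
    rw [fderiv_comp_sub]
  simp_rw [h5] at h4
  have h6 : ∫ y, g (y - t • w) * ⟪w, f y⟫ ∂τ = ∫ y in L, -fderiv ℝ g (y - t • w) w := by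
    rw [integral_neg, h4, neg_neg]
  rw [h6]
  have hF := continuous_fderiv_apply_const hg w
  have hFc := hasCompactSupport_fderiv_apply_const hc w
  obtain ⟨C, hC⟩ := hF.bounded_above_of_compact_support hFc
  obtain ⟨R, hR⟩ := hFc.isCompact.isBounded.subset_closedBall (0 : Eucl n)
  have hind : ∀ y s, s ∈ ball t 1 → ‖-fderiv ℝ g (y - s • w) w‖ ≤
      (closedBall (0 : Eucl n) (R + (|t| + 1) * ‖w‖)).indicator (fun _ => C) y := by
    intro y s hs
    by_cases hy : y ∈ closedBall (0 : Eucl n) (R + (|t| + 1) * ‖w‖)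
    · rw [indicator_of_mem hy, norm_neg]
      exact hC _
    · rw [indicator_of_notMem hy, norm_neg]
      have : y - s • w ∉ tsupport fun x => fderiv ℝ g x w := by
        intro hm
        have h1 := hR hm
        rw [mem_closedBall_zero_iff] at h1 hy
        have hs1 : |s| ≤ |t| + 1 := by
          rw [mem_ball, Real.dist_eq] at hs
          have := abs_sub_abs_le_abs_sub s t
          linarith
        have h2 : ‖y‖ ≤ ‖y - s • w‖ + |s| * ‖w‖ := by
          calc ‖y‖ = ‖(y - s • w) + s • w‖ := by simp
            _ ≤ _ := (norm_add_le _ _).trans (by rw [norm_smul, Real.norm_eq_abs])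
        have h3 : |s| * ‖w‖ ≤ (|t| + 1) * ‖w‖ := by gcongr
        exact hy (by linarith)
      have h0 : fderiv ℝ g (y - s • w) w = 0 :=
        image_eq_zero_of_notMem_tsupport (f := fun x => fderiv ℝ g x w) this
      rw [h0]; simp
  refine (hasDerivAt_integral_of_dominated_loc_of_deriv_le (μ := volume.restrict L)
    (F := fun (t : ℝ) y => g (y - t • w)) (F' := fun t y => -fderiv ℝ g (y - t • w) w)
    (ball_mem_nhds t one_pos)
    (bound := (closedBall (0 : Eucl n) (R + (|t| + 1) * ‖w‖)).indicator (fun _ => C))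
    ?_ ?_ ?_ ?_ ?_ ?_).2
  · exact Eventually.of_forall fun s => (hg.continuous.comp
      (continuous_id.sub continuous_const)).aestronglyMeasurable
  · exact (hgt.continuous.integrable_of_hasCompactSupport hct).integrableOn
  · exact ((hF.comp (continuous_id.sub continuous_const)).neg).aestronglyMeasurable
  · exact ae_of_all _ fun y s hs => hind y s hs
  · refine Integrable.integrableOn ((integrable_indicator_iff measurableSet_closedBall).2
      (integrableOn_const measure_closedBall_lt_top.ne))
  · exact ae_of_all _ fun y s _ => hfd s y

/-- Localized form of the estimate ‖1_L(· + w) - 1_L‖₁ ≤ ‖w‖ |D1_L|. A bump g close to the indicator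
of a compact piece K of the set is translated along w: φ(t) = ∫_L g(y - t w) starts at |K| or more,
ends near 0 because K + w misses L, and has derivative at most M in absolute value. -/
lemma IsGradPair.volume_translate_le [IsFiniteMeasure τ] (hp : IsGradPair L τ f)
    (hL : MeasurableSet L) (x w : Eucl n) (s : ℝ) :
    volume {y | y ∈ L ∩ ball x s ∧ y + w ∉ L} ≤
      ENNReal.ofReal (‖w‖ * τ.real (closedBall x (s + ‖w‖))) := by
  set M := ‖w‖ * τ.real (closedBall x (s + ‖w‖)) with hM
  have hM0 : 0 ≤ M := by positivity
  have hNm : MeasurableSet {y | y ∈ L ∩ ball x s ∧ y + w ∉ L} :=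
    (hL.inter measurableSet_ball).inter ((measurable_add_const w) hL.compl)
  by_contra! hlt
  obtain ⟨K, hKN, hK, hKM⟩ := hNm.exists_lt_isCompact hlt
  have hKtop : volume K ≠ ∞ := hK.measure_lt_top.ne
  have hKM' : M < volume.real K := by
    rw [ENNReal.ofReal_lt_iff_lt_toReal hM0 hKtop] at hKM
    exact hKM
  -- The margin |K| - M is chosen so that φ 0 - φ 1 > |K| - (|K| - M) = M, contradicting the mean
  -- value inequality.
  obtain ⟨U, hKU, hUo, hU⟩ := K.exists_isOpen_lt_add hKtop
    (ε := ENNReal.ofReal (volume.real K - M)) (by simpa using hKM')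
  set V := U ∩ ball x s with hV
  have hVo : IsOpen V := hUo.inter isOpen_ball
  have hKV : K ⊆ V := subset_inter hKU fun y hy => (hKN hy).1.2
  have hVb : Bornology.IsBounded V := isBounded_ball.subset inter_subset_right
  have hVtop : volume V ≠ ∞ := hVb.measure_lt_top.ne
  obtain ⟨g, hg, hc, hg1, hg0, hgI⟩ := exists_contDiff_cutoff hK.isClosed hVo hKV hVb
  have hVK : volume.real (V \ K) < volume.real K - M := by
    rw [measureReal_sdiff hKV hK.measurableSet hVtop]
    have h1 : volume V < volume K + ENNReal.ofReal (volume.real K - M) :=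
      (measure_mono inter_subset_left).trans_lt hU
    have h2 := ENNReal.toReal_strict_mono (by finiteness) h1
    rw [ENNReal.toReal_add hKtop (by finiteness), ENNReal.toReal_ofReal (by linarith)] at h2
    have h3 : volume.real V < volume.real K + (volume.real K - M) := h2
    linarith
  have hgi := hg.continuous.integrable_of_hasCompactSupport (μ := volume) hc
  set φ : ℝ → ℝ := fun t => ∫ y in L, g (y - t • w) with hφ
  have hd : ∀ t ∈ Icc (0 : ℝ) 1, HasDerivWithinAt φ (∫ y, g (y - t • w) * ⟪w, f y⟫ ∂τ)
      (Icc (0 : ℝ) 1) t := fun t _ => (hp.hasDerivAt_translate hg hc w t).hasDerivWithinAt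
  have hbd : ∀ t ∈ Ico (0 : ℝ) 1, ‖∫ y, g (y - t • w) * ⟪w, f y⟫ ∂τ‖ ≤ M := by
    intro t ht
    have hle : ∀ y, ‖g (y - t • w) * ⟪w, f y⟫‖ ≤
        (closedBall x (s + ‖w‖)).indicator (fun _ => ‖w‖) y := by
      intro y
      by_cases hy : y ∈ closedBall x (s + ‖w‖)
      · rw [indicator_of_mem hy, norm_mul, Real.norm_eq_abs, Real.norm_eq_abs,
          abs_of_nonneg (hgI _).1]
        calc g (y - t • w) * |⟪w, f y⟫| ≤ 1 * ‖w‖ :=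
              mul_le_mul (hgI _).2 (hp.abs_inner_le w y) (abs_nonneg _) zero_le_one
          _ = ‖w‖ := one_mul _
      · rw [indicator_of_notMem hy, hg0]
        · simp
        · intro hyV
          apply hy
          have h1 : ‖y - t • w - x‖ < s := by simpa [dist_eq_norm] using hyV.2
          rw [mem_closedBall, dist_eq_norm]
          calc ‖y - x‖ = ‖(y - t • w - x) + t • w‖ := by congr 1; abel
            _ ≤ ‖y - t • w - x‖ + ‖t • w‖ := norm_add_le _ _
            _ ≤ s + 1 * ‖w‖ := by
                rw [norm_smul, Real.norm_eq_abs, abs_of_nonneg ht.1]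
                gcongr
                exact ht.2.le
            _ = s + ‖w‖ := by rw [one_mul]
    have hii : Integrable ((closedBall x (s + ‖w‖)).indicator (fun _ => ‖w‖)) τ :=
      (integrable_const _).indicator measurableSet_closedBall
    refine (norm_integral_le_of_norm_le hii (ae_of_all _ hle)).trans_eq ?_
    rw [integral_indicator measurableSet_closedBall, setIntegral_const, smul_eq_mul, mul_comm]
  have h01 := norm_image_sub_le_of_norm_deriv_le_segment_01' hd hbd
  have hφ0 : volume.real K ≤ φ 0 := by
    simp only [hφ, zero_smul, sub_zero]
    have hKL : K ⊆ L := fun y hy => (hKN hy).1.1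
    calc volume.real K = ∫ y in K, (1 : ℝ) := by simp
      _ = ∫ y in K, g y := (setIntegral_congr_fun hK.measurableSet fun y hy => hg1 y hy).symm
      _ ≤ ∫ y in L, g y := setIntegral_mono_set hgi.integrableOn
          (ae_of_all _ fun y => (hgI y).1) hKL.eventuallyLE
  have hφ1 : φ 1 ≤ volume.real (V \ K) := by
    simp only [hφ, one_smul]
    rw [← integral_indicator hL]
    have e1 : ∫ y, L.indicator (fun y => g (y - w)) y =
        ∫ z, L.indicator (fun y => g (y - w)) (z + w) := (integral_add_right_eq_self _ w).symm
    rw [e1]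
    have hm : MeasurableSet (V \ K) := hVo.measurableSet.diff hK.measurableSet
    have hVKtop : volume (V \ K) ≠ ∞ := ((measure_mono sdiff_subset).trans_lt hVtop.lt_top).ne
    rw [← integral_indicator_one hm]
    refine integral_mono_of_nonneg (ae_of_all _ fun z => ?_)
      ((integrable_indicator_iff hm).2 (integrableOn_const hVKtop)) (ae_of_all _ fun z => ?_)
    · exact indicator_nonneg (fun y _ => (hgI _).1) _
    · show L.indicator (fun y => g (y - w)) (z + w) ≤ (V \ K).indicator 1 z
      by_cases hz : z + w ∈ L
      · rw [indicator_of_mem hz, add_sub_cancel_right]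
        have hzK : z ∉ K := fun hzK => (hKN hzK).2 hz
        by_cases hzV : z ∈ V
        · rw [indicator_of_mem (show z ∈ V \ K from ⟨hzV, hzK⟩)]
          exact (hgI z).2
        · rw [hg0 z hzV]
          exact indicator_nonneg (fun _ _ => zero_le_one) _
      · rw [indicator_of_notMem hz]
        exact indicator_nonneg (fun _ _ => zero_le_one) _
  rw [Real.norm_eq_abs, abs_sub_comm] at h01
  have := le_abs_self (φ 0 - φ 1)
  linarith

/-- Tonelli for the pairs (y, w) with y ∈ L ∩ B_s(x), ‖w‖ ≤ R and y + w ∉ L: one order of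
integration gives the left side, the other is controlled by the translation estimate. It serves as a
relative isoperimetric inequality. -/
lemma IsGradPair.lintegral_volume_sdiff_le [IsFiniteMeasure τ] (hp : IsGradPair L τ f)
    (hL : MeasurableSet L) (x : Eucl n) (s : ℝ) {R : ℝ} (hR : 0 ≤ R) :
    ∫⁻ y in L ∩ ball x s, volume (closedBall y R \ L) ≤
      ENNReal.ofReal (R * τ.real (closedBall x (s + R))) * volume (closedBall (0 : Eucl n) R) := by
  set A : Set (Eucl n × Eucl n) := {p | (p.1 ∈ L ∩ ball x s ∧ p.1 + p.2 ∉ L) ∧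
    p.2 ∈ closedBall (0 : Eucl n) R} with hA
  have hAm : MeasurableSet A := by
    refine ((measurable_fst (hL.inter measurableSet_ball)).inter ?_).inter
      (measurable_snd measurableSet_closedBall)
    exact (measurable_fst.add measurable_snd) hL.compl
  have h1 : ∫⁻ y in L ∩ ball x s, volume (closedBall y R \ L) = (volume.prod volume) A := by
    rw [Measure.prod_apply hAm, ← lintegral_indicator (hL.inter measurableSet_ball)]
    refine lintegral_congr fun y => ?_
    by_cases hy : y ∈ L ∩ ball x s
    · rw [indicator_of_mem hy, ← measure_preimage_add volume y]
      congr 1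
      ext z
      have hy2 : ‖y - x‖ < s := by simpa [dist_eq_norm] using hy.2
      simp [hA, hy.1, hy2, dist_eq_norm, and_comm]
    · rw [indicator_of_notMem hy]
      have : Prod.mk y ⁻¹' A = ∅ := by
        ext z
        simp only [hA, mem_preimage, mem_ofPred_eq, mem_empty_iff_false, iff_false]
        exact fun h => hy h.1.1
      rw [this, measure_empty]
  rw [h1, Measure.prod_apply_symm hAm, ← setLIntegral_const]
  rw [← lintegral_indicator measurableSet_closedBall]
  refine lintegral_mono fun w => ?_
  by_cases hw : w ∈ closedBall (0 : Eucl n) R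
  · rw [indicator_of_mem hw]
    have h2 : (fun y => (y, w)) ⁻¹' A = {y | y ∈ L ∩ ball x s ∧ y + w ∉ L} := by
      ext y
      simp only [hA, mem_preimage, mem_ofPred_eq, hw, and_true]
    rw [h2]
    rw [mem_closedBall_zero_iff] at hw
    refine (hp.volume_translate_le hL x w s).trans (ENNReal.ofReal_le_ofReal ?_)
    have := measureReal_mono (μ := τ)
      (closedBall_subset_closedBall (x := x) (by linarith : s + ‖w‖ ≤ s + R))
    gcongr
  · rw [indicator_of_notMem hw]
    have : (fun y => (y, w)) ⁻¹' A = ∅ := by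
      ext z
      simp only [hA, mem_preimage, mem_ofPred_eq, mem_empty_iff_false, iff_false]
      exact fun h => hw h.2
    rw [this, measure_empty]

end

/-! ### Density estimates at boundary points -/

/-- The constant in the volume density estimate. -/
def growthConst (n : ℕ) : ℝ := 2 + 2 / ((13 / 12 : ℝ) ^ ((n : ℝ)⁻¹) - 1)

lemma one_lt_growth_ratio (hn : n ≠ 0) : (1 : ℝ) < (13 / 12 : ℝ) ^ ((n : ℝ)⁻¹) :=
  Real.one_lt_rpow (by norm_num) (by positivity)

lemma growthConst_pos (hn : n ≠ 0) : 0 < growthConst n := by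
  have := one_lt_growth_ratio hn
  have : 0 < (13 / 12 : ℝ) ^ ((n : ℝ)⁻¹) - 1 := by linarith
  unfold growthConst
  positivity

/-- Let ρ(s) solve κ ρ(s)^n = 4 m(s). A step from s to s + 2ρ(s) multiplies ρ by at least λ =
(13/12)^(1/n). Since B = 2/(λ - 1) satisfies Bλ = B + 2, the condition s - r ≤ B ρ(s) survives the
step, so it persists until a step overshoots 2r; then r < (B + 2) ρ(s). -/
lemma growth_of_step (hn : n ≠ 0) {m : ℝ → ℝ} (hm : Monotone m) {κ r : ℝ} (hκ : 0 < κ) (hr : 0 < r)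
    (hmr : 0 < m r)
    (hstep : ∀ s R, r ≤ s → 0 < R → κ * R ^ n = 4 * m s → s + 2 * R ≤ 2 * r →
      13 / 12 * m s ≤ m (s + 2 * R)) :
    κ * (r / growthConst n) ^ n ≤ 4 * m (2 * r) := by
  set lam : ℝ := (13 / 12 : ℝ) ^ ((n : ℝ)⁻¹) with hlam
  have hlam1 : 1 < lam := one_lt_growth_ratio hn
  set B : ℝ := 2 / (lam - 1) with hB
  have hB0 : 0 < B := div_pos two_pos (by linarith)
  have hBlam : B * lam = B + 2 := by
    have : lam - 1 ≠ 0 := by linarith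
    rw [hB]; field_simp; ring
  have hG : growthConst n = B + 2 := by rw [growthConst, ← hlam, ← hB]; ring
  set ρ : ℝ → ℝ := fun s => (4 * m s / κ) ^ ((n : ℝ)⁻¹) with hρ
  have hmpos : ∀ s, r ≤ s → 0 < m s := fun s hs => hmr.trans_le (hm hs)
  have hρpos : ∀ s, r ≤ s → 0 < ρ s := fun s hs => by
    have := hmpos s hs
    simp only [hρ]
    positivity
  have hρn : ∀ s, r ≤ s → κ * ρ s ^ n = 4 * m s := fun s hs => by
    have := hmpos s hs
    simp only [hρ]
    rw [Real.rpow_inv_natCast_pow (by positivity) hn]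
    field_simp
  have hρmono : ∀ s t, r ≤ s → s ≤ t → ρ s ≤ ρ t := fun s t hs hst => by
    have h1 := hmpos s hs
    have h2 := hm hst
    simp only [hρ]
    gcongr
  set T : Set ℝ := {s | r ≤ s ∧ s ≤ 2 * r ∧ s - r ≤ B * ρ s} with hT
  have hrT : r ∈ T := ⟨le_rfl, by linarith, by simpa using (mul_pos hB0 (hρpos r le_rfl)).le⟩
  have hTb : BddAbove T := ⟨2 * r, fun s hs => hs.2.1⟩
  have hρr := hρpos r le_rfl
  -- A point this close to the supremum cannot take another admissible step, whose length is at
  -- least 2ρ(r).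
  obtain ⟨s, hsT, hs⟩ := exists_lt_of_lt_csSup ⟨r, hrT⟩ (show sSup T - ρ r < sSup T by linarith)
  have hρs := hρpos s hsT.1
  have hnot : 2 * r < s + 2 * ρ s := by
    by_contra! hle
    have h1 := hstep s (ρ s) hsT.1 hρs (hρn s hsT.1) hle
    have h2 : lam * ρ s ≤ ρ (s + 2 * ρ s) := by
      have := hmpos s hsT.1
      simp only [hρ, hlam]
      rw [← Real.mul_rpow (by norm_num) (by positivity)]
      refine Real.rpow_le_rpow (by positivity) ?_ (by positivity)
      change _ ≤ 4 * m (s + 2 * ρ s) / κ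
      calc 13 / 12 * (4 * m s / κ) = 4 * (13 / 12 * m s) / κ := by ring
        _ ≤ _ := by gcongr
    have h3 : s + 2 * ρ s ∈ T := by
      refine ⟨by linarith [hsT.1], hle, ?_⟩
      have h4 : B * (lam * ρ s) ≤ B * ρ (s + 2 * ρ s) := by gcongr
      have h5 : B * (lam * ρ s) = B * ρ s + 2 * ρ s := by rw [← mul_assoc, hBlam]; ring
      linarith [hsT.2.2]
    have h4 := le_csSup hTb h3
    have h5 := hρmono r s le_rfl hsT.1
    linarith
  have hfin : r / growthConst n ≤ ρ (2 * r) := by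
    rw [hG, div_le_iff₀ (by linarith)]
    have := hρmono s (2 * r) hsT.1 hsT.2.1
    have h6 := hsT.2.2
    nlinarith
  rw [← hρn (2 * r) (by linarith)]
  have := growthConst_pos hn
  gcongr

section
variable {L : Set (Eucl n)} {τ : Measure (Eucl n)} {f : Eucl n → Eucl n}

lemma IsGradPair.congr (hp : IsGradPair L τ f) {L' : Set (Eucl n)} (h : L =ᵐ[volume] L') :
    IsGradPair L' τ f where
  nullMeasurableSet := hp.nullMeasurableSet.congr h
  measurable := hp.measurable
  norm_eq := hp.norm_eq
  integral_eq g hg hc v := by rw [← hp.integral_eq g hg hc v, setIntegral_congr_set h]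

lemma monotone_volume_inter_ball (L : Set (Eucl n)) (x : Eucl n) :
    Monotone fun s => volume.real (L ∩ ball x s) := fun _ _ hst =>
  measureReal_mono (inter_subset_inter_right _ (ball_subset_ball hst))
    (volume_inter_ball_ne_top L x _)

lemma volume_real_closedBall (hn : 3 ≤ n) (y : Eucl n) {R : ℝ} (hR : 0 ≤ R) :
    volume.real (closedBall y R) = omega n * R ^ n := by
  rw [Measure.real, Measure.addHaar_closedBall_center, volume_closedBall_eq hn hR,
    ENNReal.toReal_ofReal (mul_nonneg (omega_pos n).le (pow_nonneg hR n))]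

lemma IsGradPair.mul_volume_le [IsFiniteMeasure τ] (hn : 3 ≤ n) (hp : IsGradPair L τ f)
    (hL : MeasurableSet L) (x : Eucl n) (s : ℝ) {R a : ℝ} (hR : 0 ≤ R)
    (ha : ∀ y ∈ ball x s, a ≤ volume.real (closedBall y R \ L)) :
    a * volume.real (L ∩ ball x s) ≤ R * τ.real (closedBall x (s + R)) * (omega n * R ^ n) := by
  have h1 := hp.lintegral_volume_sdiff_le hL x s hR
  have h2 : ENNReal.ofReal a * volume (L ∩ ball x s) ≤
      ∫⁻ y in L ∩ ball x s, volume (closedBall y R \ L) := by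
    rw [← setLIntegral_const]
    refine setLIntegral_mono' (hL.inter measurableSet_ball) fun y hy => ?_
    exact ENNReal.ofReal_le_of_le_toReal (ha y hy.2)
  have h3 := h2.trans h1
  rw [volume_closedBall_eq hn hR, ← ENNReal.ofReal_mul (by positivity),
    ← ofReal_measureReal (volume_inter_ball_ne_top L x s)] at h3
  have h0 : 0 ≤ omega n * R ^ n := mul_nonneg (omega_pos n).le (pow_nonneg hR n)
  rcases le_or_gt 0 a with h | h
  · rw [← ENNReal.ofReal_mul h] at h3
    exact (ENNReal.ofReal_le_ofReal_iff (by positivity)).1 h3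
  · exact (mul_nonpos_of_nonpos_of_nonneg h.le measureReal_nonneg).trans (by positivity)

/-- At `x` at least half of the mass of `f τ` on small balls points in the direction `v`. -/
def IsHalfDense (τ : Measure (Eucl n)) (f : Eucl n → Eucl n) (x v : Eucl n) (r₀ : ℝ) : Prop :=
  ‖v‖ = 1 ∧ ∀ s, 0 < s → s < r₀ → 0 < τ.real (closedBall x s) ∧
    τ.real (closedBall x s) ≤ 2 * ∫ y in closedBall x s, ⟪v, f y⟫ ∂τ

lemma IsHalfDense.compl {x v : Eucl n} {r₀ : ℝ} (h : IsHalfDense τ f x v r₀) :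
    IsHalfDense τ (fun y => - f y) x (-v) r₀ := by
  simpa [IsHalfDense] using h

/-- The volume m(s) of L ∩ B_s(x) obeys the step hypothesis of `growth_of_step`. It is positive for
s = r because the mass inside is positive and bounded by a volume difference. -/
lemma IsGradPair.volume_growth [IsFiniteMeasure τ] (hn : 3 ≤ n) (hp : IsGradPair L τ f)
    (hL : MeasurableSet L) {x v : Eucl n} {r₀ : ℝ} (hd : IsHalfDense τ f x v r₀) {r : ℝ}
    (hr : 0 < r) (hr₀ : 2 * r ≤ r₀) :
    omega n * (r / growthConst n) ^ n ≤ 4 * volume.real (L ∩ ball x (2 * r)) := by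
  have hmass := fun {ρ h : ℝ} (hρ : 0 < ρ) (hh : 0 < h) (hρh : ρ + h ≤ r₀) =>
    hp.mass_le hd.1 (fun s hs hsr => (hd.2 s hs hsr).2) hρ hh hρh
  refine growth_of_step (by omega) (monotone_volume_inter_ball L x) (omega_pos n) hr ?_ ?_
  · have h1 := hmass (ρ := r / 2) (h := r / 2) (by positivity) (by positivity) (by linarith)
    have h2 := (hd.2 (r / 2) (by positivity) (by linarith)).1
    rw [add_halves] at h1
    have h3 : (0 : ℝ) ≤ volume.real (L ∩ ball x (r / 2)) := measureReal_nonneg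
    have h4 := h2.trans_le h1
    have h5 := (pos_iff_pos_of_mul_pos h4).1 (by positivity)
    show 0 < volume.real (L ∩ ball x r)
    linarith
  · intro s R hs hR hκ hsR
    have hs0 : 0 < s := hr.trans_le hs
    have hmono := monotone_volume_inter_ball L x
    have hm1 := hmono (show s + R ≤ s + 2 * R by linarith)
    have hm0 : (0 : ℝ) ≤ volume.real (L ∩ ball x s) := measureReal_nonneg
    simp only at hm1 hκ ⊢
    set m := volume.real (L ∩ ball x s)
    set m1 := volume.real (L ∩ ball x (s + R))
    -- If m1 < 2m, every B_R(y) with y ∈ B_s has volume 4m and misses L in volume at least 2m. Hence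
    -- 2m² ≤ 4m R τ(B_{s+R}), while R τ(B_{s+R}) ≤ 6(m(s + 2R) - m1); so m(s + 2R) - m1 ≥ m/12, the
    -- source of 13/12.
    rcases le_or_gt (2 * m) m1 with h | h
    · linarith
    · have h1 : 2 * m * m ≤ R * τ.real (closedBall x (s + R)) * (omega n * R ^ n) := by
        refine hp.mul_volume_le hn hL x s hR.le fun y hy => ?_
        have e1 := measureReal_sdiff_add_inter (μ := volume) (s := closedBall y R) hL
          measure_closedBall_lt_top.ne
        rw [volume_real_closedBall hn y hR.le, hκ] at e1
        have e2 : volume.real (closedBall y R ∩ L) ≤ m1 := by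
          refine measureReal_mono ?_ (volume_inter_ball_ne_top L x _)
          rw [inter_comm]
          refine inter_subset_inter_right _ fun z hz => ?_
          rw [mem_ball] at hy ⊢
          rw [mem_closedBall] at hz
          linarith [dist_triangle z y x]
        linarith
      have h2 := hmass (ρ := s + R) (h := R) (by positivity) hR (by linarith)
      rw [show s + R + R = s + 2 * R by ring] at h2
      have h3 : R * τ.real (closedBall x (s + R)) ≤
          6 * (volume.real (L ∩ ball x (s + 2 * R)) - m1) := by
        calc R * τ.real (closedBall x (s + R)) ≤
            R * (6 / R * (volume.real (L ∩ ball x (s + 2 * R)) - m1)) := by gcongr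
          _ = _ := by field_simp
      have hm1' : m ≤ m1 := hmono (show s ≤ s + R by linarith)
      have hmpos : 0 < m := by
        have : 0 < omega n * R ^ n := mul_pos (omega_pos n) (by positivity)
        linarith
      rw [hκ] at h1
      have h4 : 2 * m ≤ 4 * (R * τ.real (closedBall x (s + R))) := by
        refine le_of_mul_le_mul_right ?_ hmpos
        linarith
      linarith

/-- The constant in the lower density estimate for the perimeter measure. -/
def densityConst (n : ℕ) : ℝ := omega n / (64 * 2 ^ n * (2 * growthConst n) ^ (2 * n))

lemma densityConst_pos (hn : n ≠ 0) : 0 < densityConst n := by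
  have := growthConst_pos hn
  have := omega_pos n
  unfold densityConst
  positivity

/-- Both L and its complement occupy a definite fraction of B_r(x), and the product of these
volumes, of order r^(2n), is at most a constant times τ(B_{3r}) r^(n+1). -/
lemma IsGradPair.density_le [IsFiniteMeasure τ] (hn : 3 ≤ n) (hp : IsGradPair L τ f)
    {x v : Eucl n} {r₀ : ℝ} (hd : IsHalfDense τ f x v r₀) {r : ℝ}
    (hr : 0 < r) (hr₀ : r ≤ r₀) :
    densityConst n * r ^ (n - 1) ≤ τ.real (closedBall x (3 * r)) := by
  wlog hL : MeasurableSet L generalizing L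
  · obtain ⟨L', hL', hLL'⟩ := hp.nullMeasurableSet
    exact this (hp.congr hLL') hL'
  have h1 := hp.volume_growth hn hL hd (r := r / 2) (by positivity) (by linarith)
  have h2 := hp.compl.volume_growth hn hL.compl hd.compl (r := r / 2) (by positivity) (by linarith)
  rw [mul_div_cancel₀ _ two_ne_zero, div_div] at h1 h2
  -- For y ∈ B_r(x) the ball of radius 2r about y contains B_r(x).
  have h3 := hp.mul_volume_le hn hL x r (R := 2 * r) (a := volume.real (Lᶜ ∩ ball x r))
    (by positivity) fun y hy => by
      refine measureReal_mono (fun z hz => ⟨?_, hz.1⟩)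
        ((measure_mono sdiff_subset).trans_lt measure_closedBall_lt_top).ne
      have hz2 := hz.2
      rw [mem_ball] at hy hz2
      rw [mem_closedBall]
      linarith [dist_triangle_right z y x]
  rw [show r + 2 * r = 3 * r by ring] at h3
  have hG := growthConst_pos (n := n) (by omega)
  have hω := omega_pos n
  set a := r / (2 * growthConst n) with ha
  have ha0 : 0 < a := by positivity
  set T := τ.real (closedBall x (3 * r))
  have h4 : (omega n * a ^ n) * (omega n * a ^ n) ≤
      16 * (2 * r * T * (omega n * (2 * r) ^ n)) := by
    have := mul_le_mul h2 h1 (by positivity) (by positivity)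
    linarith
  have h5 : densityConst n * r ^ (n - 1) * (32 * r * omega n * (2 * r) ^ n) ≤
      T * (32 * r * omega n * (2 * r) ^ n) := by
    have e1 : r ^ (n - 1) * r = r ^ n := pow_sub_one_mul (by omega) r
    have e2 : densityConst n * r ^ (n - 1) * (32 * r * omega n * (2 * r) ^ n) =
        (omega n * a ^ n) * (omega n * a ^ n) / 2 := by
      have : densityConst n * r ^ (n - 1) * (32 * r * omega n * (2 * r) ^ n) =
        densityConst n * (r ^ (n - 1) * r) * (32 * omega n * (2 * r) ^ n) := by ring
      rw [this, e1, densityConst, ha]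
      simp only [mul_pow, div_pow, pow_mul']
      field_simp
      try norm_num
    have e3 : 0 ≤ (omega n * a ^ n) * (omega n * a ^ n) := by positivity
    rw [e2]
    linarith
  exact le_of_mul_le_mul_right h5 (by positivity)

lemma IsGradPair.upper_density_le [IsFiniteMeasure τ] (hn : 3 ≤ n) (hp : IsGradPair L τ f)
    {x v : Eucl n} {r₀ : ℝ} (hd : IsHalfDense τ f x v r₀) {r : ℝ}
    (hr : 0 < r) (hr₀ : 2 * r ≤ r₀) :
    τ.real (closedBall x r) ≤ 6 * omega n * 2 ^ n * r ^ (n - 1) := by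
  have h1 := hp.mass_le hd.1 (fun s hs hsr => (hd.2 s hs hsr).2) hr hr (by linarith)
  have h2 : volume.real (L ∩ ball x (r + r)) ≤ omega n * (r + r) ^ n := by
    rw [← volume_real_closedBall hn x (by positivity)]
    exact measureReal_mono (inter_subset_right.trans ball_subset_closedBall)
      measure_closedBall_lt_top.ne
  have h3 : (0 : ℝ) ≤ volume.real (L ∩ ball x r) := measureReal_nonneg
  calc τ.real (closedBall x r) ≤ 6 / r * (omega n * (r + r) ^ n) :=
        h1.trans (by gcongr; linarith)
    _ = 6 * omega n * 2 ^ n * r ^ (n - 1) := by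
        have e1 : r ^ n = r ^ (n - 1) * r := (pow_sub_one_mul (by omega) r).symm
        rw [← two_mul, mul_pow, e1]
        field_simp

end

/-! ### Hausdorff measure and densities -/

/-- Vitali covering at every scale 1/(k+1): the disjoint balls of radius ρ have total mass at most
τ(univ), and their fivefold enlargements cover A with diameters at most 10ρ. -/
lemma hausdorffMeasure_le_of_lower_density {τ : Measure (Eucl n)} [IsFiniteMeasure τ] {d : ℕ}
    {c : ℝ} (hc : 0 < c) {A : Set (Eucl n)}
    (hA : ∀ x ∈ A, ∃ r₀ > 0, ∀ r, 0 < r → r < r₀ → c * r ^ d ≤ τ.real (closedBall x r)) :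
    μH[d] A ≤ ENNReal.ofReal (10 ^ d / c) * τ univ := by
  choose! r₀ hr₀ hr using hA
  have hex : ∀ k : ℕ, ∃ u : Set (Eucl n), u.Countable ∧ ∃ ρ : Eucl n → ℝ,
      (∀ x ∈ u, 0 < ρ x ∧ ρ x ≤ 1 / ((k : ℝ) + 1) ∧ c * ρ x ^ d ≤ τ.real (closedBall x (ρ x))) ∧
      u.PairwiseDisjoint (fun x => closedBall x (ρ x)) ∧
      A ⊆ ⋃ x : u, closedBall (x : Eucl n) (5 * ρ x) := by
    intro k
    have hk : (0 : ℝ) < 1 / ((k : ℝ) + 1) := by positivity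
    set ρ : Eucl n → ℝ := fun x => min (1 / ((k : ℝ) + 1)) (r₀ x / 2) with hρ
    have hρpos : ∀ x ∈ A, 0 < ρ x := fun x hx => lt_min hk (half_pos (hr₀ x hx))
    obtain ⟨u, huA, hud, hu⟩ := Vitali.exists_disjoint_subfamily_covering_enlargement_closedBall A
      (fun x => x) ρ (1 / ((k : ℝ) + 1)) (fun x _ => min_le_left _ _) 5 (by norm_num)
    refine ⟨u, ?_, ρ, fun x hx => ⟨hρpos x (huA hx), min_le_left _ _, ?_⟩, hud, fun x hx => ?_⟩
    · refine hud.countable_of_nonempty_interior fun x hx => ?_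
      exact ⟨x, ball_subset_interior_closedBall (mem_ball_self (hρpos x (huA hx)))⟩
    · exact hr x (huA hx) _ (hρpos x (huA hx))
        ((min_le_right _ _).trans_lt (half_lt_self (hr₀ x (huA hx))))
    · obtain ⟨b, hb, hsub⟩ := hu x hx
      exact mem_iUnion.2 ⟨⟨b, hb⟩, hsub (mem_closedBall_self (hρpos x hx).le)⟩
  choose u huc ρ hρ hud hcov using hex
  have : ∀ k, Countable (u k) := fun k => (huc k).to_subtype
  have hdiam : ∀ k (x : u k), ediam (closedBall (x : Eucl n) (5 * ρ k x)) ≤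
      ENNReal.ofReal (10 * ρ k x) := by
    intro k x
    refine ediam_le fun y hy z hz => ?_
    rw [edist_dist]
    refine ENNReal.ofReal_le_ofReal ?_
    rw [mem_closedBall] at hy hz
    linarith [dist_triangle_right y z (x : Eucl n)]
  refine (Measure.hausdorffMeasure_le_liminf_tsum (l := atTop) (d : ℝ) A
    (fun k : ℕ => ENNReal.ofReal (10 * (1 / ((k : ℝ) + 1)))) ?_
    (fun k (x : u k) => closedBall (x : Eucl n) (5 * ρ k x)) ?_ ?_).trans ?_
  · have h1 : Tendsto (fun k : ℕ => 10 * (1 / ((k : ℝ) + 1))) atTop (𝓝 (10 * 0)) :=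
      tendsto_one_div_add_atTop_nhds_zero_nat.const_mul 10
    have := ENNReal.tendsto_ofReal h1
    simpa using this
  · refine Eventually.of_forall fun k x => (hdiam k x).trans (ENNReal.ofReal_le_ofReal ?_)
    gcongr
    exact (hρ k x x.2).2.1
  · exact Eventually.of_forall hcov
  · refine liminf_le_of_le (by isBoundedDefault) fun b hb => ?_
    obtain ⟨k, hk⟩ := hb.exists
    refine hk.trans ?_
    calc (∑' x : u k, ediam (closedBall (x : Eucl n) (5 * ρ k x)) ^ (d : ℝ))
        ≤ ∑' x : u k, ENNReal.ofReal (10 ^ d / c) * τ (closedBall (x : Eucl n) (ρ k x)) := by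
          refine ENNReal.tsum_le_tsum fun x => ?_
          obtain ⟨h1, _, h3⟩ := hρ k x x.2
          rw [ENNReal.rpow_natCast]
          calc ediam (closedBall (x : Eucl n) (5 * ρ k x)) ^ d
              ≤ ENNReal.ofReal (10 * ρ k x) ^ d := by gcongr; exact hdiam k x
            _ = ENNReal.ofReal (10 ^ d / c * (c * ρ k x ^ d)) := by
                rw [← ENNReal.ofReal_pow (by positivity)]
                congr 1
                rw [mul_pow]
                field_simp
            _ ≤ ENNReal.ofReal (10 ^ d / c * τ.real (closedBall (x : Eucl n) (ρ k x))) :=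
                ENNReal.ofReal_le_ofReal (by gcongr)
            _ = _ := by rw [ENNReal.ofReal_mul (by positivity), ofReal_measureReal]
      _ = ENNReal.ofReal (10 ^ d / c) * τ (⋃ x ∈ u k, closedBall x (ρ k x)) := by
          rw [ENNReal.tsum_mul_left, measure_biUnion (huc k) (hud k)
            fun x _ => measurableSet_closedBall]
      _ ≤ _ := by gcongr; exact subset_univ _

/-- On the part `A k` of N where the bound holds below scale 1/(k+1), any set of small diameter δ
meeting `A k` lies in balls centred there, so C⁻¹ τ restricted to `A k` is dominated by Hausdorff
measure. -/
lemma measure_eq_zero_of_upper_density {τ : Measure (Eucl n)} [IsFiniteMeasure τ] {d : ℕ}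
    {C : ℝ} (hC : 0 < C) {N : Set (Eucl n)} (hN : μH[d] N = 0)
    (hA : ∀ x ∈ N, ∃ r₀ > 0, ∀ r, 0 < r → r < r₀ → τ.real (closedBall x r) ≤ C * r ^ d) :
    τ N = 0 := by
  set A : ℕ → Set (Eucl n) := fun k => {x | x ∈ N ∧ ∀ r, 0 < r → r < 1 / ((k : ℝ) + 1) →
    τ.real (closedBall x r) ≤ C * r ^ d} with hAdef
  have hNA : N ⊆ ⋃ k, A k := by
    intro x hx
    obtain ⟨r₀, h0, hr⟩ := hA x hx
    obtain ⟨k, hk⟩ := exists_nat_one_div_lt h0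
    exact mem_iUnion.2 ⟨k, hx, fun r hr0 hrk => hr r hr0 (hrk.trans hk)⟩
  refine measure_mono_null hNA (measure_iUnion_null fun k => ?_)
  have hk : (0 : ℝ) < 1 / ((k : ℝ) + 1) := by positivity
  set c : ℝ≥0∞ := ENNReal.ofReal C⁻¹ with hc
  have hle : c • τ.restrict (A k) ≤ μH[d] := by
    refine Measure.le_hausdorffMeasure _ _ (ENNReal.ofReal (1 / ((k : ℝ) + 1) / 2))
      (by simpa using hk) fun s hs => ?_
    rw [ENNReal.rpow_natCast, Measure.smul_apply, smul_eq_mul]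
    have hs_fin : ediam s ≠ ∞ := (hs.trans_lt ENNReal.ofReal_lt_top).ne
    set δ := (ediam s).toReal with hδ
    have hδk : δ < 1 / ((k : ℝ) + 1) := by
      have := ENNReal.toReal_mono (by finiteness) hs
      rw [ENNReal.toReal_ofReal (by positivity)] at this
      linarith
    -- Passing to the closure gives a measurable set of the same diameter.
    have hcl : τ.restrict (A k) s ≤ τ (closure s ∩ A k) := by
      rw [← Measure.restrict_apply isClosed_closure.measurableSet]
      exact measure_mono subset_closure
    -- The density bound needs a positive radius and δ may be 0, so r is taken above δ and then
    -- lowered to it.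
    have key : ∀ r, δ < r → r < 1 / ((k : ℝ) + 1) → τ (closure s ∩ A k) ≤ ENNReal.ofReal (C * r ^ d) := by
      intro r hδr hrk
      have hr0 : 0 < r := ENNReal.toReal_nonneg.trans_lt hδr
      rcases (closure s ∩ A k).eq_empty_or_nonempty with h | ⟨x, hxs, hxA⟩
      · simp [h]
      · have hsub : closure s ∩ A k ⊆ closedBall x r := by
          rintro y ⟨hy, _⟩
          rw [mem_closedBall, dist_edist]
          refine le_trans (ENNReal.toReal_mono hs_fin ?_) hδr.le
          rw [← ediam_closure]
          exact edist_le_ediam_of_mem hy hxs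
        calc τ (closure s ∩ A k) ≤ τ (closedBall x r) := measure_mono hsub
          _ = ENNReal.ofReal (τ.real (closedBall x r)) := (ofReal_measureReal).symm
          _ ≤ _ := ENNReal.ofReal_le_ofReal (hxA.2 r hr0 hrk)
    have hlim : τ (closure s ∩ A k) ≤ ENNReal.ofReal (C * δ ^ d) := by
      have ht : Tendsto (fun r : ℝ => ENNReal.ofReal (C * r ^ d)) (𝓝[>] δ)
          (𝓝 (ENNReal.ofReal (C * δ ^ d))) := by
        refine (ENNReal.continuous_ofReal.comp ?_).continuousAt.tendsto.mono_left nhdsWithin_le_nhds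
        fun_prop
      refine ge_of_tendsto ht ?_
      filter_upwards [Ioo_mem_nhdsGT hδk] with r hr using key r hr.1 hr.2
    calc c * τ.restrict (A k) s ≤ c * ENNReal.ofReal (C * δ ^ d) := by
          gcongr
          exact hcl.trans hlim
      _ = ENNReal.ofReal (δ ^ d) := by
          rw [hc, ← ENNReal.ofReal_mul (by positivity)]
          congr 1
          field_simp
      _ = ediam s ^ d := by
          rw [ENNReal.ofReal_pow ENNReal.toReal_nonneg, ENNReal.ofReal_toReal hs_fin]
  have h1 : (c • τ.restrict (A k)) (A k) ≤ 0 :=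
    (hle _).trans ((measure_mono fun x hx => hx.1).trans hN.le)
  rw [Measure.smul_apply, Measure.restrict_apply_self, smul_eq_mul, nonpos_iff_eq_zero,
    mul_eq_zero] at h1
  refine h1.resolve_left ?_
  rw [hc, ENNReal.ofReal_eq_zero, not_le]
  positivity

/-! ### Averages over small balls -/

/-- The average of `f` over the closed ball, read as `0` if the ball is a null set. -/
def ballAverage (τ : Measure (Eucl n)) (f : Eucl n → Eucl n) (x : Eucl n) (r : ℝ) : Eucl n :=
  (τ.real (closedBall x r))⁻¹ • ∫ y in closedBall x r, f y ∂τ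

lemma neBot_comap_rat (r : ℝ) : (comap ((↑) : ℚ → ℝ) (𝓝[>] r)).NeBot := by
  refine comap_neBot fun s hs => ?_
  obtain ⟨u, hu, hsub⟩ := mem_nhdsGT_iff_exists_Ioo_subset.1 hs
  obtain ⟨q, hq1, hq2⟩ := exists_rat_btwn (show r < u from hu)
  exact ⟨q, hsub ⟨hq1, hq2⟩⟩

/-- By right continuity each value is a limit of values at rational radii. The limit set of ball
averages thus involves countably many measurable functions. -/
lemma tendsto_iff_tendsto_rat {E : Type*} [PseudoMetricSpace E] {F : ℝ → E}
    (hF : ∀ r, 0 < r → ContinuousWithinAt F (Ioi r) r) {v : E} :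
    Tendsto F (𝓝[>] 0) (𝓝 v) ↔
      Tendsto (fun q : ℚ => F q) (comap ((↑) : ℚ → ℝ) (𝓝[>] 0)) (𝓝 v) := by
  refine ⟨fun h => h.comp tendsto_comap, fun h => ?_⟩
  rw [Metric.nhds_basis_closedBall.tendsto_right_iff] at h ⊢
  intro ε hε
  obtain ⟨δ, hδ, hsub⟩ := (((nhdsGT_basis (0 : ℝ)).comap ((↑) : ℚ → ℝ)).eventually_iff).1 (h ε hε)
  filter_upwards [Ioo_mem_nhdsGT hδ] with r hr
  have := neBot_comap_rat r
  refine isClosed_closedBall.mem_of_tendsto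
    ((hF r hr.1).tendsto.comp (tendsto_comap (f := ((↑) : ℚ → ℝ)))) ?_
  filter_upwards [preimage_mem_comap (Ioo_mem_nhdsGT hr.2)] with q hq
  exact hsub ⟨hr.1.trans hq.1, hq.2⟩

section
variable {τ : Measure (Eucl n)} [IsFiniteMeasure τ] {E : Type*} [NormedAddCommGroup E]
  [NormedSpace ℝ E]

omit [IsFiniteMeasure τ] in
lemma continuousWithinAt_setIntegral_closedBall {f : Eucl n → E} (hf : Integrable f τ)
    (x : Eucl n) (r : ℝ) :
    ContinuousWithinAt (fun s => ∫ y in closedBall x s, f y ∂τ) (Ioi r) r := by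
  simp_rw [← integral_indicator (measurableSet_closedBall (α := Eucl n))]
  refine tendsto_integral_filter_of_dominated_convergence (fun y => ‖f y‖) ?_ ?_ hf.norm ?_
  · exact Eventually.of_forall fun s => (hf.indicator measurableSet_closedBall).1
  · exact Eventually.of_forall fun s => ae_of_all _ fun y => norm_indicator_le_norm_self _ _
  · refine ae_of_all _ fun y => tendsto_const_nhds.congr' ?_
    by_cases hy : y ∈ closedBall x r
    · filter_upwards [self_mem_nhdsWithin] with s hs
      rw [indicator_of_mem hy,
        indicator_of_mem (closedBall_subset_closedBall (le_of_lt hs) hy)]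
    · have hy' : r < dist y x := by simpa using hy
      filter_upwards [Ioo_mem_nhdsGT hy'] with s hs
      rw [indicator_of_notMem hy, indicator_of_notMem]
      simpa using hs.2

lemma continuousWithinAt_measureReal_closedBall (x : Eucl n) (r : ℝ) :
    ContinuousWithinAt (fun s => τ.real (closedBall x s)) (Ioi r) r := by
  simpa using continuousWithinAt_setIntegral_closedBall (τ := τ) (integrable_const (1 : ℝ)) x r

lemma isClosed_dist_le (r : ℝ) : IsClosed {p : Eucl n × Eucl n | dist p.2 p.1 ≤ r} :=
  isClosed_le (by fun_prop) continuous_const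

lemma stronglyMeasurable_setIntegral_closedBall {f : Eucl n → E} (hf : StronglyMeasurable f)
    (r : ℝ) : StronglyMeasurable fun x => ∫ y in closedBall x r, f y ∂τ := by
  simp_rw [← integral_indicator (measurableSet_closedBall (α := Eucl n))]
  have h1 : StronglyMeasurable ({p : Eucl n × Eucl n | dist p.2 p.1 ≤ r}.indicator
      fun p => f p.2) :=
    (hf.comp_measurable measurable_snd).indicator (isClosed_dist_le r).measurableSet
  exact h1.integral_prod_right'

lemma measurable_measureReal_closedBall (r : ℝ) :
    Measurable fun x : Eucl n => τ.real (closedBall x r) := by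
  simpa using (stronglyMeasurable_setIntegral_closedBall (τ := τ)
    (stronglyMeasurable_const (b := (1 : ℝ))) r).measurable

variable {f : Eucl n → Eucl n}

lemma measurable_ballAverage (hf : Measurable f) (r : ℝ) :
    Measurable fun x => ballAverage τ f x r :=
  (measurable_measureReal_closedBall r).inv.smul
    (stronglyMeasurable_setIntegral_closedBall hf.stronglyMeasurable r).measurable

omit [IsFiniteMeasure τ] in
lemma ballAverage_of_measure_eq_zero {x : Eucl n} {r : ℝ} (h : τ.real (closedBall x r) = 0) :
    ballAverage τ f x r = 0 := by
  simp [ballAverage, h]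

/-- The points at which the averages of `f` over small balls tend to a unit vector. -/
def unitLimitSet (τ : Measure (Eucl n)) (f : Eucl n → Eucl n) : Set (Eucl n) :=
  {x | ∃ v : Eucl n, ‖v‖ = 1 ∧ Tendsto (ballAverage τ f x) (𝓝[>] 0) (𝓝 v)}

/-- Averages over null balls are read as 0, so a nonzero limit forces positive mass at arbitrarily
small radii, hence at all radii by monotonicity. -/
lemma eventually_measureReal_pos {x v : Eucl n} (hv : v ≠ 0)
    (h : Tendsto (ballAverage τ f x) (𝓝[>] 0) (𝓝 v)) (r : ℝ) (hr : 0 < r) :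
    0 < τ.real (closedBall x r) := by
  have h1 := h.eventually_ne hv
  obtain ⟨s, hs, hsr⟩ := (h1.and (Ioo_mem_nhdsGT hr)).exists
  have h2 : τ.real (closedBall x s) ≠ 0 := fun h0 => hs (ballAverage_of_measure_eq_zero h0)
  have h3 : τ.real (closedBall x s) ≤ τ.real (closedBall x r) :=
    measureReal_mono (closedBall_subset_closedBall hsr.2.le)
  exact (lt_of_le_of_ne measureReal_nonneg h2.symm).trans_le h3

lemma measurableSet_unitLimitSet (hf : Measurable f) (hfi : Integrable f τ) :
    MeasurableSet (unitLimitSet τ f) := by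
  -- On S the averages have nonzero denominators and are right continuous in the radius, as the
  -- reduction to rational radii requires.
  set S : Set (Eucl n) := {x | ∀ k : ℕ, 0 < τ.real (closedBall x (1 / ((k : ℝ) + 1)))} with hS
  have hSm : MeasurableSet S := by
    rw [hS, ofPred_forall]
    exact MeasurableSet.iInter fun k =>
      measurableSet_lt measurable_const (measurable_measureReal_closedBall _)
  set l : Filter ℚ := comap ((↑) : ℚ → ℝ) (𝓝[>] 0) with hl
  have hcont : ∀ x ∈ S, ∀ r, 0 < r → ContinuousWithinAt (ballAverage τ f x) (Ioi r) r := by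
    intro x hx r hr
    obtain ⟨k, hk⟩ := exists_nat_one_div_lt hr
    have hpos : τ.real (closedBall x r) ≠ 0 :=
      ((hx k).trans_le (measureReal_mono (closedBall_subset_closedBall hk.le))).ne'
    exact ((continuousWithinAt_measureReal_closedBall x r).inv₀ hpos).smul
      (continuousWithinAt_setIntegral_closedBall hfi x r)
  have heq : unitLimitSet τ f = S ∩
      ({x | ∃ v, Tendsto (fun q : ℚ => ballAverage τ f x q) l (𝓝 v)} ∩
        {x | Tendsto (fun q : ℚ => ‖ballAverage τ f x q‖) l (𝓝 1)}) := by
    ext x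
    constructor
    · rintro ⟨v, hv, h⟩
      have h1 : Tendsto (fun q : ℚ => ballAverage τ f x q) l (𝓝 v) := h.comp tendsto_comap
      refine ⟨fun k => eventually_measureReal_pos ?_ h _ (by positivity), ⟨v, h1⟩, ?_⟩
      · rintro rfl; simp at hv
      · exact hv ▸ h1.norm
    · rintro ⟨hx, ⟨v, h1⟩, h2⟩
      have : l.NeBot := neBot_comap_rat 0
      exact ⟨v, tendsto_nhds_unique h1.norm h2, (tendsto_iff_tendsto_rat (hcont x hx)).2 h1⟩
  rw [heq]
  have hm : ∀ q : ℚ, Measurable fun x => ballAverage τ f x (q : ℝ) :=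
    fun q => measurable_ballAverage hf q
  exact hSm.inter ((measurableSet_exists_tendsto
    (f := fun (q : ℚ) x => ballAverage τ f x q) hm).inter
    (measurableSet_tendsto _ (f := fun (q : ℚ) x => ‖ballAverage τ f x q‖) fun q => (hm q).norm))

lemma ae_tendsto_ballAverage (hfi : Integrable f τ) :
    ∀ᵐ x ∂τ, Tendsto (ballAverage τ f x) (𝓝[>] 0) (𝓝 (f x)) := by
  filter_upwards [(Besicovitch.vitaliFamily τ).ae_tendsto_average hfi.locallyIntegrable] with x hx
  have := hx.comp (Besicovitch.tendsto_filterAt τ x)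
  refine this.congr fun r => ?_
  simp [ballAverage, setAverage_eq]

/-- The component of the averages along v tends to 1, so it eventually exceeds 1/2. -/
lemma exists_isHalfDense (hfi : Integrable f τ) {x v : Eucl n} (hv : ‖v‖ = 1)
    (h : Tendsto (ballAverage τ f x) (𝓝[>] 0) (𝓝 v)) :
    ∃ r₀ > 0, IsHalfDense τ f x v r₀ := by
  have h1 : Tendsto (fun r => ⟪v, ballAverage τ f x r⟫) (𝓝[>] 0) (𝓝 1) := by
    have := Tendsto.inner (𝕜 := ℝ) (tendsto_const_nhds (x := v)) h
    rwa [real_inner_self_eq_norm_sq, hv, one_pow] at this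
  have h2 := h1.eventually_const_lt (show (1 / 2 : ℝ) < 1 by norm_num)
  obtain ⟨r₀, hr₀, hsub⟩ := (nhdsGT_basis (0 : ℝ)).eventually_iff.1 h2
  refine ⟨r₀, hr₀, hv, fun s hs hsr => ?_⟩
  have hpos : 0 < τ.real (closedBall x s) :=
    eventually_measureReal_pos (by rintro rfl; simp at hv) h s hs
  refine ⟨hpos, ?_⟩
  have h3 := hsub ⟨hs, hsr⟩
  rw [ballAverage, real_inner_smul_right, ← integral_inner (𝕜 := ℝ) hfi.integrableOn, inv_mul_eq_div,
    lt_div_iff₀ hpos] at h3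
  linarith

end

/-! ### The reduced boundary carries the perimeter measure -/

section
variable {L : Set (Eucl n)} {τ : Measure (Eucl n)} [IsFiniteMeasure τ] {f : Eucl n → Eucl n}

open scoped ContDiff in
-- By the fundamental lemma of the calculus of variations all components of f vanish τ-a.e. in U,
-- which is incompatible with ‖f‖ = 1 unless U is null.
lemma IsGradPair.measure_eq_zero_of_isOpen (hp : IsGradPair L τ f) {U : Set (Eucl n)}
    (hU : IsOpen U)
    (h : ∀ g : Eucl n → ℝ, ContDiff ℝ ∞ g → HasCompactSupport g → tsupport g ⊆ U → ∀ v : Eucl n,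
      ∫ x in L, fderiv ℝ g x v = 0) : τ U = 0 := by
  have h1 : ∀ v : Eucl n, ∀ᵐ x ∂τ, x ∈ U → ⟪v, f x⟫ = 0 := by
    intro v
    refine hU.ae_eq_zero_of_integral_contDiff_smul_eq_zero
      ((hp.integrable_inner v).locallyIntegrable.locallyIntegrableOn _) fun g hg hc hgU => ?_
    have h2 := hp.integral_eq g (hg.of_le (by simp)) hc v
    rw [h g hg hc hgU v] at h2
    simpa using h2
  have h2 : ∀ᵐ x ∂τ, ∀ i : Fin n, x ∈ U → ⟪EuclideanSpace.single i (1 : ℝ), f x⟫ = 0 :=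
    ae_all_iff.2 fun i => h1 _
  rw [← compl_compl U]
  change Uᶜ ∈ ae τ
  filter_upwards [h2] with x hx hxU
  have h3 : f x = 0 := by
    ext i
    have := hx i hxU
    simpa [EuclideanSpace.inner_single_left] using this
  have := hp.norm_eq x
  rw [h3, norm_zero] at this
  exact zero_ne_one this

lemma IsGradPair.measure_interior_eq_zero (hp : IsGradPair L τ f) : τ (interior L) = 0 := by
  refine hp.measure_eq_zero_of_isOpen isOpen_interior fun g hg hc hgU v => ?_
  have hg1 : ContDiff ℝ 1 g := hg.of_le (by simp)
  rw [setIntegral_eq_integral_of_forall_compl_eq_zero, integral_fderiv_apply_eq_zero hg1 hc]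
  intro x hx
  have : x ∉ tsupport (fderiv ℝ g) := fun hxs =>
    hx (interior_subset (hgU (tsupport_fderiv_subset ℝ hxs)))
  rw [image_eq_zero_of_notMem_tsupport this]
  rfl

lemma IsGradPair.measure_compl_frontier (hp : IsGradPair L τ f) : τ (frontier L)ᶜ = 0 := by
  rw [compl_frontier_eq_union_interior]
  exact measure_union_null hp.measure_interior_eq_zero hp.compl.measure_interior_eq_zero

/-- A gradient orthogonal to a makes ∫_L ∂_v g(y - t a) independent of t. The same quantity equals
-∫ g(y - t a) ⟪v, f⟫ dτ, which tends to 0 as t → ∞ because τ is finite. So ∫_L ∂_v g = 0 for every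
smooth g. -/
lemma IsGradPair.measure_eq_zero_of_ae_inner_eq_zero (hp : IsGradPair L τ f) {a : Eucl n}
    (ha : ‖a‖ = 1) (h : ∀ᵐ x ∂τ, ⟪a, f x⟫ = 0) : τ = 0 := by
  rw [← Measure.measure_univ_eq_zero]
  refine hp.measure_eq_zero_of_isOpen isOpen_univ fun g hg hc _ v => ?_
  have hg1 : ContDiff ℝ 1 g := hg.of_le (by simp)
  have hG : ContDiff ℝ 1 fun y => fderiv ℝ g y v :=
    (hg.fderiv_right (m := 1) (WithTop.coe_le_coe.2 le_top)).clm_apply contDiff_const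
  have hGc := hasCompactSupport_fderiv_apply_const hc v
  set φ : ℝ → ℝ := fun t => ∫ y in L, fderiv ℝ g (y - t • a) v with hφ
  have hd : ∀ t, HasDerivAt φ 0 t := by
    intro t
    have h1 := hp.hasDerivAt_translate hG hGc a t
    rwa [integral_eq_zero_of_ae (h.mono fun x hx => by simp [hx])] at h1
  have hconst : ∀ t, φ t = φ 0 := fun t =>
    is_const_of_deriv_eq_zero (fun t => (hd t).differentiableAt) (fun t => (hd t).deriv) t 0
  have hφ' : ∀ t, φ t = - ∫ y, g (y - t • a) * ⟪v, f y⟫ ∂τ := by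
    intro t
    have h1 := hp.integral_eq (fun y => g (y - t • a))
      (hg1.comp (contDiff_id.sub contDiff_const)) (hc.comp_sub_const _) v
    rw [← h1]
    simp_rw [hφ, fderiv_comp_sub]
  obtain ⟨C, hC⟩ := hg1.continuous.bounded_above_of_compact_support hc
  obtain ⟨R, hR⟩ := hc.isCompact.isBounded.subset_closedBall (0 : Eucl n)
  have hlim : Tendsto (fun t : ℝ => ∫ y, g (y - t • a) * ⟪v, f y⟫ ∂τ) atTop
      (𝓝 (∫ _, (0 : ℝ) ∂τ)) := by
    refine tendsto_integral_filter_of_dominated_convergence (fun _ => C * ‖v‖) ?_ ?_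
      (integrable_const _) ?_
    · refine Eventually.of_forall fun t => ?_
      exact (hg1.continuous.comp (continuous_id.sub continuous_const)).aestronglyMeasurable.mul
        (hp.integrable_inner v).1
    · refine Eventually.of_forall fun t => ae_of_all _ fun y => ?_
      rw [norm_mul]
      gcongr
      · exact (norm_nonneg _).trans (hC y)
      · exact hC _
      · exact hp.abs_inner_le v y
    · refine ae_of_all _ fun y => tendsto_const_nhds.congr' ?_
      filter_upwards [eventually_gt_atTop (R + ‖y‖), eventually_ge_atTop 0] with t ht ht0
      have : y - t • a ∉ tsupport g := by
        intro hm
        have h1 := hR hm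
        rw [mem_closedBall_zero_iff] at h1
        have h2 : t = ‖t • a‖ := by rw [norm_smul, ha, mul_one, Real.norm_of_nonneg ht0]
        have h3 := norm_sub_norm_le (t • a) y
        rw [norm_sub_rev, ← h2] at h3
        linarith
      rw [image_eq_zero_of_notMem_tsupport this, zero_mul]
  have h0 : φ 0 = ∫ y in L, fderiv ℝ g y v := by simp [hφ]
  rw [← h0]
  have h1 : Tendsto φ atTop (𝓝 (-∫ _, (0 : ℝ) ∂τ)) := hlim.neg.congr fun t => (hφ' t).symm
  have h2 : Tendsto φ atTop (𝓝 (φ 0)) := tendsto_const_nhds.congr fun t => (hconst t).symm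
  simpa using tendsto_nhds_unique h2 h1

end

/-- The normalizing factor only has to be finite and nonzero: what is transferred from `μH` is
finiteness and null sets. -/
lemma surfaceMeasure_eq (n : ℕ) : ∃ c : NNReal, c ≠ 0 ∧
    surfaceMeasure n = c • (μH[((n - 1 : ℕ) : ℝ)] : Measure (Eucl n)) :=
  ⟨_, Measure.addHaarScalarFactor_volume_hausdorffMeasure_ne_zero (n - 1),
    Measure.euclideanHausdorffMeasure_def (n - 1)⟩

section
variable {L : Set (Eucl n)} {D : VectorMeasure (Eucl n) (Eucl n)} {f : Eucl n → Eucl n}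

lemma gradRatio_eq_ballAverage
    (hf : ∀ s, MeasurableSet s → gradMeasure L s = ∫ x in s, f x ∂(gradMeasure L).variation)
    (x : Eucl n) : gradRatio L x = ballAverage (gradMeasure L).variation f x := by
  ext1 r
  rw [gradRatio, ballAverage, hf _ measurableSet_closedBall]
  rfl

lemma reducedBoundary_eq
    (hf : ∀ s, MeasurableSet s → gradMeasure L s = ∫ x in s, f x ∂(gradMeasure L).variation) :
    reducedBoundary L = frontier L ∩ unitLimitSet (gradMeasure L).variation f := by
  ext x
  simp only [reducedBoundary, unitLimitSet, mem_ofPred_eq, mem_inter_iff, gradRatio_eq_ballAverage hf]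

lemma outerNormal_eq {x v : Eucl n} (h : Tendsto (gradRatio L x) (𝓝[>] 0) (𝓝 v)) :
    outerNormal L x = - v := by
  rw [outerNormal, h.limUnder_eq]

lemma tendsto_gradRatio_of_mem {x : Eucl n} (hx : x ∈ reducedBoundary L) :
    ‖outerNormal L x‖ = 1 ∧ Tendsto (gradRatio L x) (𝓝[>] 0) (𝓝 (-outerNormal L x)) := by
  obtain ⟨_, v, hv, h⟩ := hx
  rw [outerNormal_eq h, norm_neg, neg_neg]
  exact ⟨hv, h⟩

lemma reducedBoundary_eq_empty_of_gradMeasure_eq_zero (h : gradMeasure L = 0) :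
    reducedBoundary L = ∅ := by
  refine eq_empty_of_forall_notMem fun x hx => ?_
  obtain ⟨h1, h2⟩ := tendsto_gradRatio_of_mem hx
  have h3 : gradRatio L x = fun _ => 0 := by
    ext1 r
    simp [gradRatio, h]
  rw [h3] at h2
  have h4 := tendsto_nhds_unique h2 tendsto_const_nhds
  rw [neg_eq_zero] at h4
  rw [h4, norm_zero] at h1
  exact zero_ne_one h1

/-- Finite area follows from the lower density bound; the normal is measurable as the limit of ball
averages along radii 1/(k+1). Degeneracy in one direction u is excluded through τ. -/
lemma reducedBoundary_regularity_of_isGradMeasure (hn : 3 ≤ n) (hL : NullMeasurableSet L)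
    (hD : IsGradMeasure L (gradMeasure L)) :
    surfaceArea L < ∞ ∧
    AEStronglyMeasurable (outerNormal L) ((surfaceMeasure n).restrict (reducedBoundary L)) ∧
    (∀ᵐ y ∂(surfaceMeasure n).restrict (reducedBoundary L), ‖outerNormal L y‖ = 1) ∧
    ((surfaceMeasure n).restrict (reducedBoundary L) = 0 ∨ ∀ u : Eucl n, ‖u‖ = 1 →
      0 < cosSupport ((surfaceMeasure n).restrict (reducedBoundary L)) (outerNormal L) u) := by
  obtain ⟨f, hp, hf⟩ := exists_isGradPair hn hL hD
  set τ := (gradMeasure L).variation with hτ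
  have : IsFiniteMeasure τ := ⟨hD.1⟩
  have hfi : Integrable f τ := ⟨hp.measurable.aestronglyMeasurable,
    HasFiniteIntegral.of_bounded (C := 1) (ae_of_all _ fun x => (hp.norm_eq x).le)⟩
  have hRB := reducedBoundary_eq hf
  have hm : MeasurableSet (reducedBoundary L) := by
    rw [hRB]
    exact isClosed_frontier.measurableSet.inter (measurableSet_unitLimitSet hp.measurable hfi)
  have hdense : ∀ x ∈ reducedBoundary L, ∃ v, ∃ r₀ > 0, IsHalfDense τ f x v r₀ := by
    intro x hx
    obtain ⟨h1, h2⟩ := tendsto_gradRatio_of_mem hx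
    rw [gradRatio_eq_ballAverage hf] at h2
    exact ⟨_, exists_isHalfDense hfi (by rwa [norm_neg]) h2⟩
  obtain ⟨c, hc, hS⟩ := surfaceMeasure_eq n
  have hfin : surfaceArea L < ∞ := by
    have hH : μH[((n - 1 : ℕ) : ℝ)] (reducedBoundary L) < ∞ := by
      refine (hausdorffMeasure_le_of_lower_density (τ := τ) (d := n - 1)
        (c := densityConst n / 3 ^ (n - 1))
        (div_pos (densityConst_pos (by omega)) (by positivity)) fun x hx => ?_).trans_lt
        (ENNReal.mul_lt_top ENNReal.ofReal_lt_top (measure_lt_top τ univ))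
      obtain ⟨v, r₀, hr₀, hd⟩ := hdense x hx
      refine ⟨r₀, hr₀, fun r hr hrr => ?_⟩
      have h1 := hp.density_le hn hd (r := r / 3) (by positivity) (by linarith)
      rw [mul_div_cancel₀ r (by norm_num : (3 : ℝ) ≠ 0), div_pow] at h1
      calc densityConst n / 3 ^ (n - 1) * r ^ (n - 1)
          = densityConst n * (r ^ (n - 1) / 3 ^ (n - 1)) := by ring
        _ ≤ _ := h1
    rw [surfaceArea, hS]
    exact ENNReal.mul_lt_top ENNReal.coe_lt_top hH
  have hν1 : ∀ᵐ y ∂(surfaceMeasure n).restrict (reducedBoundary L), ‖outerNormal L y‖ = 1 :=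
    (ae_restrict_iff' hm).2 (ae_of_all _ fun y hy => (tendsto_gradRatio_of_mem hy).1)
  have hνm : AEStronglyMeasurable (outerNormal L)
      ((surfaceMeasure n).restrict (reducedBoundary L)) := by
    refine AEMeasurable.aestronglyMeasurable ?_
    have hr : Tendsto (fun k : ℕ => 1 / ((k : ℝ) + 1)) atTop (𝓝[>] 0) :=
      tendsto_nhdsWithin_iff.2 ⟨tendsto_one_div_add_atTop_nhds_zero_nat,
        Eventually.of_forall fun k => mem_Ioi.2 (by positivity)⟩
    refine aemeasurable_of_tendsto_metrizable_ae' (f := fun (k : ℕ) x =>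
      - ballAverage τ f x (1 / ((k : ℝ) + 1)))
      (fun k => (measurable_ballAverage hp.measurable _).neg.aemeasurable)
      ((ae_restrict_iff' hm).2 (ae_of_all _ fun x hx => ?_))
    have h1 := ((tendsto_gradRatio_of_mem hx).2.comp hr).neg
    rw [neg_neg, gradRatio_eq_ballAverage hf] at h1
    exact h1
  refine ⟨hfin, hνm, hν1, ?_⟩
  · by_contra! hcon
    obtain ⟨hne, u, hu, hu0⟩ := hcon
    have hfin' : IsFiniteMeasure ((surfaceMeasure n).restrict (reducedBoundary L)) :=
      ⟨by rw [Measure.restrict_apply_univ]; exact hfin⟩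
    apply hne
    have hint0 : ∫ y in reducedBoundary L, |⟪u, outerNormal L y⟫| ∂(surfaceMeasure n) = 0 := by
      have h1 : 0 ≤ ∫ y in reducedBoundary L, |⟪u, outerNormal L y⟫| ∂(surfaceMeasure n) :=
        integral_nonneg fun y => abs_nonneg _
      have h2 : (1 / 2) * ∫ y in reducedBoundary L, |⟪u, outerNormal L y⟫| ∂(surfaceMeasure n) ≤ 0 :=
        hu0
      linarith
    rw [integral_eq_zero_iff_of_nonneg (fun y => abs_nonneg _)
      (integrable_abs_inner hνm hν1 u)] at hint0
    have hae : ∀ᵐ y ∂(surfaceMeasure n), y ∈ reducedBoundary L → ⟪u, outerNormal L y⟫ = 0 := by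
      rw [← ae_restrict_iff' hm]
      filter_upwards [hint0] with y hy
      simpa using hy
    set N : Set (Eucl n) := {y | y ∈ reducedBoundary L ∧ ⟪u, outerNormal L y⟫ ≠ 0} with hN
    have hN0 : μH[((n - 1 : ℕ) : ℝ)] N = 0 := by
      have h1 : surfaceMeasure n N = 0 := by
        rw [ae_iff] at hae
        convert hae using 2
        ext y
        simp [hN]
      rw [hS, Measure.smul_apply, ENNReal.smul_def, smul_eq_mul, mul_eq_zero] at h1
      exact h1.resolve_left (by simpa using hc)
    -- The upper density bound at points of the reduced boundary transfers null sets from H^(n-1) to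
    -- τ.
    have hτN : τ N = 0 := by
      refine measure_eq_zero_of_upper_density (d := n - 1) (C := 6 * omega n * 2 ^ n)
        (by have := omega_pos n; positivity) hN0 fun x hx => ?_
      obtain ⟨v, r₀, hr₀, hd⟩ := hdense x hx.1
      exact ⟨r₀ / 2, half_pos hr₀, fun r hr hrr => hp.upper_density_le hn hd hr (by linarith)⟩
    -- By Lebesgue differentiation, and since τ lives on the topological boundary, τ-almost every x
    -- lies in the reduced boundary with outer normal -f x; so ⟪u, f⟫ = 0 holds τ-a.e.
    have hτ0 : τ = 0 := by
      refine hp.measure_eq_zero_of_ae_inner_eq_zero hu ?_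
      have h1 : ∀ᵐ x ∂τ, x ∉ N := measure_eq_zero_iff_ae_notMem.1 hτN
      have h2 : ∀ᵐ x ∂τ, x ∉ (frontier L)ᶜ :=
        measure_eq_zero_iff_ae_notMem.1 hp.measure_compl_frontier
      filter_upwards [h1, h2, ae_tendsto_ballAverage hfi] with x hx1 hx2 hx3
      rw [← gradRatio_eq_ballAverage hf] at hx3
      have hxB : x ∈ reducedBoundary L := ⟨not_not.1 hx2, f x, hp.norm_eq x, hx3⟩
      by_contra hne0
      refine hx1 ⟨hxB, ?_⟩
      rw [outerNormal_eq hx3, inner_neg_right]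
      exact neg_ne_zero.2 hne0
    have hD0 : gradMeasure L = 0 := VectorMeasure.variation_eq_zero.1 hτ0
    rw [reducedBoundary_eq_empty_of_gradMeasure_eq_zero hD0, Measure.restrict_empty]

end

/-! ### The Riesz representation of bounded functionals and existence of the weak gradient -/

open scoped NNReal BoundedContinuousFunction CompactlySupported

section
variable {X : Type*} [TopologicalSpace X]

/-- The positive part of a bounded functional on bounded continuous functions, on `f ≥ 0`. -/
def dualPosPart (T : (X →ᵇ ℝ) →L[ℝ] ℝ) (f : X →ᵇ ℝ) : ℝ := sSup (T '' Icc 0 f)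

lemma apply_le_of_mem_Icc (T : (X →ᵇ ℝ) →L[ℝ] ℝ) {f g : X →ᵇ ℝ} (hg : g ∈ Icc 0 f) :
    T g ≤ ‖T‖ * ‖f‖ := by
  refine (le_abs_self _).trans ((T.le_opNorm g).trans ?_)
  gcongr
  refine (BoundedContinuousFunction.norm_le (norm_nonneg f)).2 fun x => ?_
  have h1 : 0 ≤ g x := hg.1 x
  have h2 : g x ≤ f x := hg.2 x
  rw [Real.norm_of_nonneg h1]
  exact h2.trans ((le_abs_self _).trans (f.norm_coe_le_norm x))

lemma le_dualPosPart (T : (X →ᵇ ℝ) →L[ℝ] ℝ) {f g : X →ᵇ ℝ} (hg : g ∈ Icc 0 f) :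
    T g ≤ dualPosPart T f :=
  le_csSup ⟨‖T‖ * ‖f‖, by rintro _ ⟨g, hg, rfl⟩; exact apply_le_of_mem_Icc T hg⟩ ⟨g, hg, rfl⟩

lemma dualPosPart_le (T : (X →ᵇ ℝ) →L[ℝ] ℝ) {f : X →ᵇ ℝ} (hf : 0 ≤ f) {a : ℝ}
    (h : ∀ g ∈ Icc 0 f, T g ≤ a) : dualPosPart T f ≤ a :=
  csSup_le ⟨T 0, 0, ⟨le_rfl, hf⟩, rfl⟩ (by rintro _ ⟨g, hg, rfl⟩; exact h g hg)

lemma dualPosPart_nonneg (T : (X →ᵇ ℝ) →L[ℝ] ℝ) {f : X →ᵇ ℝ} (hf : 0 ≤ f) :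
    0 ≤ dualPosPart T f := by
  simpa using le_dualPosPart T (f := f) (g := 0) ⟨le_rfl, hf⟩

/-- Riesz decomposition: a function 0 ≤ g ≤ f₁ + f₂ splits as g ⊓ f₁ plus a remainder between 0 and
f₂. -/
lemma dualPosPart_add (T : (X →ᵇ ℝ) →L[ℝ] ℝ) {f₁ f₂ : X →ᵇ ℝ} (h₁ : 0 ≤ f₁) (h₂ : 0 ≤ f₂) :
    dualPosPart T (f₁ + f₂) = dualPosPart T f₁ + dualPosPart T f₂ := by
  refine le_antisymm (dualPosPart_le T (add_nonneg h₁ h₂) fun g hg => ?_) ?_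
  · have e : g = g ⊓ f₁ + (g - g ⊓ f₁) := by abel
    rw [e, map_add]
    refine add_le_add (le_dualPosPart T ⟨le_inf hg.1 h₁, inf_le_right⟩)
      (le_dualPosPart T ⟨sub_nonneg.2 inf_le_left, ?_⟩)
    intro x
    have h1 : g x ≤ f₁ x + f₂ x := hg.2 x
    have h2 : 0 ≤ f₂ x := h₂ x
    change g x - min (g x) (f₁ x) ≤ f₂ x
    rcases min_choice (g x) (f₁ x) with h | h <;> rw [h] <;> linarith
  · rw [← le_sub_iff_add_le]
    refine dualPosPart_le T h₁ fun g₁ hg₁ => ?_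
    rw [le_sub_iff_add_le, ← le_sub_iff_add_le']
    refine dualPosPart_le T h₂ fun g₂ hg₂ => ?_
    rw [le_sub_iff_add_le', ← map_add]
    exact le_dualPosPart T ⟨add_nonneg hg₁.1 hg₂.1, add_le_add hg₁.2 hg₂.2⟩

lemma dualPosPart_smul_le (T : (X →ᵇ ℝ) →L[ℝ] ℝ) {f : X →ᵇ ℝ} (hf : 0 ≤ f) {c : ℝ} (hc : 0 < c) :
    dualPosPart T (c • f) ≤ c * dualPosPart T f := by
  have hcf : 0 ≤ c • f := fun x => mul_nonneg hc.le (hf x)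
  refine dualPosPart_le T hcf fun g hg => ?_
  have e : g = c • (c⁻¹ • g) := (smul_inv_smul₀ hc.ne' g).symm
  rw [e, map_smul, smul_eq_mul]
  gcongr
  refine le_dualPosPart T ⟨fun x => mul_nonneg (inv_nonneg.2 hc.le) (hg.1 x), fun x => ?_⟩
  have h1 : g x ≤ c * f x := hg.2 x
  change c⁻¹ * g x ≤ f x
  rwa [inv_mul_le_iff₀ hc]

lemma dualPosPart_smul (T : (X →ᵇ ℝ) →L[ℝ] ℝ) {f : X →ᵇ ℝ} (hf : 0 ≤ f) {c : ℝ} (hc : 0 ≤ c) :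
    dualPosPart T (c • f) = c * dualPosPart T f := by
  rcases hc.eq_or_lt with rfl | hc
  · have : dualPosPart T (0 : X →ᵇ ℝ) = 0 := by simp [dualPosPart]
    simpa using this
  · refine le_antisymm (dualPosPart_smul_le T hf hc) ?_
    have hcf : 0 ≤ c • f := fun x => mul_nonneg hc.le (hf x)
    have h1 := dualPosPart_smul_le T hcf (inv_pos.2 hc)
    rw [inv_smul_smul₀ hc.ne'] at h1
    calc c * dualPosPart T f ≤ c * (c⁻¹ * dualPosPart T (c • f)) := by gcongr
      _ = _ := by field_simp

/-- A compactly supported function with values in `ℝ≥0`, as a bounded continuous function. -/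
def boundedOfNNReal (f : C_c(X, ℝ≥0)) : X →ᵇ ℝ := f.toReal.toBoundedContinuousFunction

lemma boundedOfNNReal_apply (f : C_c(X, ℝ≥0)) (x : X) : boundedOfNNReal f x = f x := by
  simp [boundedOfNNReal]

lemma boundedOfNNReal_nonneg (f : C_c(X, ℝ≥0)) : 0 ≤ boundedOfNNReal f := fun x => by
  change 0 ≤ boundedOfNNReal f x
  rw [boundedOfNNReal_apply]
  exact (f x).coe_nonneg

lemma boundedOfNNReal_add (f g : C_c(X, ℝ≥0)) :
    boundedOfNNReal (f + g) = boundedOfNNReal f + boundedOfNNReal g := by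
  ext x; simp [boundedOfNNReal]

lemma boundedOfNNReal_smul (c : ℝ≥0) (f : C_c(X, ℝ≥0)) :
    boundedOfNNReal (c • f) = (c : ℝ) • boundedOfNNReal f := by
  ext x; simp [boundedOfNNReal, NNReal.smul_def]

/-- The positive part of a bounded functional, as a functional on `C_c(X, ℝ≥0)`. -/
def posFunctional (T : (X →ᵇ ℝ) →L[ℝ] ℝ) : C_c(X, ℝ≥0) →ₗ[ℝ≥0] ℝ≥0 where
  toFun f := ⟨dualPosPart T (boundedOfNNReal f), dualPosPart_nonneg T (boundedOfNNReal_nonneg f)⟩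
  map_add' f g := NNReal.eq <| by
    change dualPosPart T (boundedOfNNReal (f + g)) =
      dualPosPart T (boundedOfNNReal f) + dualPosPart T (boundedOfNNReal g)
    rw [boundedOfNNReal_add,
      dualPosPart_add T (boundedOfNNReal_nonneg f) (boundedOfNNReal_nonneg g)]
  map_smul' c f := NNReal.eq <| by
    change dualPosPart T (boundedOfNNReal (c • f)) = c * dualPosPart T (boundedOfNNReal f)
    rw [boundedOfNNReal_smul, dualPosPart_smul T (boundedOfNNReal_nonneg f) c.coe_nonneg]

/-- The negative part of a bounded functional, as a functional on `C_c(X, ℝ≥0)`. -/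
def negFunctional (T : (X →ᵇ ℝ) →L[ℝ] ℝ) : C_c(X, ℝ≥0) →ₗ[ℝ≥0] ℝ≥0 where
  toFun f := ⟨dualPosPart T (boundedOfNNReal f) - T (boundedOfNNReal f),
    sub_nonneg.2 (le_dualPosPart T ⟨boundedOfNNReal_nonneg f, le_rfl⟩)⟩
  map_add' f g := NNReal.eq <| by
    change dualPosPart T (boundedOfNNReal (f + g)) - T (boundedOfNNReal (f + g)) =
      dualPosPart T (boundedOfNNReal f) - T (boundedOfNNReal f) +
        (dualPosPart T (boundedOfNNReal g) - T (boundedOfNNReal g))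
    rw [boundedOfNNReal_add,
      dualPosPart_add T (boundedOfNNReal_nonneg f) (boundedOfNNReal_nonneg g), map_add]
    ring
  map_smul' c f := NNReal.eq <| by
    change dualPosPart T (boundedOfNNReal (c • f)) - T (boundedOfNNReal (c • f)) =
      c * (dualPosPart T (boundedOfNNReal f) - T (boundedOfNNReal f))
    rw [boundedOfNNReal_smul, dualPosPart_smul T (boundedOfNNReal_nonneg f) c.coe_nonneg,
      map_smul, smul_eq_mul]
    ring

end

lemma measure_univ_le_of_radialCutoff {α : Measure (Eucl n)} {C : ℝ≥0∞}
    (h : ∀ f : C_c(Eucl n, ℝ≥0), (∀ x, f x ≤ 1) → ∫⁻ x, f x ∂α ≤ C) : α univ ≤ C := by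
  have hmono : Monotone fun k : ℕ => closedBall (0 : Eucl n) k := fun i j hij =>
    closedBall_subset_closedBall (by exact_mod_cast hij)
  rw [← iUnion_closedBall_nat (0 : Eucl n), hmono.measure_iUnion]
  refine iSup_le fun k => ?_
  have hk : (0 : ℝ) ≤ k := k.cast_nonneg
  let u : C_c(Eucl n, ℝ) := ⟨⟨radialCutoff 0 k 1, (contDiff_radialCutoff _ _ _).continuous⟩,
    hasCompactSupport_radialCutoff 0 hk one_pos⟩
  have hu : ∀ x, u.nnrealPart x = (radialCutoff 0 k 1 x).toNNReal := fun x => rfl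
  refine le_trans ?_ (h u.nnrealPart fun x => ?_)
  · rw [← lintegral_indicator_one measurableSet_closedBall]
    refine lintegral_mono fun x => ?_
    by_cases hx : x ∈ closedBall (0 : Eucl n) k
    · rw [indicator_of_mem hx, hu, radialCutoff, radialProfile_of_le hk one_pos (norm_nonneg _)]
      · simp
      · simpa using hx
    · rw [indicator_of_notMem hx]
      exact zero_le
  · rw [hu]
    exact Real.toNNReal_le_one.2 (radialProfile_mem_Icc _ _ _).2

/-- T is the difference of the positive functionals T⁺ and T⁺ - T, each represented by a measure. On
functions with values in [0, 1] they are at most ‖T‖ and 2‖T‖, so the measures are finite. -/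
lemma exists_measures_of_functional (T : (Eucl n →ᵇ ℝ) →L[ℝ] ℝ) :
    ∃ α β : Measure (Eucl n), IsFiniteMeasure α ∧ IsFiniteMeasure β ∧
      ∀ g : C_c(Eucl n, ℝ), T g.toBoundedContinuousFunction = ∫ x, g x ∂α - ∫ x, g x ∂β := by
  set α := NNRealRMK.rieszMeasure (posFunctional T)
  set β := NNRealRMK.rieszMeasure (negFunctional T)
  have hnorm : ∀ f : C_c(Eucl n, ℝ≥0), (∀ x, f x ≤ 1) → ‖boundedOfNNReal f‖ ≤ 1 := by
    intro f hf
    refine (BoundedContinuousFunction.norm_le zero_le_one).2 fun x => ?_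
    rw [boundedOfNNReal_apply, Real.norm_of_nonneg (f x).coe_nonneg]
    exact_mod_cast hf x
  have hpos : ∀ f : C_c(Eucl n, ℝ≥0), (∀ x, f x ≤ 1) →
      dualPosPart T (boundedOfNNReal f) ≤ ‖T‖ := by
    intro f hf
    refine dualPosPart_le T (boundedOfNNReal_nonneg f) fun g hg => ?_
    exact (apply_le_of_mem_Icc T hg).trans (mul_le_of_le_one_right (norm_nonneg T) (hnorm f hf))
  have hα : IsFiniteMeasure α := by
    refine ⟨(measure_univ_le_of_radialCutoff (C := ENNReal.ofReal ‖T‖) fun f hf => ?_).trans_lt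
      ENNReal.ofReal_lt_top⟩
    rw [NNRealRMK.lintegral_rieszMeasure, ← ENNReal.ofReal_coe_nnreal]
    exact ENNReal.ofReal_le_ofReal (hpos f hf)
  have hβ : IsFiniteMeasure β := by
    refine ⟨(measure_univ_le_of_radialCutoff (C := ENNReal.ofReal (2 * ‖T‖)) fun f hf => ?_).trans_lt
      ENNReal.ofReal_lt_top⟩
    rw [NNRealRMK.lintegral_rieszMeasure, ← ENNReal.ofReal_coe_nnreal]
    refine ENNReal.ofReal_le_ofReal ?_
    change dualPosPart T (boundedOfNNReal f) - T (boundedOfNNReal f) ≤ _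
    have h1 := hpos f hf
    have h2 := (neg_le_abs _).trans (T.le_opNorm (boundedOfNNReal f))
    have h3 := mul_le_of_le_one_right (norm_nonneg T) (hnorm f hf)
    linarith
  refine ⟨α, β, hα, hβ, fun g => ?_⟩
  have hint : ∀ (γ : Measure (Eucl n)) [IsFiniteMeasure γ] (f : C_c(Eucl n, ℝ≥0)),
      Integrable (fun x => (f x : ℝ)) γ := by
    intro γ _ f
    have := f.toReal.continuous.integrable_of_hasCompactSupport (μ := γ) f.toReal.hasCompactSupport
    refine this.congr (ae_of_all _ fun x => ?_)
    exact f.toReal_apply x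
  have hT : ∀ f : C_c(Eucl n, ℝ≥0), T (boundedOfNNReal f) =
      ∫ x, (f x : ℝ) ∂α - ∫ x, (f x : ℝ) ∂β := by
    intro f
    rw [NNRealRMK.integral_rieszMeasure, NNRealRMK.integral_rieszMeasure]
    change _ = dualPosPart T (boundedOfNNReal f) -
      (dualPosPart T (boundedOfNNReal f) - T (boundedOfNNReal f))
    ring
  have hgx : ∀ x, g x = (g.nnrealPart x : ℝ) - ((-g).nnrealPart x : ℝ) := fun x => by
    rw [← CompactlySupportedContinuousMap.toReal_apply,
      ← CompactlySupportedContinuousMap.toReal_apply]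
    exact (congrArg (fun f : C_c(Eucl n, ℝ) => f x) g.nnrealPart_sub_nnrealPart_neg).symm
  have hg : g.toBoundedContinuousFunction =
      boundedOfNNReal g.nnrealPart - boundedOfNNReal (-g).nnrealPart := by
    ext x
    rw [BoundedContinuousFunction.sub_apply, boundedOfNNReal_apply, boundedOfNNReal_apply]
    exact hgx x
  rw [hg, map_sub, hT, hT]
  simp_rw [hgx]
  rw [integral_sub (hint α _) (hint α _), integral_sub (hint β _) (hint β _)]
  ring

/-! ### Construction of the weak gradient from its partial derivatives. -/

open scoped BoundedContinuousFunction CompactlySupported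

/-- Moving negative parts across, α + h⁻τ = β + h⁺τ is an identity of finite positive measures,
against which ψ can be integrated. -/
lemma integral_mul_eq_sub_of_setIntegral_eq {α β τ : Measure (Eucl n)} [IsFiniteMeasure α]
    [IsFiniteMeasure β] {h : Eucl n → ℝ} (hm : Measurable h) (hi : Integrable h τ)
    (hs : ∀ s, MeasurableSet s → ∫ x in s, h x ∂τ = α.real s - β.real s) {ψ : Eucl n → ℝ}
    (hψ : Continuous ψ) (hc : HasCompactSupport ψ) :
    ∫ x, ψ x * h x ∂τ = ∫ x, ψ x ∂α - ∫ x, ψ x ∂β := by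
  set P := τ.withDensity fun x => ENNReal.ofReal (h x) with hP
  set N := τ.withDensity fun x => ENNReal.ofReal (-h x) with hN
  have hPfin : IsFiniteMeasure P := isFiniteMeasure_withDensity_ofReal hi.2
  have hNfin : IsFiniteMeasure N := isFiniteMeasure_withDensity_ofReal hi.neg.2
  have heq : α + N = β + P := by
    ext s hms
    have h1 := hs s hms
    rw [integral_eq_lintegral_pos_part_sub_lintegral_neg_part hi.integrableOn,
      ← withDensity_apply _ hms, ← withDensity_apply _ hms, ← hP, ← hN] at h1
    rw [Measure.add_apply, Measure.add_apply, ← ENNReal.toReal_eq_toReal_iff' (by finiteness)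
      (by finiteness), ENNReal.toReal_add (by finiteness) (by finiteness),
      ENNReal.toReal_add (by finiteness) (by finiteness)]
    change (P s).toReal - (N s).toReal = (α s).toReal - (β s).toReal at h1
    linarith
  have hψi : ∀ (γ : Measure (Eucl n)) [IsFiniteMeasure γ], Integrable ψ γ := fun γ _ =>
    hψ.integrable_of_hasCompactSupport hc
  have h1 : ∫ x, ψ x ∂α + ∫ x, ψ x ∂N = ∫ x, ψ x ∂β + ∫ x, ψ x ∂P := by
    rw [← integral_add_measure (hψi α) (hψi N), ← integral_add_measure (hψi β) (hψi P), heq]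
  have h2 : ∫ x, ψ x * h x ∂τ = ∫ x, ψ x ∂P - ∫ x, ψ x ∂N := by
    have hNm : Measurable fun x => ENNReal.ofReal (-h x) := hm.neg.ennreal_ofReal
    have hPψ := hψi P
    have hNψ := hψi N
    rw [hP, integrable_withDensity_iff_integrable_smul' hm.ennreal_ofReal
      (ae_of_all _ fun x => ENNReal.ofReal_lt_top)] at hPψ
    rw [hN, integrable_withDensity_iff_integrable_smul' hNm
      (ae_of_all _ fun x => ENNReal.ofReal_lt_top)] at hNψ
    rw [hP, hN, integral_withDensity_eq_integral_toReal_smul hm.ennreal_ofReal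
      (ae_of_all _ fun x => ENNReal.ofReal_lt_top),
      integral_withDensity_eq_integral_toReal_smul hNm
      (ae_of_all _ fun x => ENNReal.ofReal_lt_top), ← integral_sub hPψ hNψ]
    refine integral_congr_ae (ae_of_all _ fun x => ?_)
    simp only [ENNReal.toReal_ofReal', smul_eq_mul]
    rcases le_total 0 (h x) with hx | hx
    · rw [max_eq_left hx, max_eq_right (by linarith)]; ring
    · rw [max_eq_right hx, max_eq_left (by linarith)]; ring
  linarith

lemma abs_integral_fderiv_le {L : Set (Eucl n)} (hL : perimeter L < ∞) {u : Eucl n → ℝ}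
    (hu : ContDiff ℝ 1 u) (hc : HasCompactSupport u) {v : Eucl n} (hv : ‖v‖ = 1) {C : ℝ}
    (hC : ∀ x, |u x| ≤ C) :
    |∫ x in L, fderiv ℝ u x v| ≤ (perimeter L).toReal * C := by
  have key : ∀ w : Eucl n → ℝ, ContDiff ℝ 1 w → HasCompactSupport w → (∀ x, |w x| ≤ 1) →
      ∫ x in L, fderiv ℝ w x v ≤ (perimeter L).toReal := by
    intro w hw hwc hw1
    have hφ : IsTestField fun y => w y • v := ⟨hw.smul contDiff_const, hwc.smul_right⟩
    have h1 : ENNReal.ofReal (∫ x in L, divergence (fun y => w y • v) x) ≤ perimeter L :=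
      le_iSup_of_le _ (le_iSup_of_le hφ (le_iSup_of_le
        (fun x => by rw [norm_smul, hv, mul_one]; exact hw1 x) le_rfl))
    simp_rw [divergence_smul_const hw] at h1
    exact (ENNReal.ofReal_le_iff_le_toReal hL.ne).1 h1
  have hC0 : 0 ≤ C := (abs_nonneg _).trans (hC 0)
  rcases hC0.eq_or_lt with rfl | hCpos
  · have : u = fun _ => 0 := funext fun x => abs_nonpos_iff.1 (hC x)
    simp [this]
  -- The perimeter bounds integrals from above only, so both signs of the scaling are used.
  · have hsc : ∀ c : ℝ, |c| = C⁻¹ → c * ∫ x in L, fderiv ℝ u x v ≤ (perimeter L).toReal := by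
      intro c hcC
      have hcu : ContDiff ℝ 1 fun x => c * u x := contDiff_const.mul hu
      have h1 := key (fun x => c * u x) hcu hc.mul_left fun x => by
        rw [abs_mul, hcC]
        calc C⁻¹ * |u x| ≤ C⁻¹ * C := by gcongr; exact hC x
          _ = 1 := inv_mul_cancel₀ hCpos.ne'
      have h2 : ∀ x, fderiv ℝ (fun x => c * u x) x v = c * fderiv ℝ u x v := fun x => by
        rw [fderiv_const_mul (hu.differentiable (by simp) x)]
        rfl
      simp_rw [h2, integral_const_mul] at h1
      exact h1
    have h1 := hsc C⁻¹ (abs_of_pos (inv_pos.2 hCpos))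
    have h2 := hsc (-C⁻¹) (by rw [abs_neg, abs_of_pos (inv_pos.2 hCpos)])
    rw [inv_mul_le_iff₀ hCpos] at h1
    rw [neg_mul, ← mul_neg, inv_mul_le_iff₀ hCpos] at h2
    rw [abs_le]
    constructor <;> linarith

/-- The compactly supported `C¹` functions among the bounded continuous functions. -/
def testSubspace (n : ℕ) : Submodule ℝ (Eucl n →ᵇ ℝ) where
  carrier := {u | ContDiff ℝ 1 u ∧ HasCompactSupport u}
  add_mem' hu hv := ⟨hu.1.add hv.1, hu.2.add hv.2⟩
  zero_mem' := ⟨contDiff_const, HasCompactSupport.zero⟩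
  smul_mem' _ _ hu := ⟨contDiff_const.mul hu.1, hu.2.mul_left⟩

/-- The functional u ↦ -∫_L ∂_v u is bounded in the sup norm by the perimeter. Hahn–Banach extends
it to all bounded continuous functions, where the Riesz representation applies, so no density of
test functions is required. -/
lemma exists_measures_partial {L : Set (Eucl n)} (hL : HasFinitePerimeter L) {v : Eucl n}
    (hv : ‖v‖ = 1) :
    ∃ α β : Measure (Eucl n), IsFiniteMeasure α ∧ IsFiniteMeasure β ∧
      ∀ u : Eucl n → ℝ, ContDiff ℝ 1 u → HasCompactSupport u →
        ∫ x in L, fderiv ℝ u x v = -(∫ x, u x ∂α - ∫ x, u x ∂β) := by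
  let F₀ : testSubspace n →ₗ[ℝ] ℝ :=
    { toFun := fun u => -∫ x in L, fderiv ℝ (u : Eucl n →ᵇ ℝ) x v
      map_add' := fun u w => by
        have h : ∀ x, fderiv ℝ ((u + w : testSubspace n) : Eucl n →ᵇ ℝ) x v =
            fderiv ℝ (u : Eucl n →ᵇ ℝ) x v + fderiv ℝ (w : Eucl n →ᵇ ℝ) x v := fun x => by
          have e : (((u + w : testSubspace n) : Eucl n →ᵇ ℝ) : Eucl n → ℝ) =
            (u : Eucl n →ᵇ ℝ) + (w : Eucl n →ᵇ ℝ) := rfl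
          rw [e, fderiv_add (u.2.1.differentiable (by simp) x)
            (w.2.1.differentiable (by simp) x)]
          rfl
        simp_rw [h]
        rw [integral_add (integrable_fderiv_apply_const u.2.1 u.2.2 v).integrableOn
          (integrable_fderiv_apply_const w.2.1 w.2.2 v).integrableOn]
        ring
      map_smul' := fun a u => by
        have h : ∀ x, fderiv ℝ ((a • u : testSubspace n) : Eucl n →ᵇ ℝ) x v =
            a * fderiv ℝ (u : Eucl n →ᵇ ℝ) x v := fun x => by
          have e : (((a • u : testSubspace n) : Eucl n →ᵇ ℝ) : Eucl n → ℝ) =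
            fun x => a * (u : Eucl n →ᵇ ℝ) x := rfl
          rw [e, fderiv_const_mul (u.2.1.differentiable (by simp) x)]
          rfl
        simp_rw [h, integral_const_mul]
        simp }
  have hb : ∀ u : testSubspace n, ‖F₀ u‖ ≤ (perimeter L).toReal * ‖u‖ := fun u => by
    change ‖-∫ x in L, fderiv ℝ (u : Eucl n →ᵇ ℝ) x v‖ ≤ _
    rw [norm_neg, Real.norm_eq_abs]
    exact abs_integral_fderiv_le hL.2 u.2.1 u.2.2 hv fun x =>
      (u : Eucl n →ᵇ ℝ).norm_coe_le_norm x
  let F : StrongDual ℝ (testSubspace n) :=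
    ⟨F₀, AddMonoidHomClass.continuous_of_bound F₀ (perimeter L).toReal hb⟩
  obtain ⟨T, hT, _⟩ := exists_extension_norm_eq (testSubspace n) F
  obtain ⟨α, β, hα, hβ, h⟩ := exists_measures_of_functional T
  refine ⟨α, β, hα, hβ, fun u hu hc => ?_⟩
  let g : C_c(Eucl n, ℝ) := ⟨⟨u, hu.continuous⟩, hc⟩
  have h1 := h g
  have h2 := hT ⟨g.toBoundedContinuousFunction, hu, hc⟩
  have h3 : T g.toBoundedContinuousFunction = -∫ x in L, fderiv ℝ u x v := h2
  have h4 : -∫ x in L, fderiv ℝ u x v = ∫ x, u x ∂α - ∫ x, u x ∂β := h3.symm.trans h1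
  linarith

/-- D is assembled from the representing measures as ∑ (α i - β i) e_i, with variation at most ∑ (α
i + β i). Its polar decomposition turns the vector-valued pairing into coordinate integrals. -/
theorem exists_isGradMeasure (hn : 3 ≤ n) {L : Set (Eucl n)} (hL : HasFinitePerimeter L) :
    ∃ D, IsGradMeasure L D := by
  have hex := fun i : Fin n => exists_measures_partial hL
    (v := EuclideanSpace.single i (1 : ℝ)) (by simp)
  choose α β hα hβ hαβ using hex
  let E : Fin n → (ℝ →L[ℝ] Eucl n) := fun i =>
    ContinuousLinearMap.toSpanSingleton ℝ (EuclideanSpace.single i (1 : ℝ))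
  let D : VectorMeasure (Eucl n) (Eucl n) := ∑ i, ((α i).toSignedMeasure -
    (β i).toSignedMeasure).mapRange (E i).toLinearMap.toAddMonoidHom (E i).continuous
  have hD : ∀ s, MeasurableSet s → D s = ∑ i, ((α i).real s - (β i).real s) •
      (EuclideanSpace.single i (1 : ℝ) : Eucl n) := by
    intro s hs
    rw [FunLike.coe_sum, Finset.sum_apply]
    refine Finset.sum_congr rfl fun i _ => ?_
    change E i (((α i).toSignedMeasure - (β i).toSignedMeasure) s) = _
    rw [sub_apply, Measure.toSignedMeasure_apply_measurable hs,
      Measure.toSignedMeasure_apply_measurable hs]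
    rfl
  have hDi : ∀ s, MeasurableSet s → ∀ i, D s i = (α i).real s - (β i).real s := by
    intro s hs i
    rw [hD s hs]
    simp [Pi.single_apply]
  have hvar : D.variation ≤ ∑ i, (α i + β i) := by
    refine VectorMeasure.variation_le_of_forall_enorm_le fun s hs => ?_
    rw [hD s hs, Measure.finsetSum_apply]
    refine (enorm_sum_le _ _).trans (Finset.sum_le_sum fun i _ => ?_)
    rw [enorm_smul]
    have h1 : ‖(EuclideanSpace.single i (1 : ℝ) : Eucl n)‖ₑ = 1 := by
      rw [← ofReal_norm]; simp
    rw [h1, mul_one, Measure.add_apply]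
    refine (enorm_sub_le).trans (add_le_add ?_ ?_)
    · rw [Real.enorm_of_nonneg measureReal_nonneg, ofReal_measureReal]
    · rw [Real.enorm_of_nonneg measureReal_nonneg, ofReal_measureReal]
  have hfin : D.variation univ < ∞ := (hvar univ).trans_lt (by
    rw [Measure.finsetSum_apply]
    exact ENNReal.sum_lt_top.2 fun i _ => measure_lt_top _ _)
  refine ⟨D, hfin, fun φ hφ => ?_⟩
  have : IsFiniteMeasure D.variation := ⟨hfin⟩
  obtain ⟨f, hfm, hf1, hfD, hf⟩ := exists_polar hn D
  have hφi := hφ.1.continuous.integrable_of_hasCompactSupport (μ := D.variation) hφ.2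
  have hfi : Integrable f D.variation := ⟨hfm.aestronglyMeasurable,
    HasFiniteIntegral.of_bounded (C := 1) (ae_of_all _ fun x => (hf1 x).le)⟩
  let p : Fin n → (Eucl n →L[ℝ] ℝ) := fun i => EuclideanSpace.proj i
  have hφp : ∀ i, ContDiff ℝ 1 fun x => φ x i := fun i => (p i).contDiff.comp hφ.1
  have hφc : ∀ i, HasCompactSupport fun x => φ x i := fun i =>
    hφ.2.comp_left (g := fun y : Eucl n => y i) rfl
  have hfip : ∀ i, Integrable (fun x => f x i) D.variation := fun i => (p i).integrable_comp hfi
  have hmul : ∀ i, ∫ x, φ x i * f x i ∂D.variation = ∫ x, φ x i ∂α i - ∫ x, φ x i ∂β i := by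
    intro i
    refine integral_mul_eq_sub_of_setIntegral_eq ((p i).measurable.comp hfm) (hfip i)
      (fun s hs => ?_) (hφp i).continuous (hφc i)
    rw [← hDi s hs i, hfD s hs]
    exact (p i).integral_comp_comm hfi.integrableOn
  have hmi : ∀ i, Integrable (fun x => φ x i * f x i) D.variation := fun i => by
    obtain ⟨C, hC⟩ := (hφp i).continuous.bounded_above_of_compact_support (hφc i)
    exact (hfip i).bdd_mul (hφp i).continuous.aestronglyMeasurable (ae_of_all _ hC)
  have hdiv : ∀ x, divergence φ x =
      ∑ i, fderiv ℝ (fun y => φ y i) x (EuclideanSpace.single i 1) := by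
    intro x
    refine Finset.sum_congr rfl fun i _ => ?_
    have := ((p i).hasFDerivAt.comp x ((hφ.1.differentiable (by simp) x).hasFDerivAt)).fderiv
    have e : (fun y => φ y i) = p i ∘ φ := rfl
    rw [e, this]
    rfl
  rw [hf φ hφi]
  simp_rw [hdiv]
  rw [integral_finsetSum _ fun i _ =>
    (integrable_fderiv_apply_const (hφp i) (hφc i) _).integrableOn]
  have hinn : ∀ x, ⟪φ x, f x⟫ = ∑ i, φ x i * f x i := fun x => by
    simp [PiLp.inner_apply, mul_comm]
  simp_rw [hinn]
  rw [integral_finsetSum _ fun i _ => hmi i, ← Finset.sum_neg_distrib]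
  refine Finset.sum_congr rfl fun i _ => ?_
  rw [hαβ i _ (hφp i) (hφc i), hmul i]


open Classical in
lemma reducedBoundary_regularity (hn : 3 ≤ n) {L : Set (Eucl n)} (hL : HasFinitePerimeter L) :
    surfaceArea L < ∞ ∧
    AEStronglyMeasurable (outerNormal L) ((surfaceMeasure n).restrict (reducedBoundary L)) ∧
    (∀ᵐ y ∂(surfaceMeasure n).restrict (reducedBoundary L), ‖outerNormal L y‖ = 1) ∧
    ((surfaceMeasure n).restrict (reducedBoundary L) = 0 ∨ ∀ u : Eucl n, ‖u‖ = 1 →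
      0 < cosSupport ((surfaceMeasure n).restrict (reducedBoundary L)) (outerNormal L) u) := by
  have h := exists_isGradMeasure hn hL
  refine reducedBoundary_regularity_of_isGradMeasure hn hL.1 ?_
  rw [gradMeasure, dif_pos h]
  exact h.choose_spec

lemma IsConvexBodyWithSupport.congr {K : Set (Eucl n)} {h h' : Eucl n → ℝ}
    (hK : IsConvexBodyWithSupport K h) (hh : ∀ u : Eucl n, ‖u‖ = 1 → h u = h' u) :
    IsConvexBodyWithSupport K h' :=
  ⟨hK.1, hK.2.1, hK.2.2.1, fun u hu => hh u hu ▸ hK.2.2.2 u hu⟩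

end IsoZonal

end

/-! ### The theorem. -/

theorem theorem2 (n : ℕ) (hn : 3 ≤ n) (e : USphere n) (μ : Measure (USphere n))
    (hμe : IsEvenMeasure μ) (hμz : IsZonal e μ) (hμ : μ univ = 1 / 2)
    (L : Set (Eucl n)) (hL : HasFinitePerimeter L) (hint : (interior L).Nonempty) :
    -- the objects are well defined
    (surfaceArea L < ∞ ∧
      (∀ u : Eucl n, ‖u‖ = 1 →
        IntegrableOn (fun x => |⟪u, outerNormal L x⟫|) (reducedBoundary L) (surfaceMeasure n) ∧
        IntegrableOn (fun x => supportFn (zonoidAt μ e u) (outerNormal L x))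
          (reducedBoundary L) (surfaceMeasure n)) ∧
      IsConvexBodyWithSupport (projBody L) (projSupport L) ∧
      IsConvexBodyWithSupport (phiBody μ e L) (phiSupport μ e L)) ∧
    -- the two inequalities
    ENNReal.ofReal ((n : ℝ) ^ n * omega n ^ (n + 1) / omega (n - 1) ^ n) * (surfaceArea L ^ n)⁻¹ ≤
      volume (polarBody (phiBody μ e L)) ∧
    volume (polarBody (phiBody μ e L)) ≤ volume (polarBody (projBody L)) ∧
    -- equality on the left
    (ENNReal.ofReal ((n : ℝ) ^ n * omega n ^ (n + 1) / omega (n - 1) ^ n) * (surfaceArea L ^ n)⁻¹ =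
      volume (polarBody (phiBody μ e L)) ↔ IsBall (phiBody μ e L)) ∧
    -- equality on the right
    (volume (polarBody (phiBody μ e L)) = volume (polarBody (projBody L)) ↔
      IsDiscreteMeasure μ ∨ IsBall (projBody L)) ∧
    -- Petty's projection inequality for `L` implies the inequality
    -- `|Φ^{μ,∘} L| |L|^(n-1) ≤ (ω_n / ω_{n-1})^n`
    (volume (polarBody (projBody L)) * volume L ^ (n - 1) ≤
        ENNReal.ofReal ((omega n / omega (n - 1)) ^ n) →
      volume (polarBody (phiBody μ e L)) * volume L ^ (n - 1) ≤
        ENNReal.ofReal ((omega n / omega (n - 1)) ^ n)) ∧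
    -- and that inequality implies the isoperimetric inequality for `L`
    (volume (polarBody (phiBody μ e L)) * volume L ^ (n - 1) ≤
        ENNReal.ofReal ((omega n / omega (n - 1)) ^ n) →
      ENNReal.ofReal ((n : ℝ) ^ n * omega n) * volume L ^ (n - 1) ≤ surfaceArea L ^ n) := by
  classical
  obtain ⟨hfin, hν, hν1, hdeg⟩ := reducedBoundary_regularity hn hL
  set σ := (surfaceMeasure n).restrict (reducedBoundary L) with hσ
  have hσu : σ univ = surfaceArea L := by rw [hσ, Measure.restrict_apply_univ]; rfl
  have : IsFiniteMeasure σ := ⟨by rw [hσu]; exact hfin⟩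
  have := isFiniteMeasure_of_half hμ
  have hphi : ∀ u : Eucl n, ‖u‖ = 1 →
      zonalSupport σ (outerNormal L) μ e u = phiSupport μ e L u := by
    intro u hu
    unfold zonalSupport phiSupport
    simp_rw [supportFn_zonoidAt hn hμz hu]
    -- One side integrates h(Z(u), ν), the other h(Z(ν), u); they agree on unit vectors by symmetry.
    exact (integral_congr_ae (zonoidSupport_ae_symm hn hμz hν1 hu)).symm
  have hbody : phiBody μ e L = bodyOf (zonalSupport σ (outerNormal L) μ e) :=
    (bodyOf_congr hphi).symm
  have hproj : projSupport L = cosSupport σ (outerNormal L) := rfl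
  have hvol := volume_polar_inequalities hn hμz hμ hν hν1 hdeg
  rw [hσu, ← hbody] at hvol
  have hprojB : projBody L = bodyOf (cosSupport σ (outerNormal L)) := rfl
  rw [← hprojB] at hvol
  obtain ⟨h1, h2, h3, h4⟩ := hvol
  -- Nonempty interior gives positive volume, which the isoperimetric step needs to rule out zero
  -- perimeter.
  have hV : volume L ≠ 0 := by
    have := isOpen_interior.measure_pos (volume : Measure (Eucl n)) hint
    exact (this.trans_le (measure_mono interior_subset)).ne'
  refine ⟨⟨hfin, fun u hu => ⟨integrable_abs_inner hν hν1 u, ?_⟩, ?_, ?_⟩, h1, h2, h3, h4,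
    fun hp => le_trans (by gcongr) hp, fun hp => isoperimetric_of_polar_inequality hn hV h1 hp⟩
  · show Integrable _ σ
    simp_rw [supportFn_zonoidAt hn hμz hu]
    exact (integrable_zonoidSupport hn hμz hν hν1 u).congr
      (zonoidSupport_ae_symm hn hμz hν1 hu).symm
  · rw [hprojB, hproj]
    exact (isSublinear_cosSupport hν hν1).isConvexBodyWithSupport (by omega)
  · rw [hbody]
    exact ((isSublinear_zonalSupport hn hμz hν hν1).isConvexBodyWithSupport (by omega)).congr hphi
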